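/- Let $b\in\mathbb C$ with $\operatorname{Re} b>0$ and put $c_b=\tfrac{i}{2}(b+b^{-1})$. Let $\Phi_b$ be Faddeev's quantum dilogarithm, that is, the meromorphic function on $\mathbb C$ which in the strip $|\operatorname{Im} z|<\operatorname{Im} c_b$ is given by $$\Phi_b(z)=\exp\left(\int_{i0-\infty}^{i0+\infty}\frac{e^{-2izw}\,dw}{4\sinh(wb)\sinh(w/b)\,w}\right),$$ and which is continued to $\mathbb C$ by the functional equation $\Phi_b(z-ib/2)=(1+e^{2\pi bz})\,\Phi_b(z+ib/2)$. Let $$\phi_b(x,y)=(W\Phi_b)(x,y)=e^{\pi i xy}\sum_{m\in\mathbb Z}\Phi_b(x+m)\,e^{2\pi i m y}$$ be its Weil–Gel'fand–Zak transform, and put $$\xi(x)=\prod_{m,n\ge 0}\left(1-e^{2\pi(ix-bm-b^{-1}n)}\right),\qquad \chi(x,y)=\xi(c_b-x)\,\xi(-y)\,\xi(x+y+\tfrac12).$$ **Proposition.** The product defining $\xi$ converges for every $x\in\mathbb C$, $\chi$ is an entire function on $\mathbb C^2$, and the closed set $\chi^{-1}(0)$ has empty interior. At the points of the domain $\{(x,y)\in\mathbb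 C^2:\operatorname{Im}x>-\operatorname{Im}y>0\}$ where $\chi\neq0$ the series for $\phi_b$ converges absolutely, and the function $\phi_b\chi$ defined there extends to an analytic function on $\mathbb C^2$. Consequently $\phi_b$ extends to a meromorphic function on $\mathbb C^2$ that is holomorphic off $\chi^{-1}(0)$ (all its poles are contained in $\chi^{-1}(0)$), and its product with $\chi$ is that entire function. -/

import Mathlib

open Complex Topology

noncomputable section

namespace WGZ

/-- `c_b = i (b + b⁻¹) / 2`. -/
def cb (b : ℂ) : ℂ := I * (b + b⁻¹) / 2

/-- The integrand `e^{-2izw} / (4 sinh(wb) sinh(w/b) w)`. -/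
def faddeevIntegrand (b z w : ℂ) : ℂ :=
  exp (-2 * I * z * w) / (4 * sinh (w * b) * sinh (w / b) * w)

/-- Height of the horizontal contour. For `Re b > 0` the poles of the integrand in the open upper
half plane are `π i n b` and `π i n b⁻¹` with `n ≥ 1`; they have imaginary part at least
`π * min (Re b) (Re b⁻¹)`, so that the line `Im w = contourHeight b` separates them from `0`
and is homotopic, off the poles, to the real axis avoiding `0` from above. -/
def contourHeight (b : ℂ) : ℝ := min b.re (b⁻¹).re

/-- The integral `exp (∫ e^{-2izw} / (4 sinh(wb) sinh(w/b) w) dw)` from `i0 - ∞` to `i0 + ∞`, which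
defines Faddeev's quantum dilogarithm in the strip `|Im z| < Im c_b`. -/
def faddeevIntegral (b z : ℂ) : ℂ :=
  exp (∫ t : ℝ, faddeevIntegrand b z ((t : ℂ) + (contourHeight b : ℂ) * I))

/-- Faddeev's quantum dilogarithm `Φ_b` on all of `ℂ` (for `Re b > 0`): the meromorphic
continuation of `faddeevIntegral b` by means of the functional equation
`Φ_b (z - ib/2) = (1 + e^{2πbz}) Φ_b (z + ib/2)`. The argument is first moved by `-i b k` into the
strip `|Im| ≤ Re b / 2`, which lies inside `|Im| < Im c_b = (Re b + Re b⁻¹) / 2`.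
At a pole the value is `0` (division by zero). -/
def faddeev (b z : ℂ) : ℂ :=
  let k : ℤ := round (z.im / b.re)
  faddeevIntegral b (z - I * b * (k : ℂ)) *
      (∏ j ∈ Finset.range (-k).toNat,
        (1 + exp (2 * (Real.pi : ℂ) * b * (z + I * b * ((j : ℂ) + 1 / 2))))) /
    (∏ j ∈ Finset.range k.toNat,
        (1 + exp (2 * (Real.pi : ℂ) * b * (z - I * b * ((j : ℂ) + 1 / 2)))))

/-- The `m`-th term of the series in the Weil–Gel'fand–Zak transform. -/
def wgzTerm (f : ℂ → ℂ) (x y : ℂ) (m : ℤ) : ℂ :=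
  f (x + (m : ℂ)) * exp (2 * (Real.pi : ℂ) * I * (m : ℂ) * y)

/-- The Weil–Gel'fand–Zak transform
`(Wf)(x,y) = e^{πixy} ∑_{m ∈ ℤ} f(x+m) e^{2πimy}`. -/
def wgz (f : ℂ → ℂ) (p : ℂ × ℂ) : ℂ :=
  exp ((Real.pi : ℂ) * I * p.1 * p.2) * ∑' m : ℤ, wgzTerm f p.1 p.2 m

/-- `φ_b = W Φ_b`, as given by the series. -/
def phi (b : ℂ) (p : ℂ × ℂ) : ℂ := wgz (faddeev b) p

/-- The domain `Im x > - Im y > 0` on which the series for `φ_b` converges absolutely. -/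
def seriesDomain : Set (ℂ × ℂ) := {p | 0 < -p.2.im ∧ -p.2.im < p.1.im}

/-- The factor `1 - e^{2π(ix - bm - b⁻¹n)}`. -/
def xiFactor (b x : ℂ) (mn : ℕ × ℕ) : ℂ :=
  1 - exp (2 * (Real.pi : ℂ) * (I * x - b * (mn.1 : ℂ) - b⁻¹ * (mn.2 : ℂ)))

/-- `ξ(x) = ∏_{m,n ≥ 0} (1 - e^{2π(ix - bm - b⁻¹n)})`. -/
def xi (b x : ℂ) : ℂ := ∏' mn : ℕ × ℕ, xiFactor b x mn

/-- `χ(x,y) = ξ(c_b - x) ξ(-y) ξ(x + y + 1/2)`. -/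
def chi (b : ℂ) (p : ℂ × ℂ) : ℂ :=
  xi b (cb b - p.1) * xi b (-p.2) * xi b (p.1 + p.2 + 1 / 2)

/-- `f` is a meromorphic function on `ℂ²` whose poles lie in the thin closed set `P`:
it is holomorphic off `P`, and near every point of `ℂ²` it is a quotient `g / h` of two
holomorphic functions where `h` does not vanish off `P`. The values of `f` on `P` are irrelevant. -/
structure IsMeromorphicWithPolesIn (f : ℂ × ℂ → ℂ) (P : Set (ℂ × ℂ)) : Prop where
  isClosed : IsClosed P
  interior_eq_empty : interior P = ∅
  analytic_off : AnalyticOnNhd ℂ f Pᶜ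
  local_quotient : ∀ p : ℂ × ℂ, ∃ U ∈ 𝓝 p, ∃ g h : ℂ × ℂ → ℂ,
    AnalyticOnNhd ℂ g U ∧ AnalyticOnNhd ℂ h U ∧ ∀ q ∈ U \ P, h q ≠ 0 ∧ f q = g q / h q

end WGZ

end

/-! Since ξ has period 1, multiplying the series by ξ(c_b - x) replaces Φ_b by Θ(z) = Φ_b(z) ξ(c_b -
z). This function is entire, because the zeros of ξ(c_b - z) cancel the poles of Φ_b
(`differentiable_theta`). The series of Θ splits into two one-sided series. The half m < 0 is
`zakSum` of Θ; it converges for Im y < 0, as Θ is bounded for Re z → -∞. The inversion relation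
Φ_b(z) Φ_b(-z) = Φ_b(0)² e^{πiz²} makes e^{-πiz²} Θ(-z) bounded there as well, and the half m ≥ 0
is, up to an exponential factor, `zakSum` of this function at (1 - x, -(x + y + 1/2)), convergent
for Im (x + y) > 0. The factors ξ(-y) and ξ(x + y + 1/2) of χ continue the two halves.

To see this, let S be the shift by 1 and q_{kl} = e^{-2π(bk + l/b)}. Multiplying the one-sided
series of f by 1 - q e^{-2πiy} gives the series of f - q S f, up to an entire boundary term
(`zakSum_sub_mul`), and the series converges for Im y < σ as soon as f = O(e^{2πσ Re z}). As ξ(-y)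
is the product of all 1 - q_{kl} e^{-2πiy}, it suffices that for every σ finitely many operators 1 -
q_{kl} S turn f into a function decaying at rate σ. This property is `IsTame`.

Heuristically f has an expansion in the exponentials e^{2π(bk + l/b)z}, each killed by its own
operator. The double expansion is never constructed. Instead, the functional equation f(z + ib) -
f(z) = c e^{2πbz} f(z + d) gains a factor e^{2πbz} for the ib-difference. A Cauchy formula with an
ib-periodic kernel (`integral_slant_eq`) shows that a bounded function whose ib-difference is
O(e^{2πσ Re z}) is, to this order, a combination of finitely many e^{2πnz/b} on each horizontal line
(`exists_expansion`); a single row of operators kills these. Alternating the two steps gives any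
rate (`isTame_of_diff`).

The functional equation and the inversion relation of Φ_b come from the defining integral by the
residue at the origin (`integral_line_sub_integral_line`), first in the strip of definition and then
on translated strips. -/

noncomputable section

namespace WGZ

open Filter MeasureTheory Set

/-! ### Entire infinite products `∏ (1 - aᵢ u)` -/

/-- The product `∏ (1 - aᵢ u)`, an entire function of `u` when `a` is absolutely summable. -/
def qprod {ι : Type*} (a : ι → ℂ) (u : ℂ) : ℂ := ∏' i, (1 - a i * u)

section qprod

variable {ι : Type*} {a : ι → ℂ}

lemma summable_norm_neg_mul (ha : Summable fun i => ‖a i‖) (u : ℂ) :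
    Summable fun i => ‖-(a i * u)‖ := by
  simpa [norm_mul] using ha.mul_right ‖u‖

lemma multipliable_one_sub_mul (ha : Summable fun i => ‖a i‖) (u : ℂ) :
    Multipliable fun i => 1 - a i * u := by
  simpa [sub_eq_add_neg] using multipliable_one_add_of_summable (summable_norm_neg_mul ha u)

lemma qprod_ne_zero (ha : Summable fun i => ‖a i‖) {u : ℂ} (hu : ∀ i, 1 - a i * u ≠ 0) :
    qprod a u ≠ 0 := by
  have := tprod_one_add_ne_zero_of_summable (f := fun i => -(a i * u))
    (by simpa [sub_eq_add_neg] using hu) (summable_norm_neg_mul ha u)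
  simpa [qprod, sub_eq_add_neg] using this

lemma qprod_eq_zero {u : ℂ} (i : ι) (hi : 1 - a i * u = 0) : qprod a u = 0 :=
  tprod_of_exists_eq_zero ⟨i, hi⟩

lemma differentiable_qprod (ha : Summable fun i => ‖a i‖) : Differentiable ℂ (qprod a) := by
  intro u
  set K : Set ℂ := Metric.ball 0 (‖u‖ + 1)
  have hK : u ∈ K := by simp [K]
  have h := Summable.hasProdLocallyUniformlyOn_one_add (f := fun i x => -(a i * x)) (K := K)
    Metric.isOpen_ball (ha.mul_right (‖u‖ + 1)) (.of_forall fun i x hx => by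
      rw [norm_neg, norm_mul]
      have : ‖x‖ < ‖u‖ + 1 := by simpa [K] using hx
      gcongr) (fun i => by fun_prop)
  have h2 := h.differentiableOn (.of_forall fun s => by
    simpa [Finset.prod_fn] using DifferentiableOn.finsetProd (fun _ _ ↦ by fun_prop))
    Metric.isOpen_ball
  have h3 := h2.differentiableAt (Metric.isOpen_ball.mem_nhds hK)
  simpa [qprod, sub_eq_add_neg, Function.comp_def] using! h3

/-- Splitting off finitely many factors serves to trade them, one by one, for difference operators,
while the entire remainder stays outside. -/
lemma qprod_eq_prod_mul (ha : Summable fun i => ‖a i‖) (s : Finset ι) (u : ℂ) :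
    qprod a u = (∏ i ∈ s, (1 - a i * u)) * qprod (fun i : ((s : Set ι)ᶜ : Set ι) => a i) u := by
  have h := Multipliable.tprod_mul_tprod_compl (f := fun i => 1 - a i * u) (s := (s : Set ι))
    (Finset.multipliable s _)
    (multipliable_one_sub_mul (a := fun i : ((s : Set ι)ᶜ : Set ι) => a i)
      (ha.comp_injective Subtype.coe_injective) u)
  rw [Finset.tprod_subtype' s (fun i => 1 - a i * u)] at h
  exact h.symm

end qprod

lemma summable_norm_pow_mul_pow {s t : ℂ} (hs : ‖s‖ < 1) (ht : ‖t‖ < 1) :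
    Summable fun p : ℕ × ℕ => ‖s ^ p.1 * t ^ p.2‖ := by
  have := (summable_geometric_of_lt_one (norm_nonneg s) hs).mul_of_nonneg
    (summable_geometric_of_lt_one (norm_nonneg t) ht) (fun _ => by positivity)
    (fun _ => by positivity)
  simpa using this

lemma hasProd_qprod {ι : Type*} {a : ι → ℂ} (ha : Summable fun i => ‖a i‖) (u : ℂ) :
    HasProd (fun i => 1 - a i * u) (qprod a u) :=
  (multipliable_one_sub_mul ha u).hasProd

lemma hasProd_qprod_fiberwise {ι κ : Type*} {a : ι × κ → ℂ} (ha : Summable fun i => ‖a i‖)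
    (hrow : ∀ i, Summable fun k => ‖a (i, k)‖) (u : ℂ) :
    HasProd (fun i => qprod (fun k => a (i, k)) u) (qprod a u) :=
  (hasProd_qprod ha u).prod_fiberwise fun i => hasProd_qprod (hrow i) u

/-- The row with s-exponent 0 is split off. In the other rows one factor s is moved into the
variable, as s^(m+1) u = s^m (us). -/
lemma qprod_pow_mul_pow {s t : ℂ} (hs : ‖s‖ < 1) (ht : ‖t‖ < 1) (u : ℂ) :
    qprod (fun p : ℕ × ℕ => s ^ p.1 * t ^ p.2) u =
      qprod (fun n : ℕ => t ^ n) u * qprod (fun p : ℕ × ℕ => s ^ p.1 * t ^ p.2) (u * s) := by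
  have hrow (m : ℕ) : Summable fun n : ℕ => ‖s ^ m * t ^ n‖ := by
    simpa using (summable_geometric_of_lt_one (norm_nonneg t) ht).mul_left (‖s‖ ^ m)
  have h1 (u : ℂ) : HasProd (fun m : ℕ => qprod (fun n : ℕ => s ^ m * t ^ n) u)
      (qprod (fun p : ℕ × ℕ => s ^ p.1 * t ^ p.2) u) :=
    hasProd_qprod_fiberwise (summable_norm_pow_mul_pow hs ht) hrow u
  have h2 (m : ℕ) : qprod (fun n : ℕ => s ^ (m + 1) * t ^ n) u =
      qprod (fun n : ℕ => s ^ m * t ^ n) (u * s) := by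
    simp only [qprod]; congr 1; ext n; ring
  have h3 : HasProd (fun m : ℕ => qprod (fun n : ℕ => s ^ (m + 1) * t ^ n) u)
      (qprod (fun p : ℕ × ℕ => s ^ p.1 * t ^ p.2) (u * s)) := by
    rw [funext h2]; exact h1 (u * s)
  have h4 := HasProd.zero_mul (f := fun m : ℕ => qprod (fun n : ℕ => s ^ m * t ^ n) u) h3
  have h5 : qprod (fun n : ℕ => s ^ 0 * t ^ n) u = qprod (fun n : ℕ => t ^ n) u := by simp
  rw [h5] at h4
  exact HasProd.unique (h1 u) h4

/-! ### The functions `ξ` and `χ` -/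

lemma inv_re_pos {b : ℂ} (hb : 0 < b.re) : 0 < (b⁻¹).re := by
  rw [Complex.inv_re]
  exact div_pos hb (normSq_pos.2 (by rintro rfl; simp at hb))

lemma ne_zero_of_re_pos {b : ℂ} (hb : 0 < b.re) : b ≠ 0 := by
  rintro rfl; simp at hb

/-- `e^{-2πp}`. -/
def nome (p : ℂ) : ℂ := exp (-(2 * Real.pi * p))

lemma norm_nome_lt_one {p : ℂ} (hp : 0 < p.re) : ‖nome p‖ < 1 := by
  rw [nome, norm_exp, Real.exp_lt_one_iff]
  simp
  positivity

/-- The coefficients `e^{-2π(bm + b⁻¹n)}` of the product `ξ`. -/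
def xiCoeff (b : ℂ) (p : ℕ × ℕ) : ℂ := nome b ^ p.1 * nome b⁻¹ ^ p.2

lemma xiFactor_eq (b x : ℂ) (p : ℕ × ℕ) :
    xiFactor b x p = 1 - xiCoeff b p * exp (2 * Real.pi * I * x) := by
  rw [xiFactor, xiCoeff, nome, nome, ← Complex.exp_nat_mul, ← Complex.exp_nat_mul,
    ← Complex.exp_add, ← Complex.exp_add]
  congr 2; ring

lemma xi_eq (b x : ℂ) : xi b x = qprod (xiCoeff b) (exp (2 * Real.pi * I * x)) := by
  simp only [xi, xiFactor_eq, qprod]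

lemma summable_xiCoeff {b : ℂ} (hb : 0 < b.re) : Summable fun p => ‖xiCoeff b p‖ :=
  summable_norm_pow_mul_pow (norm_nome_lt_one hb) (norm_nome_lt_one (inv_re_pos hb))

lemma multipliable_xiFactor {b : ℂ} (hb : 0 < b.re) (x : ℂ) : Multipliable (xiFactor b x) := by
  have := multipliable_one_sub_mul (summable_xiCoeff hb) (exp (2 * Real.pi * I * x))
  simpa only [← xiFactor_eq] using this

lemma differentiable_xi {b : ℂ} (hb : 0 < b.re) : Differentiable ℂ (xi b) := by
  have : xi b = fun x => qprod (xiCoeff b) (exp (2 * Real.pi * I * x)) := funext (xi_eq b)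
  rw [this]
  exact (differentiable_qprod (summable_xiCoeff hb)).comp (by fun_prop)

lemma xi_add_int (b x : ℂ) (m : ℤ) : xi b (x + m) = xi b x := by
  rw [xi_eq, xi_eq]
  congr 1
  rw [show 2 * Real.pi * I * (x + m) = 2 * Real.pi * I * x + m * (2 * Real.pi * I) by ring,
    Complex.exp_add, Complex.exp_int_mul_two_pi_mul_I, mul_one]

/-- `∏_{n ≥ 0} (1 - e^{2π(ix - b⁻¹n)})`. -/
def xiRow (b x : ℂ) : ℂ := qprod (fun n : ℕ => nome b⁻¹ ^ n) (exp (2 * Real.pi * I * x))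

lemma summable_xiRow {b : ℂ} (hb : 0 < b.re) : Summable fun n : ℕ => ‖nome b⁻¹ ^ n‖ := by
  simpa using summable_geometric_of_lt_one (norm_nonneg _) (norm_nome_lt_one (inv_re_pos hb))

lemma differentiable_xiRow {b : ℂ} (hb : 0 < b.re) : Differentiable ℂ (xiRow b) :=
  (differentiable_qprod (summable_xiRow hb)).comp (by fun_prop)

/-- Adding ib to x multiplies e^{2πix} by `nome b`. This is the counterpart for ξ of the functional
equation of Φ_b, and it matches the rows of ξ with the successive denominators of Φ_b. -/
lemma xi_eq_xiRow_mul {b : ℂ} (hb : 0 < b.re) (x : ℂ) :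
    xi b x = xiRow b x * xi b (x + I * b) := by
  rw [xi_eq, xi_eq, xiRow]
  have := qprod_pow_mul_pow (norm_nome_lt_one hb) (norm_nome_lt_one (inv_re_pos hb))
    (exp (2 * Real.pi * I * x))
  rw [show xiCoeff b = fun p => nome b ^ p.1 * nome b⁻¹ ^ p.2 from rfl, this]
  congr 2
  rw [nome, ← Complex.exp_add]
  congr 1
  linear_combination (-2 * (Real.pi : ℂ) * b) * I_sq

/-- Each factor is 1 minus a number of modulus less than 1. -/
lemma xi_ne_zero {b : ℂ} (hb : 0 < b.re) {x : ℂ} (hx : 0 < x.im) : xi b x ≠ 0 := by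
  rw [xi_eq]
  refine qprod_ne_zero (summable_xiCoeff hb) fun p h => ?_
  have h1 : ‖xiCoeff b p * exp (2 * Real.pi * I * x)‖ = 1 := by
    rw [← sub_eq_zero.1 h]; simp
  have h2 : ‖exp (2 * Real.pi * I * x)‖ < 1 := by
    rw [norm_exp, Real.exp_lt_one_iff]
    simp; positivity
  have h3 : ‖xiCoeff b p‖ ≤ 1 := by
    rw [xiCoeff, norm_mul, norm_pow, norm_pow]
    exact mul_le_one₀ (pow_le_one₀ (norm_nonneg _) (norm_nome_lt_one hb).le) (by positivity)
      (pow_le_one₀ (norm_nonneg _) (norm_nome_lt_one (inv_re_pos hb)).le)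
  rw [norm_mul] at h1
  nlinarith [norm_nonneg (xiCoeff b p), norm_nonneg (exp (2 * Real.pi * I * x))]

lemma xiRow_eq_zero {b x : ℂ} (n : ℕ) (h : exp (2 * Real.pi * (I * x - b⁻¹ * n)) = 1) :
    xiRow b x = 0 := by
  refine qprod_eq_zero n ?_
  rw [nome, ← Complex.exp_nat_mul, ← Complex.exp_add, sub_eq_zero, ← h]
  congr 1; ring

lemma analyticOnNhd_chi {b : ℂ} (hb : 0 < b.re) : AnalyticOnNhd ℂ (chi b) Set.univ := by
  intro p _
  have h (z : ℂ) : AnalyticAt ℂ (xi b) z := (differentiable_xi hb).analyticAt z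
  unfold chi
  refine ((AnalyticAt.fun_comp (h _) ?_).mul (AnalyticAt.fun_comp (h _) ?_)).mul
    (AnalyticAt.fun_comp (h _) ?_) 
  · exact analyticAt_const.sub analyticAt_fst
  · exact analyticAt_snd.neg
  · exact (analyticAt_fst.add analyticAt_snd).add analyticAt_const

lemma interior_chi_zero {b : ℂ} (hb : 0 < b.re) : interior {p | chi b p = 0} = ∅ := by
  by_contra hne
  obtain ⟨p, hp⟩ := nonempty_iff_ne_empty.2 hne
  have h0 : chi b =ᶠ[𝓝 p] 0 := mem_interior_iff_mem_nhds.1 hp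
  have h1 := (analyticOnNhd_chi hb).eqOn_zero_of_preconnected_of_eventuallyEq_zero
    isPreconnected_univ (mem_univ p) h0
  set t : ℝ := (b.re + (b⁻¹).re) / 2
  have ht : 0 < t := by have := inv_re_pos hb; simp only [t]; positivity
  have hc : (cb b).im = t := by simp [cb, t]
  -- At this point all three arguments of ξ in χ have imaginary part t/3 > 0.
  have h2 := h1 (mem_univ (cb b - t / 3 * I, -(t / 3 * I)))
  simp only [chi, Pi.zero_apply, mul_eq_zero] at h2
  rcases h2 with (h2 | h2) | h2
  · refine xi_ne_zero hb ?_ h2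
    simp; positivity
  · refine xi_ne_zero hb ?_ h2
    simp; positivity
  · refine xi_ne_zero hb ?_ h2
    simp [hc]; linarith

end WGZ

end

noncomputable section

namespace WGZ

open Filter MeasureTheory Set

/-! ### Contour shifts -/

/-- Cauchy's theorem for the parallelogram with vertices `w₀ + t₁`, `w₀ + t₂`, `w₀ + t₁ + v`,
`w₀ + t₂ + v`. -/
lemma integral_boundary_parallelogram {φ : ℂ → ℂ} {w₀ v : ℂ} {t₁ t₂ : ℝ} (h : t₁ ≤ t₂)
    (hφ : ∀ t ∈ Icc t₁ t₂, ∀ s ∈ Icc (0 : ℝ) 1, AnalyticAt ℂ φ (w₀ + t + s * v)) :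
    (∫ s in (0 : ℝ)..1, v * φ (w₀ + t₂ + s * v)) - (∫ s in (0 : ℝ)..1, v * φ (w₀ + t₁ + s * v)) =
      (∫ t in t₁..t₂, φ (w₀ + t + v)) - ∫ t in t₁..t₂, φ (w₀ + t) := by
  set A : ℝ × ℝ → ℂ := fun p => w₀ + p.1 + p.2 * v with hA
  set L : ℝ × ℝ →L[ℝ] ℂ := (ContinuousLinearMap.fst ℝ ℝ ℝ).smulRight (1 : ℂ) +
    (ContinuousLinearMap.snd ℝ ℝ ℝ).smulRight v with hL
  have hAL (p) : HasFDerivAt A L p := by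
    have h1 : HasFDerivAt (fun p : ℝ × ℝ => w₀ + L p) L p := L.hasFDerivAt.const_add w₀
    convert h1 using 2 with q
    simp [hA, hL]; ring
  have hd (p : ℝ × ℝ) (hp : p ∈ Icc t₁ t₂ ×ˢ Icc (0 : ℝ) 1) :
      HasFDerivAt (fun p => φ (A p)) (((ContinuousLinearMap.toSpanSingleton ℂ
        (deriv φ (A p))).restrictScalars ℝ).comp L) p := by
    have := ((hφ p.1 hp.1 p.2 hp.2).differentiableAt.hasDerivAt.hasFDerivAt.restrictScalars ℝ)
    exact HasFDerivAt.comp p this (hAL p)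
  have hsub : Ioo (min t₁ t₂) (max t₁ t₂) ×ˢ Ioo (min (0 : ℝ) 1) (max 0 1) ⊆
      Icc t₁ t₂ ×ˢ Icc (0 : ℝ) 1 := by
    rw [min_eq_left h, max_eq_right h, min_eq_left zero_le_one, max_eq_right zero_le_one]
    exact prod_mono Ioo_subset_Icc_self Ioo_subset_Icc_self
  have hcont : ContinuousOn (fun p => φ (A p)) (uIcc t₁ t₂ ×ˢ uIcc (0 : ℝ) 1) := by
    rw [uIcc_of_le h, uIcc_of_le zero_le_one]
    exact fun p hp => (hd p hp).continuousAt.continuousWithinAt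
  -- In the coordinates (t, s) the point moves with velocities 1 and v, so the divergence is vφ' -
  -- φ'v = 0. This is the Cauchy–Riemann equation.
  have hzero (p : ℝ × ℝ) : (v • ((ContinuousLinearMap.toSpanSingleton ℂ
        (deriv φ (A p))).restrictScalars ℝ).comp L) (1, 0) + (-(((ContinuousLinearMap.toSpanSingleton ℂ
        (deriv φ (A p))).restrictScalars ℝ).comp L)) (0, 1) = 0 := by
    simp [hL]
  have key := integral2_divergence_prod_of_hasFDerivAt (fun p => v * φ (A p)) (fun p => -φ (A p))
    (fun p => v • ((ContinuousLinearMap.toSpanSingleton ℂ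
        (deriv φ (A p))).restrictScalars ℝ).comp L)
    (fun p => -(((ContinuousLinearMap.toSpanSingleton ℂ
        (deriv φ (A p))).restrictScalars ℝ).comp L)) t₁ 0 t₂ 1
    (continuousOn_const.mul hcont) hcont.neg
    (fun p hp => (hd p (hsub hp)).const_mul v) (fun p hp => (hd p (hsub hp)).neg)
    (by simp only [hzero]; exact integrableOn_zero)
  simp only [hzero] at key
  simp only [hA, intervalIntegral.integral_zero, intervalIntegral.integral_neg, ofReal_zero, ofReal_one,
    zero_mul, one_mul, add_zero] at key
  linear_combination -key

/-- A line of integration may be shifted across a strip in which the integrand is holomorphic and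
tends to zero at infinity. -/
lemma integral_line_shift {φ : ℂ → ℂ} {w₀ v : ℂ} {g : ℝ → ℝ}
    (hφ : ∀ t : ℝ, ∀ s ∈ Icc (0 : ℝ) 1, AnalyticAt ℂ φ (w₀ + t + s * v))
    (hg : ∀ᶠ t : ℝ in cocompact ℝ, ∀ s ∈ Icc (0 : ℝ) 1, ‖φ (w₀ + t + s * v)‖ ≤ g t)
    (hg0 : Tendsto g (cocompact ℝ) (𝓝 0))
    (h0 : Integrable fun t : ℝ => φ (w₀ + t)) (h1 : Integrable fun t : ℝ => φ (w₀ + t + v)) :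
    ∫ t : ℝ, φ (w₀ + t + v) = ∫ t : ℝ, φ (w₀ + t) := by
  have side (l : Filter ℕ) (u : ℕ → ℝ) (hu : Tendsto u l (cocompact ℝ)) :
      Tendsto (fun n => ∫ s in (0 : ℝ)..1, v * φ (w₀ + u n + s * v)) l (𝓝 0) := by
    have hb : ∀ᶠ n in l, ‖∫ s in (0 : ℝ)..1, v * φ (w₀ + u n + s * v)‖ ≤ ‖v‖ * g (u n) := by
      filter_upwards [hu.eventually hg] with n hn
      refine (intervalIntegral.norm_integral_le_of_norm_le_const (C := ‖v‖ * g (u n))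
        fun s hs => ?_).trans (by simp)
      rw [uIoc_of_le zero_le_one] at hs
      rw [norm_mul]
      gcongr
      exact hn s (Ioc_subset_Icc_self hs)
    refine squeeze_zero_norm' hb ?_
    simpa using (hg0.comp hu).const_mul ‖v‖
  have hT : Tendsto (fun n : ℕ => (n : ℝ)) atTop atTop := tendsto_natCast_atTop_atTop
  have hB : Tendsto (fun n : ℕ => -(n : ℝ)) atTop atBot := tendsto_neg_atTop_atBot.comp hT
  have e1 := side atTop (fun n => n) (hT.mono_right atTop_le_cocompact)
  have e2 := side atTop (fun n => -n) (hB.mono_right atBot_le_cocompact)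
  have i1 := intervalIntegral_tendsto_integral h1 hB hT
  have i0 := intervalIntegral_tendsto_integral h0 hB hT
  have := tendsto_nhds_unique ((e1.sub e2).congr fun n : ℕ => integral_boundary_parallelogram
    (φ := φ) (w₀ := w₀) (v := v) (t₁ := -(n : ℝ)) (t₂ := n)
    (by linarith [Nat.cast_nonneg (α := ℝ) n]) fun t _ s hs => hφ t s hs) (i1.sub i0)
  rw [sub_zero] at this
  exact (sub_eq_zero.1 this.symm)

lemma integral_div_sq_add_sq {η : ℝ} (hη : 0 < η) : ∫ t : ℝ, η / (t ^ 2 + η ^ 2) = Real.pi := by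
  have h := Measure.integral_comp_div (fun t : ℝ => (1 + t ^ 2)⁻¹) η
  rw [integral_univ_inv_one_add_sq, abs_of_pos hη, smul_eq_mul] at h
  have h2 : (fun t : ℝ => η / (t ^ 2 + η ^ 2)) = fun t => η⁻¹ * (1 + (t / η) ^ 2)⁻¹ := by
    ext t
    have : t ^ 2 + η ^ 2 ≠ 0 := by positivity
    have : η ^ 2 + t ^ 2 ≠ 0 := by positivity
    field_simp; ring
  rw [h2, integral_const_mul, h]
  field_simp

lemma integrable_div_sq_add_sq {η : ℝ} (hη : η ≠ 0) (c : ℝ) :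
    Integrable fun t : ℝ => c / (t ^ 2 + η ^ 2) := by
  have h := (integrable_inv_one_add_sq.comp_div hη).const_mul (c / η ^ 2)
  refine h.congr (.of_forall fun t => ?_)
  have : t ^ 2 + η ^ 2 ≠ 0 := by positivity
  have : η ^ 2 + t ^ 2 ≠ 0 := by positivity
  simp only
  field_simp; ring

lemma ofReal_add_mul_I_ne_zero (t : ℝ) {η : ℝ} (hη : η ≠ 0) : (t : ℂ) + η * I ≠ 0 := by
  intro h; apply hη; simpa using congrArg im h

lemma normSq_ofReal_add_mul_I (t η : ℝ) : ((t : ℂ) + η * I) * (t - η * I) = (t ^ 2 + η ^ 2 : ℝ) := by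
  push_cast; linear_combination (-(η : ℂ) ^ 2) * I_sq

lemma integrable_inv_sub_inv {η η' : ℝ} (hη : η ≠ 0) (hη' : η' ≠ 0) :
    Integrable fun t : ℝ => ((t : ℂ) + η * I)⁻¹ - ((t : ℂ) + η' * I)⁻¹ := by
  have h1 := (integrable_div_sq_add_sq hη (|η' - η| / 2)).add
    (integrable_div_sq_add_sq hη' (|η' - η| / 2))
  refine h1.mono' (Continuous.aestronglyMeasurable ?_) (.of_forall fun t => ?_)
  · refine Continuous.sub (Continuous.inv₀ (by fun_prop) fun t => ofReal_add_mul_I_ne_zero t hη)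
      (Continuous.inv₀ (by fun_prop) fun t => ofReal_add_mul_I_ne_zero t hη')
  · have a1 := ofReal_add_mul_I_ne_zero t hη
    have a2 := ofReal_add_mul_I_ne_zero t hη'
    have hn (η : ℝ) : ‖(t : ℂ) + η * I‖ ^ 2 = t ^ 2 + η ^ 2 := by
      rw [← normSq_eq_norm_sq, normSq_add_mul_I]
    have e : ((t : ℂ) + η * I)⁻¹ - ((t : ℂ) + η' * I)⁻¹ =
        ((η' - η : ℝ) : ℂ) * I / (((t : ℂ) + η * I) * ((t : ℂ) + η' * I)) := by
      rw [inv_sub_inv a1 a2]; congr 1; push_cast; ring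
    rw [e, norm_div, norm_mul, norm_mul, norm_I, mul_one, Complex.norm_real, Real.norm_eq_abs]
    simp only [Pi.add_apply]
    rw [← hn η, ← hn η']
    have p1 := norm_pos_iff.2 a1
    have p2 := norm_pos_iff.2 a2
    set x := ‖(t : ℂ) + η * I‖
    set y := ‖(t : ℂ) + η' * I‖
    rw [div_add_div _ _ (by positivity) (by positivity), div_le_div_iff₀ (by positivity) (by positivity)]
    -- The bound is 1/(xy) ≤ (x⁻² + y⁻²)/2 with denominators cleared.
    have : 0 ≤ |η' - η| * (x * y) * (x - y) ^ 2 := by positivity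
    nlinarith

/-- Adding the integrand at t and at -t cancels the odd parts and leaves the Lorentzians. Their
integrals are kept unevaluated because η and η' may have either sign. -/
lemma integral_inv_sub_inv {η η' : ℝ} (hη : η ≠ 0) (hη' : η' ≠ 0) :
    ∫ t : ℝ, (((t : ℂ) + η * I)⁻¹ - ((t : ℂ) + η' * I)⁻¹) =
      (((∫ t : ℝ, η' / (t ^ 2 + η' ^ 2)) - ∫ t : ℝ, η / (t ^ 2 + η ^ 2) : ℝ) : ℂ) * I := by
  set g : ℝ → ℂ := fun t => ((t : ℂ) + η * I)⁻¹ - ((t : ℂ) + η' * I)⁻¹ with hg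
  have hi : Integrable g := integrable_inv_sub_inv hη hη'
  have h1 : ∫ t, g (-t) = ∫ t, g t := integral_neg_eq_self g volume
  have h2 : ∫ t, (g t + g (-t)) = 2 * ∫ t, g t := by
    rw [integral_add hi hi.comp_neg, h1]; ring
  have h3 (t : ℝ) : g t + g (-t) =
      2 * I * ((η' / (t ^ 2 + η' ^ 2) - η / (t ^ 2 + η ^ 2) : ℝ) : ℂ) := by
    have e (η : ℝ) (hη : η ≠ 0) : ((t : ℂ) + η * I)⁻¹ + ((-t : ℝ) + η * I : ℂ)⁻¹ =
        -2 * I * ((η / (t ^ 2 + η ^ 2) : ℝ) : ℂ) := by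
      have a1 := ofReal_add_mul_I_ne_zero t hη
      have a2 := ofReal_add_mul_I_ne_zero (-t) hη
      have a3 : (((t ^ 2 + η ^ 2 : ℝ)) : ℂ) ≠ 0 := by
        rw [ofReal_ne_zero]; positivity
      rw [ofReal_div]
      rw [inv_add_inv a1 a2, mul_div_assoc', div_eq_div_iff (mul_ne_zero a1 a2) a3]
      rw [← normSq_ofReal_add_mul_I]
      push_cast; ring
    have e1 := e η hη
    have e2 := e η' hη'
    simp only [hg]
    push_cast at e1 e2 ⊢
    linear_combination e1 - e2
  simp_rw [h3] at h2
  rw [integral_const_mul, integral_complex_ofReal,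
    integral_sub (integrable_div_sq_add_sq hη' _) (integrable_div_sq_add_sq hη _)] at h2
  linear_combination -h2 / 2

lemma _root_.AnalyticAt.dslope {f : ℂ → ℂ} {c w : ℂ} (hc : AnalyticAt ℂ f c) (hw : AnalyticAt ℂ f w) :
    AnalyticAt ℂ (dslope f c) w := by
  rcases eq_or_ne w c with rfl | hne
  · obtain ⟨s, hs, hs'⟩ := hw.eventually_analyticAt.exists_mem
    have h1 : DifferentiableOn ℂ f s := fun x hx => (hs' x hx).differentiableAt.differentiableWithinAt
    exact ((Complex.differentiableOn_dslope hs).2 h1).analyticAt hs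
  · have h1 : AnalyticAt ℂ (fun x => (x - c)⁻¹ * (f x - f c)) w :=
      ((analyticAt_id.sub analyticAt_const).inv (sub_ne_zero.2 hne)).mul (hw.sub analyticAt_const)
    refine h1.congr ?_
    filter_upwards [isOpen_ne.mem_nhds hne] with x hx
    rw [dslope_of_ne _ hx, slope_def_module, smul_eq_mul]

/-- The residue theorem for a strip containing a single simple pole, at the origin. -/
lemma integral_line_sub_integral_line {N : ℂ → ℂ} {h₁ h₂ : ℝ} {g : ℝ → ℝ} (hh₁ : 0 < h₁) (hh₂ : 0 < h₂)
    (hN : ∀ w : ℂ, -h₂ ≤ w.im → w.im ≤ h₁ → AnalyticAt ℂ N w)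
    (hg : ∀ᶠ t : ℝ in cocompact ℝ, ∀ y ∈ Icc (-h₂) h₁, ‖N (t + y * I) / (t + y * I)‖ ≤ g t)
    (hg0 : Tendsto g (cocompact ℝ) (𝓝 0))
    (i₁ : Integrable fun t : ℝ => N (t + h₁ * I) / (t + h₁ * I))
    (i₂ : Integrable fun t : ℝ => N (t - h₂ * I) / (t - h₂ * I)) :
    (∫ t : ℝ, N (t + h₁ * I) / (t + h₁ * I)) - (∫ t : ℝ, N (t - h₂ * I) / (t - h₂ * I)) =
      -(2 * Real.pi * I * N 0) := by
  -- An auxiliary pole at -iA, below the strip, balances the pole N(0)/w: the difference 1/w - 1/(w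
  -- + iA) is integrable on horizontal lines, while 1/w is not.
  set A : ℝ := h₂ + 1 with hA
  set φ : ℂ → ℂ := fun w => dslope N 0 w + N 0 * (w + A * I)⁻¹ with hφ
  have φ_eq {w : ℂ} (hw : w ≠ 0) : φ w = N w / w - N 0 * (w⁻¹ - (w + A * I)⁻¹) := by
    simp only [hφ, dslope_of_ne _ hw, slope_def_module, smul_eq_mul, sub_zero]
    rw [div_eq_mul_inv]; ring
  have hne (t : ℝ) {y : ℝ} (hy : -h₂ ≤ y) : (t : ℂ) + y * I + A * I ≠ 0 := by
    have := ofReal_add_mul_I_ne_zero t (η := y + A) (by simp only [hA]; linarith)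
    push_cast at this
    rwa [add_mul, ← add_assoc] at this
  have hφa (w : ℂ) (h1 : -h₂ ≤ w.im) (h2 : w.im ≤ h₁) : AnalyticAt ℂ φ w := by
    refine (AnalyticAt.dslope (hN 0 (by simp; exact hh₂.le) (by simp; exact hh₁.le)) (hN w h1 h2)).add
      (analyticAt_const.mul ((analyticAt_id.add analyticAt_const).inv ?_))
    have := hne w.re h1
    rwa [re_add_im] at this
  have u1 (t : ℝ) : φ (t + h₁ * I) = N (t + h₁ * I) / (t + h₁ * I) -
      N 0 * (((t : ℂ) + h₁ * I)⁻¹ - ((t : ℂ) + (h₁ + A : ℝ) * I)⁻¹) := by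
    rw [φ_eq (ofReal_add_mul_I_ne_zero t hh₁.ne')]; push_cast; ring_nf
  have u2 (t : ℝ) : φ (t - h₂ * I) = N (t - h₂ * I) / (t - h₂ * I) -
      N 0 * (((t : ℂ) + (-h₂ : ℝ) * I)⁻¹ - ((t : ℂ) + (1 : ℝ) * I)⁻¹) := by
    have := ofReal_add_mul_I_ne_zero t (neg_ne_zero.2 hh₂.ne')
    rw [φ_eq (by push_cast at this; rwa [neg_mul, ← sub_eq_add_neg] at this)]
    simp only [hA]; push_cast; ring_nf
  have k1 := integrable_inv_sub_inv hh₁.ne' (show h₁ + A ≠ 0 by positivity)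
  have k2 := integrable_inv_sub_inv (neg_ne_zero.2 hh₂.ne') (one_ne_zero (α := ℝ))
  have v1 := integral_inv_sub_inv hh₁.ne' (show h₁ + A ≠ 0 by positivity)
  have v2 := integral_inv_sub_inv (neg_ne_zero.2 hh₂.ne') (one_ne_zero (α := ℝ))
  have hneg : ∫ t : ℝ, -h₂ / (t ^ 2 + (-h₂) ^ 2) = -Real.pi := by
    rw [← integral_div_sq_add_sq hh₂, ← integral_neg]; congr 1; ext t; rw [neg_sq, neg_div]
  -- On the upper line both poles 0 and -iA lie below and the integral is 0. On the lower line they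
  -- lie on opposite sides and the integral is 2πi.
  rw [integral_div_sq_add_sq hh₁, integral_div_sq_add_sq (by positivity)] at v1
  rw [hneg, integral_div_sq_add_sq one_pos] at v2
  have j1 : Integrable fun t : ℝ => φ (t + h₁ * I) := by
    simp_rw [u1]; exact i₁.sub (k1.const_mul _)
  have j2 : Integrable fun t : ℝ => φ (t - h₂ * I) := by
    simp_rw [u2]; exact i₂.sub (k2.const_mul _)
  have hshift := integral_line_shift (φ := φ) (w₀ := -h₂ * I) (v := (h₁ + h₂) * I)
    (g := fun t => g t + ‖N 0‖ * (2 * ‖t‖⁻¹)) ?_ ?_ ?_ ?_ ?_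
  · have e1 (t : ℝ) : -(h₂ : ℂ) * I + t + (h₁ + h₂) * I = t + h₁ * I := by ring
    have e2 (t : ℝ) : -(h₂ : ℂ) * I + t = t - h₂ * I := by ring
    simp_rw [e1, e2, u1, u2] at hshift
    rw [integral_sub i₁ (k1.const_mul _), integral_sub i₂ (k2.const_mul _), integral_const_mul,
      integral_const_mul, v1, v2] at hshift
    push_cast at hshift
    linear_combination hshift
  · intro t s hs
    have : ((s * (h₁ + h₂) : ℝ)) ∈ Icc 0 (h₁ + h₂) :=
      ⟨by have := hs.1; positivity, by nlinarith [hs.2]⟩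
    apply hφa
    · simp; nlinarith [this.1]
    · simp; nlinarith [this.2]
  · filter_upwards [hg, (isCompact_singleton (x := (0 : ℝ))).compl_mem_cocompact] with t ht ht0 s hs
    have ht0 : t ≠ 0 := ht0
    have hy : (-h₂ + s * (h₁ + h₂)) ∈ Icc (-h₂) h₁ :=
      ⟨by have := hs.1; nlinarith, by nlinarith [hs.2]⟩
    set y := -h₂ + s * (h₁ + h₂) with hydef
    have e : -(h₂ : ℂ) * I + t + s * ((h₁ + h₂) * I) = t + y * I := by
      simp only [hydef]; push_cast; ring
    have hre : ∀ y : ℝ, ‖((t : ℂ) + y * I)⁻¹‖ ≤ ‖t‖⁻¹ := fun y => by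
      rw [norm_inv]
      refine inv_anti₀ (by positivity) ?_
      have := abs_re_le_norm ((t : ℂ) + y * I)
      simpa using this
    rw [e, φ_eq (fun h => ht0 (by simpa using congrArg re h))]
    refine (norm_sub_le _ _).trans (add_le_add (ht y hy) ?_)
    rw [norm_mul]
    gcongr
    refine (norm_sub_le _ _).trans ?_
    have h1 := hre y
    have h2 := hre (y + A)
    push_cast at h2
    rw [add_mul, ← add_assoc] at h2
    linarith
  · have := (tendsto_norm_cocompact_atTop (E := ℝ)).inv_tendsto_atTop
    simpa using hg0.add ((this.const_mul 2).const_mul ‖N 0‖)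
  · refine j2.congr (.of_forall fun t => ?_)
    simp only; congr 1; ring
  · refine j1.congr (.of_forall fun t => ?_)
    simp only; congr 1; ring

end WGZ

end

noncomputable section

namespace WGZ

open Filter MeasureTheory Set

/-! ### Exponential integrals along a horizontal line -/

lemma integrable_exp_neg_mul_abs {a : ℝ} (ha : 0 < a) :
    Integrable fun t : ℝ => Real.exp (-a * |t|) := by
  -- With this m the bound 1 + u + u²/2 ≤ e^u at u = a|t| yields m (1 + t²) ≤ e^{a|t|}.
  set m := min 1 (a ^ 2 / 2) with hm
  have hm0 : 0 < m := by positivity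
  refine (integrable_inv_one_add_sq.const_mul m⁻¹).mono' (by fun_prop) (.of_forall fun t => ?_)
  have h1 := Real.quadratic_le_exp_of_nonneg (x := a * |t|) (by positivity)
  have h2 : m * (1 + t ^ 2) ≤ Real.exp (a * |t|) := by
    have : (a * |t|) ^ 2 = a ^ 2 * t ^ 2 := by rw [mul_pow, sq_abs]
    have e1 : m ≤ 1 := min_le_left _ _
    have e2 : m ≤ a ^ 2 / 2 := min_le_right _ _
    have : 0 ≤ a * |t| := by positivity
    nlinarith [sq_nonneg t]
  rw [Real.norm_eq_abs, Real.abs_exp, neg_mul, Real.exp_neg, ← mul_inv]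
  exact inv_anti₀ (by positivity) h2

lemma norm_exp_line (z : ℂ) (t h : ℝ) :
    ‖exp (-2 * I * z * (t + h * I))‖ = Real.exp (2 * (h * z.re + t * z.im)) := by
  rw [norm_exp]; congr 1; simp; ring

lemma norm_exp_line_le {z : ℂ} {δ : ℝ} (hz : |z.im| ≤ δ) (t h : ℝ) :
    ‖exp (-2 * I * z * (t + h * I))‖ ≤ Real.exp (2 * h * z.re) * Real.exp (2 * δ * |t|) := by
  rw [norm_exp_line, ← Real.exp_add]
  refine Real.exp_le_exp.2 ?_
  have h1 : t * z.im ≤ |t| * |z.im| := (le_abs_self _).trans (abs_mul _ _).le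
  nlinarith [abs_nonneg t]

/-- The integral `∫ e^{-2izw} G(w) dw` along the line `Im w = h`. -/
def lineLaplace (h : ℝ) (G : ℝ → ℂ) (z : ℂ) : ℂ := ∫ t : ℝ, exp (-2 * I * z * (t + h * I)) * G t

section lineLaplace

variable {h κ C : ℝ} {G : ℝ → ℂ}

lemma norm_lineLaplace_integrand_le (hb : ∀ t, ‖G t‖ ≤ C * Real.exp (-κ * |t|)) {z : ℂ} {δ : ℝ}
    (hz : |z.im| ≤ δ) (t : ℝ) : ‖exp (-2 * I * z * (t + h * I)) * G t‖ ≤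
      Real.exp (2 * h * z.re) * C * Real.exp (-(κ - 2 * δ) * |t|) := by
  rw [norm_mul]
  refine (mul_le_mul (norm_exp_line_le hz t h) (hb t) (norm_nonneg _) (by positivity)).trans
    (le_of_eq ?_)
  rw [mul_mul_mul_comm, ← Real.exp_add]; ring_nf

lemma integrable_lineLaplace (hG : Continuous G) (hb : ∀ t, ‖G t‖ ≤ C * Real.exp (-κ * |t|)) {z : ℂ}
    (hz : |z.im| < κ / 2) : Integrable fun t : ℝ => exp (-2 * I * z * (t + h * I)) * G t := by
  refine ((integrable_exp_neg_mul_abs (a := κ - 2 * |z.im|) (by linarith)).const_mul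
    (Real.exp (2 * h * z.re) * C)).mono' (Continuous.aestronglyMeasurable (by fun_prop))
    (.of_forall fun t => norm_lineLaplace_integrand_le hb le_rfl t)

lemma norm_lineLaplace_le (hb : ∀ t, ‖G t‖ ≤ C * Real.exp (-κ * |t|)) {δ : ℝ} (hδ : δ < κ / 2)
    {z : ℂ} (hz : |z.im| ≤ δ) : ‖lineLaplace h G z‖ ≤
      Real.exp (2 * h * z.re) * (C * ∫ t : ℝ, Real.exp (-(κ - 2 * δ) * |t|)) := by
  refine (norm_integral_le_of_norm_le ((integrable_exp_neg_mul_abs (a := κ - 2 * δ)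
    (by linarith)).const_mul _) (.of_forall fun t => norm_lineLaplace_integrand_le hb hz t)).trans
    (le_of_eq ?_)
  rw [integral_const_mul]; ring

lemma hasDerivAt_lineLaplace (hG : Continuous G) (hb : ∀ t, ‖G t‖ ≤ C * Real.exp (-κ * |t|)) {z : ℂ}
    (hz : |z.im| < κ / 2) : HasDerivAt (lineLaplace h G)
      (∫ t : ℝ, exp (-2 * I * z * (t + h * I)) * (-2 * I * (t + h * I) * G t)) z := by
  obtain ⟨δ, hδ1, hδ2⟩ := exists_between hz
  set a := κ - 2 * δ with ha
  have ha0 : 0 < a := by simp only [a]; linarith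
  -- The integrand depends on Re x through e^{2h Re x}, so it is h Re x that has to be bounded
  -- above, whatever the sign of h.
  have hs : {x : ℂ | |x.im| < δ ∧ h * x.re < h * z.re + 1} ∈ 𝓝 z := by
    refine IsOpen.mem_nhds ?_ ⟨hδ1, by linarith⟩
    exact (isOpen_lt continuous_im.abs continuous_const).inter
      (isOpen_lt (continuous_re.const_mul h) continuous_const)
  have hC : 0 ≤ C := by
    have := (norm_nonneg _).trans (hb 0)
    simpa using this
  refine (hasDerivAt_integral_of_dominated_loc_of_deriv_le
    (F := fun z t => exp (-2 * I * z * (t + h * I)) * G t)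
    (F' := fun z t => exp (-2 * I * z * (t + h * I)) * (-2 * I * (t + h * I) * G t))
    (bound := fun t => 2 * (2 / a + |h|) * Real.exp (2 * (h * z.re + 1)) * C *
      Real.exp (-(a / 2) * |t|)) hs
    (.of_forall fun x => Continuous.aestronglyMeasurable (by fun_prop))
    (integrable_lineLaplace hG hb hz)
    (Continuous.aestronglyMeasurable (by fun_prop)) (.of_forall fun t x hx => ?_)
    ((integrable_exp_neg_mul_abs (by positivity)).const_mul _) (.of_forall fun t x hx => ?_)).2
  · have h1 := norm_lineLaplace_integrand_le (h := h) hb hx.1.le t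
    have h2 : exp (-2 * I * x * (t + h * I)) * (-2 * I * (t + h * I) * G t) =
      -2 * I * (t + h * I) * (exp (-2 * I * x * (t + h * I)) * G t) := by ring
    have h3 : ‖-2 * I * ((t : ℂ) + h * I)‖ ≤ 2 * (|t| + |h|) := by
      have : ‖(t : ℂ) + h * I‖ ≤ |t| + |h| := (norm_add_le _ _).trans (by simp)
      simp only [norm_mul, norm_neg, norm_I, mul_one, Complex.norm_ofNat]; linarith
    -- Half of the decay rate a absorbs the linear factor produced by differentiation.
    have h4 : |t| + |h| ≤ (2 / a + |h|) * Real.exp (a / 2 * |t|) := by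
      have e1 := Real.add_one_le_exp (a / 2 * |t|)
      have e2 : 1 ≤ Real.exp (a / 2 * |t|) := Real.one_le_exp (by positivity)
      have e3 : |t| ≤ 2 / a * Real.exp (a / 2 * |t|) := by
        rw [div_mul_eq_mul_div, le_div_iff₀ ha0]; nlinarith
      nlinarith [abs_nonneg h]
    rw [h2, norm_mul]
    refine (mul_le_mul (h3.trans (mul_le_mul_of_nonneg_left h4 zero_le_two)) h1 (norm_nonneg _)
      (by positivity)).trans ?_
    have h5 : Real.exp (-(a / 2) * |t|) = Real.exp (a / 2 * |t|) * Real.exp (-a * |t|) := by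
      rw [← Real.exp_add]; ring_nf
    have h6 : Real.exp (2 * h * x.re) ≤ Real.exp (2 * (h * z.re + 1)) :=
      Real.exp_le_exp.2 (by linarith [hx.2])
    rw [h5, ← ha]
    have : 0 ≤ 2 * (2 / a + |h|) * (C * (Real.exp (a / 2 * |t|) * Real.exp (-a * |t|))) := by positivity
    nlinarith [mul_le_mul_of_nonneg_left h6 this]
  · have := (((hasDerivAt_id x).const_mul (-2 * I)).mul_const ((t : ℂ) + h * I)).cexp.mul_const (G t)
    refine this.congr_deriv ?_
    simp; ring

lemma analyticAt_lineLaplace (hG : Continuous G) (hb : ∀ t, ‖G t‖ ≤ C * Real.exp (-κ * |t|)) {z : ℂ}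
    (hz : |z.im| < κ / 2) : AnalyticAt ℂ (lineLaplace h G) z := by
  have ho : IsOpen {x : ℂ | |x.im| < κ / 2} := isOpen_lt (by fun_prop) continuous_const
  exact DifferentiableOn.analyticAt (s := {x : ℂ | |x.im| < κ / 2}) (fun x hx =>
    (hasDerivAt_lineLaplace hG hb hx).differentiableAt.differentiableWithinAt) (ho.mem_nhds hz)

end lineLaplace

/-! ### Bounds for the hyperbolic sine -/

/-- The zeros of sinh(wp) are -iπk/p with k an integer, and their imaginary parts have modulus |k| π
Re p⁻¹. Only k = 0 fits into the strip. -/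
lemma sinh_ne_zero_of_abs_im_lt {p w : ℂ} (hp : p ≠ 0) (hw0 : w ≠ 0)
    (hw : |w.im| < Real.pi * (p⁻¹).re) : sinh (w * p) ≠ 0 := by
  intro h
  have h1 : Complex.sin (w * p * I) = 0 := by rw [Complex.sin_mul_I, h, zero_mul]
  obtain ⟨k, hk⟩ := Complex.sin_eq_zero_iff.1 h1
  have h2 : w = -(k * Real.pi : ℝ) * I * p⁻¹ := by
    have : w * (p * p⁻¹) * (I * I) = k * Real.pi * I * p⁻¹ := by linear_combination I * p⁻¹ * hk
    rw [mul_inv_cancel₀ hp, I_mul_I] at this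
    push_cast; linear_combination -this
  have h3 : w.im = -(k * Real.pi) * (p⁻¹).re := by
    rw [h2]; simp [mul_assoc]
  have hpos : 0 < Real.pi * (p⁻¹).re := (abs_nonneg _).trans_lt hw
  have h4 : |(k : ℝ)| < 1 := by
    rw [h3, neg_mul, abs_neg, mul_assoc, abs_mul, abs_of_pos hpos] at hw
    by_contra hk1
    nlinarith
  have h5 : k = 0 := by
    have : |k| < 1 := by exact_mod_cast h4
    exact Int.abs_lt_one_iff.1 this
  apply hw0; rw [h2, h5]; simp

/-- With ζ the argument and r = |Re ζ|, one has 2|sinh ζ| ≥ e^r - e^{-r}. The threshold on |t|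
ensures r ≥ 1, hence e^{-r} ≤ e^r / 2, and r ≥ Re p |t| - H |Im p| gives the constant. -/
lemma exp_mul_abs_le_norm_sinh {p : ℂ} (hp : 0 < p.re) {H t y : ℝ} (hy : |y| ≤ H)
    (ht : H * |p.im| + 1 ≤ p.re * |t|) :
    Real.exp (-(H * |p.im|)) / 4 * Real.exp (p.re * |t|) ≤ ‖sinh ((t + y * I) * p)‖ := by
  set ζ : ℂ := (t + y * I) * p with hζ
  have hre : ζ.re = t * p.re - y * p.im := by simp [hζ]
  set r := |ζ.re| with hr
  have hr1 : p.re * |t| - H * |p.im| ≤ r := by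
    rw [hr, hre]
    have h1 := abs_sub_abs_le_abs_sub (t * p.re) (y * p.im)
    rw [abs_mul, abs_mul, abs_of_pos hp] at h1
    have := mul_le_mul_of_nonneg_right hy (abs_nonneg p.im)
    linarith
  have hr2 : Real.exp r - Real.exp (-r) ≤ 2 * ‖sinh ζ‖ := by
    have h1 : 2 * sinh ζ = exp ζ - exp (-ζ) := Complex.two_sinh ζ
    have h2 : 2 * ‖sinh ζ‖ = ‖exp ζ - exp (-ζ)‖ := by rw [← h1, norm_mul]; simp
    rw [h2]
    rcases le_total 0 ζ.re with h | h
    · have := norm_sub_norm_le (exp ζ) (exp (-ζ))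
      rw [norm_exp, norm_exp, neg_re] at this
      rwa [hr, abs_of_nonneg h]
    · have := norm_sub_norm_le (exp (-ζ)) (exp ζ)
      rw [norm_exp, norm_exp, neg_re, norm_sub_rev] at this
      rwa [hr, abs_of_nonpos h, neg_neg]
  have hr3 : Real.exp (-r) ≤ Real.exp r / 2 := by
    have h1 := Real.add_one_le_exp r
    have h2 : Real.exp (-r) ≤ 1 := Real.exp_le_one_iff.2 (by linarith)
    linarith
  have hr4 : Real.exp (-(H * |p.im|)) * Real.exp (p.re * |t|) ≤ Real.exp r := by
    rw [← Real.exp_add]; exact Real.exp_le_exp.2 (by linarith)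
  linarith

/-- The reciprocal of the hyperbolic sine decays uniformly on horizontal strips. -/
lemma eventually_norm_inv_sinh_le {p : ℂ} (hp : 0 < p.re) (H : ℝ) :
    ∃ C, 0 < C ∧ ∀ᶠ t : ℝ in cocompact ℝ, ∀ y : ℝ, |y| ≤ H →
      ‖(sinh ((t + y * I) * p))⁻¹‖ ≤ C * Real.exp (-p.re * |t|) := by
  refine ⟨(Real.exp (-(H * |p.im|)) / 4)⁻¹, by positivity, ?_⟩
  have h1 : Tendsto (fun t : ℝ => p.re * ‖t‖) (cocompact ℝ) atTop :=
    tendsto_norm_cocompact_atTop.const_mul_atTop hp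
  filter_upwards [h1.eventually_ge_atTop (H * |p.im| + 1)] with t ht y hy
  rw [norm_inv, neg_mul, Real.exp_neg (p.re * |t|), ← mul_inv]
  exact inv_anti₀ (by positivity) (exp_mul_abs_le_norm_sinh hp hy ht)

/-- A continuous function on `ℝ` bounded by `C e^{-κ|t|}` at infinity is so bounded everywhere. -/
lemma exists_forall_norm_le_exp {G : ℝ → ℂ} (hG : Continuous G) {C κ : ℝ}
    (hb : ∀ᶠ t : ℝ in cocompact ℝ, ‖G t‖ ≤ C * Real.exp (-κ * |t|)) :
    ∃ C', ∀ t, ‖G t‖ ≤ C' * Real.exp (-κ * |t|) := by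
  obtain ⟨K, hK, hKs⟩ := mem_cocompact.1 hb
  obtain ⟨M, hM⟩ := hK.exists_bound_of_continuousOn (f := fun t => G t * Real.exp (κ * |t|))
    (by fun_prop)
  refine ⟨max C M, fun t => ?_⟩
  by_cases ht : t ∈ K
  · have := hM t ht
    rw [norm_mul, Complex.norm_real, Real.norm_eq_abs, Real.abs_exp] at this
    rw [neg_mul, Real.exp_neg, ← div_eq_mul_inv, le_div_iff₀ (Real.exp_pos _)]
    exact this.trans (le_max_right _ _)
  · exact (hKs ht).trans (mul_le_mul_of_nonneg_right (le_max_left _ _) (Real.exp_pos _).le)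

end WGZ

end

noncomputable section

namespace WGZ

open Filter MeasureTheory Set

/-! ### The Fourier-type integral of 1 / sinh(w/b) -/

lemma tendsto_exp_neg_mul_abs {a : ℝ} (ha : 0 < a) :
    Tendsto (fun t : ℝ => Real.exp (-a * |t|)) (cocompact ℝ) (𝓝 0) := by
  have h1 : Tendsto (fun t : ℝ => a * ‖t‖) (cocompact ℝ) atTop :=
    tendsto_norm_cocompact_atTop.const_mul_atTop ha
  have := Real.tendsto_exp_neg_atTop_nhds_zero.comp h1
  simpa [Function.comp_def] using this

lemma norm_exp_line_le_of_abs_le {z : ℂ} {δ H y : ℝ} (hz : |z.im| ≤ δ) (hy : |y| ≤ H) (t : ℝ) :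
    ‖exp (-2 * I * z * (t + y * I))‖ ≤ Real.exp (2 * H * |z.re|) * Real.exp (2 * δ * |t|) := by
  refine (norm_exp_line_le hz t y).trans ?_
  gcongr ?_ * _
  refine Real.exp_le_exp.2 ?_
  have : y * z.re ≤ |y| * |z.re| := (le_abs_self _).trans (abs_mul _ _).le
  nlinarith [abs_nonneg z.re]

/-- The quotient `sinh (wp) / w`, an entire function of `w`. -/
def sinhQuot (p : ℂ) : ℂ → ℂ := dslope (fun w => sinh (w * p)) 0

lemma sinhQuot_mul (p w : ℂ) : sinhQuot p w * w = sinh (w * p) := by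
  have := sub_smul_dslope (fun w => sinh (w * p)) 0 w
  simp only [sub_zero, zero_mul, Complex.sinh_zero, smul_eq_mul] at this
  rw [mul_comm]; exact this

lemma sinhQuot_zero (p : ℂ) : sinhQuot p 0 = p := by
  have : HasDerivAt (fun w => sinh (w * p)) (cosh (0 * p) * (1 * p)) 0 :=
    ((hasDerivAt_id (0 : ℂ)).mul_const p).csinh
  rw [sinhQuot, dslope_same, this.deriv]; simp

lemma analyticAt_sinhQuot (p w : ℂ) : AnalyticAt ℂ (sinhQuot p) w := by
  have (x : ℂ) : AnalyticAt ℂ (fun w => sinh (w * p)) x :=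
    (show Differentiable ℂ fun w => sinh (w * p) by fun_prop).analyticAt x
  exact (this 0).dslope (this w)

lemma sinhQuot_ne_zero {p w : ℂ} (hp : p ≠ 0) (hw : |w.im| < Real.pi * (p⁻¹).re) :
    sinhQuot p w ≠ 0 := by
  rcases eq_or_ne w 0 with rfl | h0
  · rwa [sinhQuot_zero]
  · intro h
    apply sinh_ne_zero_of_abs_im_lt hp h0 hw
    rw [← sinhQuot_mul, h, zero_mul]

/-- The integral `∫ e^{-2izw} / sinh (w/b) dw` along a line above the origin. -/
lemma integral_inv_sinh {b z : ℂ} (hb : 0 < b.re) {h : ℝ} (h0 : 0 < h) (h1 : h < Real.pi * b.re)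
    (hz : |z.im| < (b⁻¹).re / 2) :
    (∫ t : ℝ, exp (-2 * I * z * (t + h * I)) * (sinh ((t + h * I) * b⁻¹))⁻¹) *
      (1 + exp (-2 * Real.pi * b * z)) = -(2 * Real.pi * I * b) := by
  have hb0 := ne_zero_of_re_pos hb
  have hb1 : b⁻¹ ≠ 0 := inv_ne_zero hb0
  have hρ := inv_re_pos hb
  set ψ : ℂ → ℂ := fun w => exp (-2 * I * z * w) * (sinh (w * b⁻¹))⁻¹ with hψ
  set N : ℂ → ℂ := fun w => exp (-2 * I * z * w) / sinhQuot b⁻¹ w with hN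
  have hNψ (w : ℂ) : N w / w = ψ w := by
    simp only [hN, hψ]; rw [div_div, sinhQuot_mul, div_eq_mul_inv]
  -- The lower line Im w = -h₂ is the image of the upper one under w ↦ w - iπb, which multiplies the
  -- integrand by -e^{-2πbz}. The strip between them contains the single pole 0.
  set h₂ : ℝ := Real.pi * b.re - h with hh₂
  have hh₂0 : 0 < h₂ := by simp only [hh₂]; linarith
  set H := Real.pi * b.re
  obtain ⟨C, hC0, hC⟩ := eventually_norm_inv_sinh_le hρ H
  set a : ℝ := (b⁻¹).re - 2 * |z.im| with ha
  have ha0 : 0 < a := by simp only [ha]; linarith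
  set M := Real.exp (2 * H * |z.re|) * C with hM
  have hdec : ∀ᶠ t : ℝ in cocompact ℝ, ∀ y : ℝ, |y| ≤ H →
      ‖ψ (t + y * I)‖ ≤ M * Real.exp (-a * |t|) := by
    filter_upwards [hC] with t ht y hy
    rw [hψ, norm_mul]
    refine (mul_le_mul (norm_exp_line_le_of_abs_le le_rfl hy t) (ht y hy) (norm_nonneg _)
      (by positivity)).trans (le_of_eq ?_)
    rw [hM, mul_mul_mul_comm, ← Real.exp_add]
    congr 2; simp only [ha]; ring
  have hint (y : ℝ) (hy0 : y ≠ 0) (hy : |y| < H) : Integrable fun t : ℝ => ψ (t + y * I) := by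
    have hc : Continuous fun t : ℝ => ψ (t + y * I) := by
      refine Continuous.mul (by fun_prop) (Continuous.inv₀ (by fun_prop) fun t => ?_)
      exact sinh_ne_zero_of_abs_im_lt hb1 (ofReal_add_mul_I_ne_zero t hy0) (by simpa using hy)
    obtain ⟨C', hC'⟩ := exists_forall_norm_le_exp hc (hdec.mono fun t ht => ht y hy.le)
    exact ((integrable_exp_neg_mul_abs ha0).const_mul C').mono' hc.aestronglyMeasurable
      (.of_forall hC')
  have i1 := hint h h0.ne' (by rwa [abs_of_pos h0])
  have i2 := hint (-h₂) (neg_ne_zero.2 hh₂0.ne') (by rw [abs_neg, abs_of_pos hh₂0]; simp only [hh₂]; linarith)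
  have e2 (t : ℝ) : (t : ℂ) + (-h₂ : ℝ) * I = t - h₂ * I := by push_cast; ring
  simp_rw [e2] at i2
  have key := integral_line_sub_integral_line (N := N) (g := fun t => M * Real.exp (-a * |t|)) h0 hh₂0
    (fun w hw1 hw2 => by
      refine AnalyticAt.div ?_ (analyticAt_sinhQuot _ _) (sinhQuot_ne_zero hb1 ?_)
      · exact (show Differentiable ℂ fun w => exp (-2 * I * z * w) by fun_prop).analyticAt w
      · rw [inv_inv, abs_lt]; constructor <;> linarith)
    (hdec.mono fun t ht y hy => by
      rw [hNψ]; refine ht y (abs_le.2 ⟨?_, ?_⟩) <;> linarith [hy.1, hy.2])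
    (by simpa using (tendsto_exp_neg_mul_abs ha0).const_mul M)
    (by simpa only [hNψ] using i1) (by simpa only [hNψ] using i2)
  simp only [hNψ] at key
  have hN0 : N 0 = b := by simp [hN, sinhQuot_zero]
  rw [hN0] at key
  have hper (w : ℂ) : ψ (w - I * Real.pi * b) = -(exp (-2 * Real.pi * b * z) * ψ w) := by
    have s1 : sinh ((w - I * Real.pi * b) * b⁻¹) = -sinh (w * b⁻¹) := by
      rw [show (w - I * Real.pi * b) * b⁻¹ = w * b⁻¹ - Real.pi * I by field_simp,
        Complex.sinh_sub, Complex.sinh_mul_I, Complex.cosh_mul_I]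
      simp
    have s2 : exp (-2 * I * z * (w - I * Real.pi * b)) =
        exp (-2 * Real.pi * b * z) * exp (-2 * I * z * w) := by
      rw [← Complex.exp_add]; congr 1; linear_combination (2 * z * Real.pi * b) * I_sq
    simp only [hψ]
    rw [s1, s2, inv_neg]; ring
  have hlow : ∫ t : ℝ, ψ (t - h₂ * I) = -(exp (-2 * Real.pi * b * z) * ∫ t : ℝ, ψ (t + h * I)) := by
    -- The translation by -iπb has real part π Im b, absorbed by the invariance of the integral over
    -- ℝ.
    rw [← integral_const_mul, ← integral_neg,
      ← integral_add_right_eq_self (fun t : ℝ => ψ (t - h₂ * I)) (Real.pi * b.im)]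
    congr 1; ext t
    rw [← hper]
    congr 1
    simp only [hh₂, H]
    apply Complex.ext <;> simp
  rw [hlow] at key
  linear_combination key

/-! ### The logarithm of the quantum dilogarithm as a line integral -/

section Faddeev

variable {b : ℂ}

lemma contourHeight_pos (hb : 0 < b.re) : 0 < contourHeight b := lt_min hb (inv_re_pos hb)

lemma contourHeight_lt (hb : 0 < b.re) : contourHeight b < Real.pi * b.re :=
  (min_le_left _ _).trans_lt (by nlinarith [Real.pi_gt_three])

lemma contourHeight_lt' (hb : 0 < b.re) : contourHeight b < Real.pi * (b⁻¹).re :=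
  (min_le_right _ _).trans_lt (by nlinarith [Real.pi_gt_three, inv_re_pos hb])

lemma sinh_line_ne_zero (hb : 0 < b.re) (t : ℝ) : sinh ((t + contourHeight b * I) * b) ≠ 0 :=
  sinh_ne_zero_of_abs_im_lt (ne_zero_of_re_pos hb)
    (ofReal_add_mul_I_ne_zero t (contourHeight_pos hb).ne')
    (by simpa [abs_of_pos (contourHeight_pos hb)] using contourHeight_lt' hb)

lemma sinh_line_inv_ne_zero (hb : 0 < b.re) (t : ℝ) :
    sinh ((t + contourHeight b * I) * b⁻¹) ≠ 0 :=
  sinh_ne_zero_of_abs_im_lt (inv_ne_zero (ne_zero_of_re_pos hb))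
    (ofReal_add_mul_I_ne_zero t (contourHeight_pos hb).ne')
    (by simpa [abs_of_pos (contourHeight_pos hb)] using contourHeight_lt hb)

lemma norm_inv_line_le (hb : 0 < b.re) (t : ℝ) :
    ‖((t : ℂ) + contourHeight b * I)⁻¹‖ ≤ (contourHeight b)⁻¹ := by
  have h := contourHeight_pos hb
  rw [norm_inv]
  refine inv_anti₀ h ?_
  have := abs_im_le_norm ((t : ℂ) + contourHeight b * I)
  simpa [abs_of_pos h] using this

/-- The kernel `1 / (4 sinh(wb) sinh(w/b) w)` on the line `Im w = contourHeight b`. -/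
def faddeevKernel (b : ℂ) (t : ℝ) : ℂ :=
  (4 * sinh ((t + contourHeight b * I) * b) * sinh ((t + contourHeight b * I) * b⁻¹) *
    (t + contourHeight b * I))⁻¹

lemma continuous_faddeevKernel (hb : 0 < b.re) : Continuous (faddeevKernel b) := by
  refine Continuous.inv₀ (by fun_prop) fun t => ?_
  have h1 := sinh_line_ne_zero hb t
  have h2 := sinh_line_inv_ne_zero hb t
  have h3 := ofReal_add_mul_I_ne_zero t (contourHeight_pos hb).ne'
  simp [h1, h2, h3]

lemma exists_norm_faddeevKernel_le (hb : 0 < b.re) :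
    ∃ C, ∀ t, ‖faddeevKernel b t‖ ≤ C * Real.exp (-(b.re + (b⁻¹).re) * |t|) := by
  obtain ⟨C₁, hC₁, h₁⟩ := eventually_norm_inv_sinh_le hb (contourHeight b)
  obtain ⟨C₂, hC₂, h₂⟩ := eventually_norm_inv_sinh_le (inv_re_pos hb) (contourHeight b)
  refine exists_forall_norm_le_exp (continuous_faddeevKernel hb)
    (C := 4⁻¹ * C₁ * C₂ * (contourHeight b)⁻¹) ?_
  have hh := contourHeight_pos hb
  filter_upwards [h₁, h₂] with t ht₁ ht₂
  have a1 := ht₁ _ (abs_of_pos hh).le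
  have a2 := ht₂ _ (abs_of_pos hh).le
  have a3 := norm_inv_line_le hb t
  rw [show -(b.re + (b⁻¹).re) * |t| = -b.re * |t| + -(b⁻¹).re * |t| by ring, Real.exp_add]
  rw [faddeevKernel, mul_inv, mul_inv, mul_inv, norm_mul, norm_mul, norm_mul]
  calc _ ≤ ‖(4 : ℂ)⁻¹‖ * (C₁ * Real.exp (-b.re * |t|)) * (C₂ * Real.exp (-(b⁻¹).re * |t|)) *
        (contourHeight b)⁻¹ := by gcongr
    _ = _ := by rw [norm_inv, Complex.norm_ofNat]; ring

/-- The logarithm of Faddeev's quantum dilogarithm in the strip `|Im z| < Im c_b`. -/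
def faddeevLog (b : ℂ) : ℂ → ℂ := lineLaplace (contourHeight b) (faddeevKernel b)

lemma faddeevIntegrand_eq (b z : ℂ) (t : ℝ) :
    faddeevIntegrand b z (t + contourHeight b * I) =
      exp (-2 * I * z * (t + contourHeight b * I)) * faddeevKernel b t := by
  rw [faddeevIntegrand, faddeevKernel, div_eq_mul_inv _ b, div_eq_mul_inv]

lemma faddeevIntegral_eq (b z : ℂ) : faddeevIntegral b z = exp (faddeevLog b z) := by
  simp only [faddeevIntegral, faddeevLog, lineLaplace, faddeevIntegrand_eq]

lemma analyticAt_faddeevIntegral (hb : 0 < b.re) {z : ℂ} (hz : |z.im| < (b.re + (b⁻¹).re) / 2) :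
    AnalyticAt ℂ (faddeevIntegral b) z := by
  obtain ⟨C, hC⟩ := exists_norm_faddeevKernel_le hb
  rw [funext (faddeevIntegral_eq b)]
  exact (analyticAt_lineLaplace (continuous_faddeevKernel hb) hC hz).cexp

lemma integrable_faddeev (hb : 0 < b.re) {z : ℂ} (hz : |z.im| < (b.re + (b⁻¹).re) / 2) :
    Integrable fun t : ℝ => exp (-2 * I * z * (t + contourHeight b * I)) * faddeevKernel b t := by
  obtain ⟨C, hC⟩ := exists_norm_faddeevKernel_le hb
  exact integrable_lineLaplace (continuous_faddeevKernel hb) hC hz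

lemma exists_norm_faddeevLog_le (hb : 0 < b.re) {δ : ℝ} (hδ : δ < (b.re + (b⁻¹).re) / 2) :
    ∃ C, ∀ z : ℂ, |z.im| ≤ δ → ‖faddeevLog b z‖ ≤ C * Real.exp (2 * contourHeight b * z.re) := by
  obtain ⟨C, hC⟩ := exists_norm_faddeevKernel_le hb
  exact ⟨_, fun z hz => (norm_lineLaplace_le hC hδ hz).trans (le_of_eq (mul_comm _ _))⟩

/-- The kernel `-1 / (2 w sinh(w/b))` on the line `Im w = contourHeight b`. -/
def shiftKernel (b : ℂ) (t : ℝ) : ℂ :=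
  -(2 * (t + contourHeight b * I) * sinh ((t + contourHeight b * I) * b⁻¹))⁻¹

lemma continuous_shiftKernel (hb : 0 < b.re) : Continuous (shiftKernel b) := by
  refine (Continuous.inv₀ (by fun_prop) fun t => ?_).neg
  have h2 := sinh_line_inv_ne_zero hb t
  have h3 := ofReal_add_mul_I_ne_zero t (contourHeight_pos hb).ne'
  simp [h2, h3]

lemma exists_norm_shiftKernel_le (hb : 0 < b.re) :
    ∃ C, ∀ t, ‖shiftKernel b t‖ ≤ C * Real.exp (-(b⁻¹).re * |t|) := by
  obtain ⟨C₂, hC₂, h₂⟩ := eventually_norm_inv_sinh_le (inv_re_pos hb) (contourHeight b)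
  refine exists_forall_norm_le_exp (continuous_shiftKernel hb)
    (C := 2⁻¹ * (contourHeight b)⁻¹ * C₂) ?_
  have hh := contourHeight_pos hb
  filter_upwards [h₂] with t ht₂
  have a2 := ht₂ _ (abs_of_pos hh).le
  have a3 := norm_inv_line_le hb t
  simp only [shiftKernel, mul_inv, norm_neg, norm_mul]
  calc _ ≤ ‖(2 : ℂ)⁻¹‖ * (contourHeight b)⁻¹ * (C₂ * Real.exp (-(b⁻¹).re * |t|)) := by gcongr
    _ = _ := by rw [norm_inv, Complex.norm_ofNat]; ring

/-- Moving z by ∓ib/2 multiplies the integrand by e^{∓wb}. The difference of these factors, -2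
sinh(wb), cancels one hyperbolic sine of the kernel. -/
lemma faddeevLog_sub (hb : 0 < b.re) {z : ℂ} (hz : |z.im| < (b⁻¹).re / 2) :
    faddeevLog b (z - I * b / 2) - faddeevLog b (z + I * b / 2) =
      lineLaplace (contourHeight b) (shiftKernel b) z := by
  have him : (I * b / 2).im = b.re / 2 := by simp
  have h1 : |(z - I * b / 2).im| < (b.re + (b⁻¹).re) / 2 := by
    rw [sub_im, him]; rw [abs_lt] at hz ⊢; constructor <;> linarith
  have h2 : |(z + I * b / 2).im| < (b.re + (b⁻¹).re) / 2 := by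
    rw [add_im, him]; rw [abs_lt] at hz ⊢; constructor <;> linarith
  rw [faddeevLog, lineLaplace, lineLaplace, lineLaplace,
    ← integral_sub (integrable_faddeev hb h1) (integrable_faddeev hb h2)]
  congr 1; ext t
  have s1 := sinh_line_ne_zero hb t
  have s2 := sinh_line_inv_ne_zero hb t
  have s3 := ofReal_add_mul_I_ne_zero t (contourHeight_pos hb).ne'
  rw [faddeevKernel, shiftKernel]
  set w : ℂ := t + contourHeight b * I
  have e1 : exp (-2 * I * (z - I * b / 2) * w) = exp (-2 * I * z * w) * exp (-(w * b)) := by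
    rw [← Complex.exp_add]; congr 1; linear_combination (b * w) * I_sq
  have e2 : exp (-2 * I * (z + I * b / 2) * w) = exp (-2 * I * z * w) * exp (w * b) := by
    rw [← Complex.exp_add]; congr 1; linear_combination (-b * w) * I_sq
  have e3 := Complex.two_sinh (w * b)
  rw [e1, e2]
  generalize sinh (w * b⁻¹) = S₂ at *
  field_simp
  linear_combination 2 * e3

/-- The zeros of 1 + e^{2πbz} are the points i(k + 1/2)/b with k an integer, and |k + 1/2| ≥ 1/2
keeps them out of the strip. -/
lemma one_add_exp_ne_zero_of_abs_im_lt (hb : 0 < b.re) {z : ℂ} (hz : |z.im| < (b⁻¹).re / 2) :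
    1 + exp (2 * Real.pi * b * z) ≠ 0 := by
  have hb0 := ne_zero_of_re_pos hb
  intro h
  have h1 : Complex.cosh (Real.pi * b * z) = 0 := by
    have h2 : exp (Real.pi * b * z) * (2 * Complex.cosh (Real.pi * b * z)) = 0 := by
      rw [Complex.two_cosh, mul_add, ← Complex.exp_add, ← Complex.exp_add, ← h, add_comm]
      congr 1
      · rw [add_neg_cancel, exp_zero]
      · congr 1; ring
    simpa using h2
  have h3 : Complex.cos (Real.pi * b * z * I) = 0 := by rw [Complex.cos_mul_I, h1]
  obtain ⟨k, hk⟩ := Complex.cos_eq_zero_iff.1 h3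
  have hpi : (Real.pi : ℂ) ≠ 0 := by exact_mod_cast Real.pi_ne_zero
  have h4 : z = -((2 * k + 1) / 2 : ℝ) * I * b⁻¹ := by
    have : Real.pi * (z * (I * I)) * b = Real.pi * ((2 * k + 1) / 2 * I) := by
      linear_combination I * hk
    have h5 : (z * (I * I)) * b = ((2 * k + 1) / 2 * I) := by
      apply mul_left_cancel₀ hpi; linear_combination this
    rw [I_mul_I] at h5
    rw [show z = z * b * b⁻¹ by field_simp]
    push_cast
    linear_combination -b⁻¹ * h5
  have h5 : z.im = -((2 * k + 1) / 2) * (b⁻¹).re := by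
    rw [h4]; simp [mul_assoc]
  have hρ := inv_re_pos hb
  have h6 : |(2 * k + 1 : ℝ)| < 1 := by
    rw [h5, abs_mul, abs_neg, abs_div, abs_of_pos hρ, abs_two] at hz
    by_contra hk1
    nlinarith
  have h7 : |2 * k + 1| < 1 := by exact_mod_cast h6
  have := Int.abs_lt_one_iff.1 h7
  omega

end Faddeev

end WGZ

end

noncomputable section

namespace WGZ

open Filter MeasureTheory Set

/-! ### Functional equation and inversion relation in the strip of definition -/

variable {b : ℂ}

/-- Both sides have the same logarithmic derivative in the strip, by `integral_inv_sinh`. Both tend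
to 1 along the real axis at -∞; for the left side this is due to the contour lying above the origin,
which makes the integral O(e^{2h Re z}). -/
lemma exp_shiftKernel (hb : 0 < b.re) {z : ℂ} (hz : |z.im| < (b⁻¹).re / 2) :
    exp (lineLaplace (contourHeight b) (shiftKernel b) z) = 1 + exp (2 * Real.pi * b * z) := by
  obtain ⟨C, hC⟩ := exists_norm_shiftKernel_le hb
  have hρ := inv_re_pos hb
  set h := contourHeight b with hh
  set Y := lineLaplace h (shiftKernel b) with hY
  set U : Set ℂ := {z : ℂ | |z.im| < (b⁻¹).re / 2} with hU
  have hUo : IsOpen U := isOpen_lt continuous_im.abs continuous_const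
  have hUc : Convex ℝ U := by
    have : U = Complex.imLm ⁻¹' (Ioo (-((b⁻¹).re / 2)) ((b⁻¹).re / 2)) := by
      ext z; simp [hU, abs_lt]
    rw [this]; exact (convex_Ioo _ _).is_linear_preimage Complex.imLm.isLinear
  have hderiv (z : ℂ) (hz : z ∈ U) :
      HasDerivAt (fun z => exp (-Y z) * (1 + exp (2 * Real.pi * b * z))) 0 z := by
    have d1 := hasDerivAt_lineLaplace (h := h) (continuous_shiftKernel hb) hC hz
    have hJ := integral_inv_sinh hb (contourHeight_pos hb) (contourHeight_lt hb) hz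
    have e1 : (∫ t : ℝ, exp (-2 * I * z * (t + h * I)) * (-2 * I * (t + h * I) * shiftKernel b t)) =
        I * ∫ t : ℝ, exp (-2 * I * z * (t + h * I)) * (sinh ((t + h * I) * b⁻¹))⁻¹ := by
      rw [← integral_const_mul]
      congr 1; ext t
      have s2 := sinh_line_inv_ne_zero hb t
      have s3 := ofReal_add_mul_I_ne_zero t (contourHeight_pos hb).ne'
      rw [← hh] at s2 s3
      rw [shiftKernel, ← hh]
      generalize (t : ℂ) + h * I = w at *
      generalize sinh (w * b⁻¹) = S at *
      field_simp
    rw [e1] at d1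
    have d2 : HasDerivAt (fun z => 1 + exp (2 * Real.pi * b * z))
        (exp (2 * Real.pi * b * z) * (2 * Real.pi * b * 1)) z :=
      (((hasDerivAt_id z).const_mul (2 * Real.pi * b)).cexp).const_add 1
    have d3 := d1.neg.cexp.mul d2
    refine d3.congr_deriv ?_
    have e2 : exp (2 * Real.pi * b * z) * exp (-2 * Real.pi * b * z) = 1 := by
      rw [← Complex.exp_add, ← Complex.exp_zero]; congr 1; ring
    set J := ∫ t : ℝ, exp (-2 * I * z * (t + h * I)) * (sinh ((t + h * I) * b⁻¹))⁻¹
    set X := exp (2 * Real.pi * b * z)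
    set X' := exp (-2 * Real.pi * b * z)
    simp only [Pi.neg_apply]
    linear_combination (-I * exp (-Y z) * X) * hJ + exp (-Y z) * (I * J) * e2
      + exp (-Y z) * X * (2 * Real.pi * b) * I_sq
  have hconst (x : ℂ) (hx : x ∈ U) : exp (-Y x) * (1 + exp (2 * Real.pi * b * x)) =
      exp (-Y z) * (1 + exp (2 * Real.pi * b * z)) :=
    hUc.is_const_of_fderivWithin_eq_zero (𝕜 := ℂ) (f := fun z => exp (-Y z) * (1 + exp (2 * Real.pi * b * z)))
      (fun x hx => (hderiv x hx).differentiableAt.differentiableWithinAt)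
      (fun x hx => by
        rw [fderivWithin_of_isOpen hUo hx]
        ext; simp [(hderiv x hx).hasFDerivAt.fderiv]) hx hz
  have lim1 : Tendsto (fun x : ℝ => Y x) atBot (𝓝 0) := by
    have hb1 (x : ℝ) := norm_lineLaplace_le (h := h) hC (δ := 0) (by positivity) (z := x) (by simp)
    have h1 : Tendsto (fun x : ℝ => 2 * h * (x : ℂ).re) atBot atBot := by
      simp only [ofReal_re]
      exact tendsto_id.const_mul_atBot (by have := contourHeight_pos hb; positivity)
    have h2 := (Real.tendsto_exp_atBot.comp h1).mul_const
      (C * ∫ t : ℝ, Real.exp (-((b⁻¹).re - 2 * 0) * |t|))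
    rw [zero_mul] at h2
    exact squeeze_zero_norm hb1 h2
  have lim2 : Tendsto (fun x : ℝ => exp (2 * Real.pi * b * x)) atBot (𝓝 0) := by
    rw [tendsto_zero_iff_norm_tendsto_zero]
    simp only [norm_exp]
    refine Real.tendsto_exp_atBot.comp ?_
    have : (fun x : ℝ => (2 * Real.pi * b * x : ℂ).re) = fun x => 2 * Real.pi * b.re * x := by
      ext x; simp
    rw [this]
    exact tendsto_id.const_mul_atBot (by positivity)
  have lim3 : Tendsto (fun x : ℝ => exp (-Y x) * (1 + exp (2 * Real.pi * b * x))) atBot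
      (𝓝 (exp (-0) * (1 + 0))) :=
    ((Complex.continuous_exp.tendsto _).comp lim1.neg).mul (lim2.const_add 1)
  have hval := tendsto_nhds_unique lim3 (tendsto_const_nhds.congr fun x : ℝ =>
    (hconst x (by
      change |(x : ℂ).im| < _
      rw [ofReal_im, abs_zero]; positivity)).symm)
  rw [neg_zero, Complex.exp_zero, add_zero, one_mul, Complex.exp_neg] at hval
  have := exp_ne_zero (Y z)
  field_simp at hval
  exact hval

/-- The functional equation of Faddeev's quantum dilogarithm inside the strip of definition. -/
lemma faddeevIntegral_sub (hb : 0 < b.re) {z : ℂ} (hz : |z.im| < (b⁻¹).re / 2) :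
    faddeevIntegral b (z - I * b / 2) =
      (1 + exp (2 * Real.pi * b * z)) * faddeevIntegral b (z + I * b / 2) := by
  rw [faddeevIntegral_eq, faddeevIntegral_eq, ← exp_shiftKernel hb hz, ← faddeevLog_sub hb hz,
    ← Complex.exp_add, sub_add_cancel]

/-- The inversion relation of Faddeev's quantum dilogarithm inside the strip of definition. -/
lemma faddeevIntegral_mul_neg (hb : 0 < b.re) {z : ℂ} (hz : |z.im| < (b.re + (b⁻¹).re) / 2) :
    faddeevIntegral b z * faddeevIntegral b (-z) =
      faddeevIntegral b 0 ^ 2 * exp (Real.pi * I * z ^ 2) := by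
  have hb0 := ne_zero_of_re_pos hb
  have hb1 : b⁻¹ ≠ 0 := inv_ne_zero hb0
  have hρ := inv_re_pos hb
  set h := contourHeight b with hh
  have h0 : 0 < h := contourHeight_pos hb
  set Z : ℂ → ℂ := dslope (fun w => sin (w * z)) 0 with hZ
  have hZw (w : ℂ) : Z w * w = sin (w * z) := by
    have := sub_smul_dslope (fun w => sin (w * z)) 0 w
    simp only [sub_zero, zero_mul, Complex.sin_zero, smul_eq_mul] at this
    rw [mul_comm]; exact this
  have hZ0 : Z 0 = z := by
    have : HasDerivAt (fun w => sin (w * z)) (cos (0 * z) * (1 * z)) 0 :=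
      ((hasDerivAt_id (0 : ℂ)).mul_const z).csin
    rw [hZ, dslope_same, this.deriv]; simp
  have hZa (w : ℂ) : AnalyticAt ℂ Z w := by
    have (x : ℂ) : AnalyticAt ℂ (fun w => sin (w * z)) x :=
      (show Differentiable ℂ fun w => sin (w * z) by fun_prop).analyticAt x
    exact (this 0).dslope (this w)
  set N : ℂ → ℂ := fun w => -2 * Z w ^ 2 / (4 * sinhQuot b w * sinhQuot b⁻¹ w) with hN
  have hN0 : N 0 = -z ^ 2 / 2 := by
    simp only [hN, hZ0, sinhQuot_zero]; field_simp; ring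
  set D : ℂ → ℂ := fun w => (4 * sinh (w * b) * sinh (w * b⁻¹) * w)⁻¹ with hD
  -- The mean of the integrands for z and -z, minus the integrand for 0. The exponentials combine to
  -- -2 sin²(wz), whose zero at the origin reduces the triple pole of D there to at most a simple
  -- one, with residue N(0) = -z²/2.
  set r : ℂ → ℂ := fun w =>
    2⁻¹ * (exp (-2 * I * z * w) * D w + exp (-2 * I * (-z) * w) * D w) - exp (-2 * I * 0 * w) * D w with hr
  have hNr {w : ℂ} (hw : w ≠ 0) : N w / w = r w := by
    have hcos : exp (-2 * I * z * w) + exp (-2 * I * (-z) * w) = 2 * (1 - 2 * sin (w * z) ^ 2) := by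
      rw [← Complex.cos_sq_add_sin_sq (w * z)]
      have h1 := Complex.two_cos (2 * (w * z))
      rw [Complex.cos_two_mul] at h1
      have h2 := Complex.cos_sq_add_sin_sq (w * z)
      rw [show -2 * I * z * w = -(2 * (w * z)) * I by ring,
        show -2 * I * (-z) * w = 2 * (w * z) * I by ring]
      linear_combination -h1 + 2 * h2
    have e1 : r w = -2 * sin (w * z) ^ 2 * D w := by
      simp only [hr, mul_zero, zero_mul, exp_zero]
      linear_combination 2⁻¹ * D w * hcos
    rw [e1, ← hZw]
    simp only [hN, hD]
    rw [← sinhQuot_mul, ← sinhQuot_mul, div_div, div_eq_mul_inv]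
    simp only [mul_inv]
    field_simp
  obtain ⟨C₁, hC₁, h₁⟩ := eventually_norm_inv_sinh_le hb h
  obtain ⟨C₂, hC₂, h₂⟩ := eventually_norm_inv_sinh_le hρ h
  set κ := b.re + (b⁻¹).re with hκ
  set M := 2 * Real.exp (2 * h * |z.re|) with hM
  set a := κ - 2 * |z.im| with ha
  have ha0 : 0 < a := by simp only [ha]; linarith
  -- By oddness the lower line contributes minus the upper one, so the residue theorem evaluates
  -- twice the integral over the upper line.
  have hrodd (w : ℂ) : r (-w) = -r w := by
    simp only [hr, hD, neg_mul, Complex.sinh_neg, mul_neg, neg_neg, mul_zero, zero_mul, inv_neg]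
    ring
  have hr1 (t : ℝ) : r (t + h * I) =
      2⁻¹ * (exp (-2 * I * z * (t + h * I)) * faddeevKernel b t +
        exp (-2 * I * (-z) * (t + h * I)) * faddeevKernel b t) -
      exp (-2 * I * 0 * (t + h * I)) * faddeevKernel b t := rfl
  have hz' : |(-z).im| < κ / 2 := by rw [neg_im, abs_neg]; exact hz
  have hz0 : |(0 : ℂ).im| < κ / 2 := by simp; positivity
  have j1 := (((integrable_faddeev hb hz).add (integrable_faddeev hb hz')).const_mul 2⁻¹).sub
    (integrable_faddeev hb hz0)
  have hrint : Integrable fun t : ℝ => r (t + h * I) := j1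
  have hrval : ∫ t : ℝ, r (t + h * I) =
      2⁻¹ * (faddeevLog b z + faddeevLog b (-z)) - faddeevLog b 0 := by
    simp_rw [hr1]
    rw [integral_sub, integral_const_mul, integral_add]
    · rfl
    · exact integrable_faddeev hb hz
    · exact integrable_faddeev hb hz'
    · exact ((integrable_faddeev hb hz).add (integrable_faddeev hb hz')).const_mul 2⁻¹
    · exact integrable_faddeev hb hz0
  have hrlow (t : ℝ) : r (t - h * I) = -r ((-t : ℝ) + h * I) := by
    rw [← hrodd]; congr 1; push_cast; ring
  have hrint' : Integrable fun t : ℝ => r (t - h * I) := by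
    simp_rw [hrlow]; exact hrint.comp_neg.neg
  have hrval' : ∫ t : ℝ, r (t - h * I) = -∫ t : ℝ, r (t + h * I) := by
    simp_rw [hrlow]
    rw [integral_neg, integral_neg_eq_self (fun t : ℝ => r (t + h * I))]
  have n1 (t : ℝ) : (t : ℂ) + h * I ≠ 0 := ofReal_add_mul_I_ne_zero t h0.ne'
  have n2 (t : ℝ) : (t : ℂ) - h * I ≠ 0 := by
    have := ofReal_add_mul_I_ne_zero t (neg_ne_zero.2 h0.ne')
    push_cast at this; rwa [neg_mul, ← sub_eq_add_neg] at this
  have key := integral_line_sub_integral_line (N := N) (h₁ := h) (h₂ := h)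
    (g := fun t => M * C₁ * C₂ * Real.exp (-a * |t|)) h0 h0
    (fun w hw1 hw2 => by
      have hw := abs_le.2 ⟨hw1, hw2⟩
      refine (analyticAt_const.mul ((hZa w).pow 2)).div ((analyticAt_const.mul
        (analyticAt_sinhQuot _ _)).mul (analyticAt_sinhQuot _ _)) ?_
      have s1 := sinhQuot_ne_zero hb0 (hw.trans_lt (contourHeight_lt' hb))
      have s2 := sinhQuot_ne_zero hb1 (hw.trans_lt (by rw [inv_inv]; exact contourHeight_lt hb))
      simp [s1, s2])
    (by
      filter_upwards [h₁, h₂, tendsto_norm_cocompact_atTop.eventually_ge_atTop (1 : ℝ)]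
        with t ht₁ ht₂ ht y hy
      have hy' : |y| ≤ h := abs_le.2 hy
      set w : ℂ := t + y * I with hw
      have hw1 : 1 ≤ ‖w‖ := by
        have := abs_re_le_norm w
        simp [hw] at this
        exact ht.trans this
      have hw0 : w ≠ 0 := by rintro h; rw [h] at hw1; simp at hw1; linarith
      rw [hNr hw0]
      have hDb : ‖D w‖ ≤ 4⁻¹ * (C₁ * Real.exp (-b.re * |t|)) * (C₂ * Real.exp (-(b⁻¹).re * |t|)) := by
        have a1 := ht₁ _ hy'
        have a2 := ht₂ _ hy'
        simp only [hD]
        rw [mul_inv, mul_inv, mul_inv, norm_mul, norm_mul, norm_mul, norm_inv 4, Complex.norm_ofNat]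
        have a3 : ‖w⁻¹‖ ≤ 1 := by rw [norm_inv]; exact inv_le_one_of_one_le₀ hw1
        calc _ ≤ 4⁻¹ * (C₁ * Real.exp (-b.re * |t|)) * (C₂ * Real.exp (-(b⁻¹).re * |t|)) * 1 := by
              gcongr
          _ = _ := mul_one _
      have hE (z' : ℂ) (h1 : |z'.im| ≤ |z.im|) (h2 : |z'.re| ≤ |z.re|) :
          ‖exp (-2 * I * z' * w)‖ ≤ Real.exp (2 * h * |z.re|) * Real.exp (2 * |z.im| * |t|) := by
        refine (norm_exp_line_le_of_abs_le h1 hy' t).trans ?_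
        gcongr
      have E1 := hE z le_rfl le_rfl
      have E2 := hE (-z) (by simp) (by simp)
      have E3 := hE 0 (by simp) (by simp)
      set Q := Real.exp (2 * h * |z.re|) * Real.exp (2 * |z.im| * |t|) with hQ
      have hQ0 : 0 ≤ Q := by positivity
      have e : r w = (2⁻¹ * (exp (-2 * I * z * w) + exp (-2 * I * (-z) * w)) -
          exp (-2 * I * 0 * w)) * D w := by simp only [hr]; ring
      have b1 : ‖2⁻¹ * (exp (-2 * I * z * w) + exp (-2 * I * (-z) * w)) - exp (-2 * I * 0 * w)‖ ≤
          2 * Q := by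
        refine (norm_sub_le _ _).trans ?_
        rw [norm_mul, norm_inv, Complex.norm_ofNat]
        have := norm_add_le (exp (-2 * I * z * w)) (exp (-2 * I * (-z) * w))
        linarith
      rw [e, norm_mul]
      refine (mul_le_mul b1 hDb (norm_nonneg _) (by positivity)).trans ?_
      have e3 : Real.exp (-a * |t|) = Real.exp (2 * |z.im| * |t|) * Real.exp (-b.re * |t|) *
          Real.exp (-(b⁻¹).re * |t|) := by
        rw [← Real.exp_add, ← Real.exp_add]; congr 1; simp only [ha, hκ]; ring
      rw [e3, hM, hQ]
      set x1 := Real.exp (2 * h * |z.re|)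
      set x2 := Real.exp (2 * |z.im| * |t|)
      set x3 := Real.exp (-b.re * |t|)
      set x4 := Real.exp (-(b⁻¹).re * |t|)
      have : 0 ≤ x1 * x2 * C₁ * x3 * C₂ * x4 := by positivity
      nlinarith)
    (by simpa using (tendsto_exp_neg_mul_abs ha0).const_mul (M * C₁ * C₂))
    (by simpa only [hNr (n1 _)] using hrint) (by simpa only [hNr (n2 _)] using hrint')
  simp only [hNr (n1 _), hNr (n2 _)] at key
  rw [hrval', hrval, hN0] at key
  have hlog : faddeevLog b z + faddeevLog b (-z) =
      2 * faddeevLog b 0 + Real.pi * I * z ^ 2 := by linear_combination key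
  rw [faddeevIntegral_eq, faddeevIntegral_eq, faddeevIntegral_eq, ← Complex.exp_add, hlog,
    Complex.exp_add, two_mul, Complex.exp_add, sq (exp _)]

end WGZ

end

noncomputable section

namespace WGZ

open Filter MeasureTheory Set

/-! ### Horizontal strips near `-∞` -/

/-- The filter `Re z → -∞` within the strip `|Im z| ≤ H`. -/
def leftStrip (H : ℝ) : Filter ℂ := comap re atBot ⊓ 𝓟 {z | |z.im| ≤ H}

lemma eventually_leftStrip {H : ℝ} {p : ℂ → Prop} :
    (∀ᶠ z in leftStrip H, p z) ↔ ∃ R : ℝ, ∀ z : ℂ, z.re ≤ R → |z.im| ≤ H → p z := by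
  rw [leftStrip, eventually_inf_principal, eventually_comap, eventually_atBot]
  constructor
  · rintro ⟨R, hR⟩
    exact ⟨R, fun z hz hz' => hR z.re hz z rfl hz'⟩
  · rintro ⟨R, hR⟩
    exact ⟨R, fun x hx z hz hz' => hR z (hz ▸ hx) hz'⟩

lemma eventually_leftStrip_mem (H : ℝ) : ∀ᶠ z in leftStrip H, |z.im| ≤ H :=
  eventually_leftStrip.2 ⟨0, fun _ _ h => h⟩

lemma tendsto_re_leftStrip (H : ℝ) : Tendsto re (leftStrip H) atBot :=
  tendsto_comap.mono_left inf_le_left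

lemma tendsto_add_leftStrip (c : ℂ) (H : ℝ) :
    Tendsto (fun z => z + c) (leftStrip H) (leftStrip (H + |c.im|)) := by
  intro s hs
  obtain ⟨R, hR⟩ := eventually_leftStrip.1 hs
  refine eventually_leftStrip.2 ⟨R - c.re, fun z hz hz' => hR _ ?_ ?_⟩
  · rw [add_re]; linarith
  · rw [add_im]; exact (abs_add_le _ _).trans (by linarith)

lemma eventually_forall_add {p : ℂ → Prop} (hp : ∀ H, ∀ᶠ z in leftStrip H, p z) (c : ℂ) (H : ℝ) :
    ∀ᶠ z in leftStrip H, p (z + c) :=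
  (tendsto_add_leftStrip c H).eventually (hp _)

lemma norm_exp_two_pi_mul (b z : ℂ) :
    ‖exp (2 * Real.pi * b * z)‖ = Real.exp (2 * Real.pi * (b.re * z.re - b.im * z.im)) := by
  rw [norm_exp]; congr 1; simp; ring

lemma norm_exp_two_pi_mul_le (b : ℂ) {H : ℝ} {z : ℂ} (hz : |z.im| ≤ H) :
    ‖exp (2 * Real.pi * b * z)‖ ≤
      Real.exp (2 * Real.pi * (|b.im| * H)) * Real.exp (2 * Real.pi * b.re * z.re) := by
  rw [norm_exp_two_pi_mul, ← Real.exp_add]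
  refine Real.exp_le_exp.2 ?_
  have h1 : -(b.im * z.im) ≤ |b.im| * |z.im| := (neg_le_abs _).trans (abs_mul _ _).le
  have h2 : |b.im| * |z.im| ≤ |b.im| * H := mul_le_mul_of_nonneg_left hz (abs_nonneg _)
  have := Real.pi_pos
  nlinarith

variable {b : ℂ}

lemma tendsto_exp_leftStrip (hb : 0 < b.re) (c : ℂ) (H : ℝ) :
    Tendsto (fun z => exp (2 * Real.pi * b * (z + c))) (leftStrip H) (𝓝 0) := by
  have h0 (H : ℝ) : Tendsto (fun z => exp (2 * Real.pi * b * z)) (leftStrip H) (𝓝 0) := by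
    refine squeeze_zero_norm' ((eventually_leftStrip_mem H).mono fun z hz =>
      norm_exp_two_pi_mul_le b hz) ?_
    rw [← mul_zero (Real.exp (2 * Real.pi * (|b.im| * H)))]
    refine Tendsto.const_mul _ (Real.tendsto_exp_atBot.comp ?_)
    exact (tendsto_re_leftStrip H).const_mul_atBot (by positivity)
  exact (h0 _).comp (tendsto_add_leftStrip c H)

/-! ### Faddeev's quantum dilogarithm on the plane -/

/-- The factor `1 + e^{2πb(z - ib(j + 1/2))}` of the denominator of `faddeev`. -/
def poleFactor (b : ℂ) (j : ℕ) (z : ℂ) : ℂ :=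
  1 + exp (2 * Real.pi * b * (z - I * b * (j + 1 / 2)))

/-- The factor `1 + e^{2πb(z + ib(j + 1/2))}` of the numerator of `faddeev`. -/
def zeroFactor (b : ℂ) (j : ℕ) (z : ℂ) : ℂ :=
  1 + exp (2 * Real.pi * b * (z + I * b * (j + 1 / 2)))

/-- The expression of `faddeev` in the strip around `Im z = n Re b`. -/
def faddeevPiece (b : ℂ) (n : ℤ) (z : ℂ) : ℂ :=
  faddeevIntegral b (z - I * b * n) * (∏ j ∈ Finset.range (-n).toNat, zeroFactor b j z) /
    ∏ j ∈ Finset.range n.toNat, poleFactor b j z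

lemma faddeev_eq_piece (b z : ℂ) : faddeev b z = faddeevPiece b (round (z.im / b.re)) z := rfl

lemma differentiable_poleFactor (b : ℂ) (j : ℕ) : Differentiable ℂ (poleFactor b j) := by
  unfold poleFactor; fun_prop

lemma differentiable_zeroFactor (b : ℂ) (j : ℕ) : Differentiable ℂ (zeroFactor b j) := by
  unfold zeroFactor; fun_prop

/-- The functional equation of Faddeev's quantum dilogarithm. -/
lemma faddeev_eq_mul (hb : 0 < b.re) {z : ℂ} (hz : zeroFactor b 0 z ≠ 0) :
    faddeev b z = zeroFactor b 0 z * faddeev b (z + I * b) := by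
  have hk : round ((z + I * b).im / b.re) = round (z.im / b.re) + 1 := by
    rw [← round_add_one]; congr 1; simp; field_simp
  rw [faddeev_eq_piece, faddeev_eq_piece, hk]
  set k := round (z.im / b.re)
  have harg : z + I * b - I * b * ((k + 1 : ℤ) : ℂ) = z - I * b * k := by push_cast; ring
  simp only [faddeevPiece, harg]
  have hp (j : ℕ) : poleFactor b (j + 1) (z + I * b) = poleFactor b j z := by
    simp only [poleFactor]; congr 3; push_cast; ring
  have hp0 : poleFactor b 0 (z + I * b) = zeroFactor b 0 z := by
    simp only [poleFactor, zeroFactor]; congr 3; push_cast; ring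
  have hz' (j : ℕ) : zeroFactor b j (z + I * b) = zeroFactor b (j + 1) z := by
    simp only [zeroFactor]; congr 3; push_cast; ring
  obtain ⟨m, hm⟩ | ⟨m, hm⟩ : (∃ m : ℕ, k = m) ∨ ∃ m : ℕ, k = -(m + 1 : ℤ) := by
    rcases k with m | m
    · exact .inl ⟨m, rfl⟩
    · exact .inr ⟨m, by rw [Int.negSucc_eq]⟩
  · have e1 : k.toNat = m := by omega
    have e2 : (k + 1).toNat = m + 1 := by omega
    have e3 : (-k).toNat = 0 := by omega
    have e4 : (-(k + 1)).toNat = 0 := by omega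
    simp only [e1, e2, e3, e4, Finset.prod_range_succ', hp, hp0, Finset.prod_range_zero]
    field_simp
  · have e1 : k.toNat = 0 := by omega
    have e2 : (k + 1).toNat = 0 := by omega
    have e3 : (-k).toNat = m + 1 := by omega
    have e4 : (-(k + 1)).toNat = m := by omega
    simp only [e1, e2, e3, e4, Finset.prod_range_succ', hz']
    ring

/-- This is `faddeevIntegral_sub` at the midpoint z - ib(n + 1/2). The two hypotheses together say
exactly that |Im| < Re b⁻¹ / 2 there. -/
lemma faddeevIntegral_sub_one (hb : 0 < b.re) {n : ℤ} {z : ℂ}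
    (h1 : |z.im - n * b.re| < (b.re + (b⁻¹).re) / 2)
    (h2 : |z.im - (n + 1) * b.re| < (b.re + (b⁻¹).re) / 2) :
    1 + exp (2 * Real.pi * b * (z - I * b * (n + 1 / 2))) ≠ 0 ∧
    faddeevIntegral b (z - I * b * (n + 1 : ℤ)) =
      (1 + exp (2 * Real.pi * b * (z - I * b * (n + 1 / 2)))) * faddeevIntegral b (z - I * b * n) := by
  have him : |(z - I * b * (n + 1 / 2)).im| < (b⁻¹).re / 2 := by
    have : (z - I * b * (n + 1 / 2)).im = z.im - (n + 1 / 2) * b.re := by simp; ring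
    rw [this]
    rw [abs_lt] at h1 h2 ⊢
    constructor <;> linarith [h1.1, h1.2, h2.1, h2.2]
  refine ⟨one_add_exp_ne_zero_of_abs_im_lt hb him, ?_⟩
  have := faddeevIntegral_sub hb him
  rw [show z - I * b * (n + 1 : ℤ) = z - I * b * (n + 1 / 2) - I * b / 2 by push_cast; ring, this]
  congr 2; ring

/-- The factor gained by the integral is matched by one more factor in the denominator if n ≥ 0, and
by one factor fewer in the numerator if n < 0. -/
lemma faddeevPiece_succ (hb : 0 < b.re) {n : ℤ} {z : ℂ}
    (h1 : |z.im - n * b.re| < (b.re + (b⁻¹).re) / 2)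
    (h2 : |z.im - (n + 1) * b.re| < (b.re + (b⁻¹).re) / 2) :
    faddeevPiece b n z = faddeevPiece b (n + 1) z := by
  obtain ⟨hne, hE⟩ := faddeevIntegral_sub_one hb h1 h2
  simp only [faddeevPiece, hE]
  obtain ⟨m, hm⟩ | ⟨m, hm⟩ : (∃ m : ℕ, n = m) ∨ ∃ m : ℕ, n = -(m + 1 : ℤ) := by
    rcases n with m | m
    · exact .inl ⟨m, rfl⟩
    · exact .inr ⟨m, by rw [Int.negSucc_eq]⟩
  · have e1 : n.toNat = m := by omega
    have e2 : (n + 1).toNat = m + 1 := by omega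
    have e3 : (-n).toNat = 0 := by omega
    have e4 : (-(n + 1)).toNat = 0 := by omega
    have e5 : poleFactor b m z = 1 + exp (2 * Real.pi * b * (z - I * b * (n + 1 / 2))) := by
      rw [poleFactor, hm, Int.cast_natCast]
    simp only [e1, e2, e3, e4, Finset.prod_range_succ, e5]
    generalize 1 + exp (2 * Real.pi * b * (z - I * b * (n + 1 / 2))) = X at *
    field_simp
  · have e1 : n.toNat = 0 := by omega
    have e2 : (n + 1).toNat = 0 := by omega
    have e3 : (-n).toNat = m + 1 := by omega
    have e4 : (-(n + 1)).toNat = m := by omega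
    have e5 : zeroFactor b m z = 1 + exp (2 * Real.pi * b * (z - I * b * (n + 1 / 2))) := by
      rw [zeroFactor, hm]; congr 3; push_cast; ring
    simp only [e1, e2, e3, e4, Finset.prod_range_succ, e5]
    ring

lemma abs_im_sub_round_mul_le (hb : 0 < b.re) (z : ℂ) :
    |z.im - round (z.im / b.re) * b.re| ≤ b.re / 2 := by
  have h := abs_sub_round (z.im / b.re)
  have e : z.im - round (z.im / b.re) * b.re = (z.im / b.re - round (z.im / b.re)) * b.re := by
    field_simp
  rw [e, abs_mul, abs_of_pos hb]
  nlinarith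

/-- A family of functions holomorphic on overlapping horizontal strips and agreeing on the overlaps
glues to a holomorphic function. -/
lemma analyticAt_glue {Ψ : ℤ → ℂ → ℂ} {β c : ℝ} (hβ : 0 < β) (hc : β / 2 < c) {z₀ : ℂ}
    (h1 : AnalyticAt ℂ (Ψ (round (z₀.im / β))) z₀)
    (h2 : ∀ n : ℤ, ∀ z : ℂ, |z.im - n * β| < c → |z.im - (n + 1) * β| < c → Ψ n z = Ψ (n + 1) z) :
    AnalyticAt ℂ (fun z => Ψ (round (z.im / β)) z) z₀ := by
  refine h1.congr ?_
  set k₀ := round (z₀.im / β) with hk₀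
  have hround (z : ℂ) : |z.im - round (z.im / β) * β| ≤ β / 2 := by
    have h := abs_sub_round (z.im / β)
    have e : z.im - round (z.im / β) * β = (z.im / β - round (z.im / β)) * β := by
      field_simp
    rw [e, abs_mul, abs_of_pos hβ]
    nlinarith
  have e1 : ∀ᶠ z : ℂ in 𝓝 z₀, |z.im - k₀ * β| < c :=
    (isOpen_lt (by fun_prop) continuous_const).mem_nhds ((hround z₀).trans_lt hc)
  have e2 : ∀ᶠ z : ℂ in 𝓝 z₀, |z.im - z₀.im| < β :=
    (isOpen_lt (by fun_prop) continuous_const).mem_nhds (by simpa using hβ)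
  filter_upwards [e1, e2] with z hz1 hz2
  set k := round (z.im / β) with hk
  have hz3 : |z.im - k * β| < c := (hround z).trans_lt hc
  -- Close to z₀ the rounded index changes by at most one, so a single overlap identity suffices.
  have hk1 : |((k - k₀ : ℤ) : ℝ)| < 2 := by
    have a1 := abs_le.1 (hround z)
    have a2 := abs_le.1 (hround z₀)
    have a3 := abs_lt.1 hz2
    rw [← hk] at a1
    rw [← hk₀] at a2
    push_cast
    rw [abs_lt]
    constructor <;> nlinarith
  have hk2 : |k - k₀| < 2 := by exact_mod_cast hk1
  rw [abs_lt] at hk2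
  obtain h | h | h : k = k₀ ∨ k = k₀ + 1 ∨ k₀ = k + 1 := by omega
  · rw [h]
  · rw [h]; rw [h] at hz3; push_cast at hz3; exact h2 k₀ z hz1 hz3
  · rw [h]; rw [h] at hz1; push_cast at hz1; exact (h2 k z hz3 hz1).symm

lemma strip_lt (hb : 0 < b.re) : b.re / 2 < (b.re + (b⁻¹).re) / 2 := by
  linarith [inv_re_pos hb]

lemma im_sub_mul (b z : ℂ) (n : ℤ) : (z - I * b * n).im = z.im - n * b.re := by
  simp; ring

/-- `faddeev` is holomorphic off the zeros of its denominator. -/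
lemma analyticAt_faddeev (hb : 0 < b.re) {z : ℂ}
    (hz : ∀ j ∈ Finset.range (round (z.im / b.re)).toNat, poleFactor b j z ≠ 0) :
    AnalyticAt ℂ (faddeev b) z := by
  refine analyticAt_glue (Ψ := faddeevPiece b) hb (strip_lt hb) ?_
    fun n z h1 h2 => faddeevPiece_succ hb h1 h2
  refine AnalyticAt.div (AnalyticAt.mul ?_ ?_) ?_ (Finset.prod_ne_zero_iff.2 hz)
  · refine AnalyticAt.fun_comp (analyticAt_faddeevIntegral hb ?_)
      (analyticAt_id.sub analyticAt_const)
    rw [im_sub_mul]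
    exact (abs_im_sub_round_mul_le hb z).trans_lt (strip_lt hb)
  · exact Finset.analyticAt_fun_prod _ fun j _ => (differentiable_zeroFactor b j).analyticAt z
  · exact Finset.analyticAt_fun_prod _ fun j _ => (differentiable_poleFactor b j).analyticAt z

lemma abs_round_le (hb : 0 < b.re) {H : ℝ} {z : ℂ} (hz : |z.im| ≤ H) :
    |round (z.im / b.re)| ≤ ⌈H / b.re + 1⌉ := by
  have h := abs_im_sub_round_mul_le hb z
  have h1 : |(round (z.im / b.re) : ℝ)| ≤ H / b.re + 1 := by
    have h2 := abs_sub_round (z.im / b.re)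
    have h3 : |z.im / b.re| ≤ H / b.re := by
      rw [abs_div, abs_of_pos hb]; gcongr
    rw [abs_le] at h2 h3 ⊢
    constructor <;> linarith
  have h2 := h1.trans (Int.le_ceil _)
  exact_mod_cast h2

/-- Properties of `faddeev` on left strips may be checked for each of its local expressions. -/
lemma eventually_of_forall_round (hb : 0 < b.re) {H : ℝ} {p : ℤ → ℂ → Prop}
    (h : ∀ n : ℤ, ∀ᶠ z in leftStrip H, |z.im - n * b.re| ≤ b.re / 2 → p n z) :
    ∀ᶠ z in leftStrip H, p (round (z.im / b.re)) z := by
  set K := ⌈H / b.re + 1⌉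
  have h1 : ∀ᶠ z in leftStrip H, ∀ n ∈ Finset.Icc (-K) K, |z.im - n * b.re| ≤ b.re / 2 → p n z :=
    (Filter.eventually_all_finset _).2 fun n _ => h n
  filter_upwards [h1, eventually_leftStrip_mem H] with z hz hzH
  exact hz _ (Finset.mem_Icc.2 (abs_le.1 (abs_round_le hb hzH))) (abs_im_sub_round_mul_le hb z)

lemma tendsto_poleFactor (hb : 0 < b.re) (j : ℕ) (H : ℝ) :
    Tendsto (poleFactor b j) (leftStrip H) (𝓝 1) := by
  have := (tendsto_exp_leftStrip hb (-(I * b * (j + 1 / 2))) H).const_add 1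
  rw [add_zero] at this
  exact this.congr fun z => by rw [poleFactor, sub_eq_add_neg]

lemma tendsto_zeroFactor (hb : 0 < b.re) (j : ℕ) (H : ℝ) :
    Tendsto (zeroFactor b j) (leftStrip H) (𝓝 1) := by
  have := (tendsto_exp_leftStrip hb (I * b * (j + 1 / 2)) H).const_add 1
  rw [add_zero] at this
  exact this

lemma tendsto_prod_one {α : Type*} {l : Filter α} {f : ℕ → α → ℂ} (s : Finset ℕ)
    (h : ∀ j ∈ s, Tendsto (f j) l (𝓝 1)) : Tendsto (fun x => ∏ j ∈ s, f j x) l (𝓝 1) := by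
  simpa using tendsto_finsetProd s h

/-- Only finitely many of the local expressions occur for |Im z| ≤ H. In each of them the logarithm
is O(e^{2h Re z}), where h > 0 is the height of the contour, and the remaining factors tend to 1. -/
lemma tendsto_faddeev (hb : 0 < b.re) (H : ℝ) : Tendsto (faddeev b) (leftStrip H) (𝓝 1) := by
  rw [Metric.tendsto_nhds]
  intro ε hε
  refine eventually_of_forall_round (p := fun n z => dist (faddeevPiece b n z) 1 < ε) hb fun n => ?_
  obtain ⟨C, hC⟩ := exists_norm_faddeevLog_le hb (strip_lt hb)
  have hlog : Tendsto (fun z => faddeevLog b (z - I * b * n))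
      (leftStrip H ⊓ 𝓟 {z | |z.im - n * b.re| ≤ b.re / 2}) (𝓝 0) := by
    have h1 : Tendsto (fun z : ℂ => 2 * contourHeight b * (z - I * b * n).re) (leftStrip H) atBot := by
      refine Tendsto.const_mul_atBot (by have := contourHeight_pos hb; positivity) ?_
      simp only [sub_eq_add_neg, add_re]
      exact tendsto_atBot_add_const_right _ _ (tendsto_re_leftStrip H)
    have h2 := (Real.tendsto_exp_atBot.comp h1).const_mul C
    rw [mul_zero] at h2
    refine squeeze_zero_norm' (eventually_inf_principal.2 (.of_forall fun z hz => ?_))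
      (h2.mono_left inf_le_left)
    exact hC _ (by rw [im_sub_mul]; exact hz)
  have hE : Tendsto (fun z => faddeevIntegral b (z - I * b * n))
      (leftStrip H ⊓ 𝓟 {z | |z.im - n * b.re| ≤ b.re / 2}) (𝓝 1) := by
    simp only [faddeevIntegral_eq]
    simpa [Function.comp_def] using (Complex.continuous_exp.tendsto _).comp hlog
  have hP : Tendsto (faddeevPiece b n) (leftStrip H ⊓ 𝓟 {z | |z.im - n * b.re| ≤ b.re / 2})
      (𝓝 (1 * 1 / 1)) :=
    (hE.mul (tendsto_prod_one _ fun j _ => (tendsto_zeroFactor hb j H).mono_left inf_le_left)).div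
      (tendsto_prod_one _ fun j _ => (tendsto_poleFactor hb j H).mono_left inf_le_left) one_ne_zero
  rw [one_mul, div_one] at hP
  exact eventually_inf_principal.1 (Metric.tendsto_nhds.1 hP ε hε)

lemma eventually_poleFactor_ne_zero (hb : 0 < b.re) (H : ℝ) :
    ∀ᶠ z in leftStrip H, ∀ j ∈ Finset.range (round (z.im / b.re)).toNat, poleFactor b j z ≠ 0 := by
  refine eventually_of_forall_round (p := fun n z => ∀ j ∈ Finset.range n.toNat,
    poleFactor b j z ≠ 0) hb fun n => ?_
  filter_upwards [(Filter.eventually_all_finset (Finset.range n.toNat)).2 fun j _ =>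
    (tendsto_poleFactor hb j H).eventually_ne one_ne_zero] with z hz _ using hz

/-- At -z the exponential in the factor is the inverse of one tending to 0, so it cannot equal -1
far to the left. -/
lemma eventually_poleFactor_neg_ne_zero (hb : 0 < b.re) (H : ℝ) :
    ∀ᶠ z in leftStrip H, ∀ j ∈ Finset.range (round ((-z).im / b.re)).toNat,
      poleFactor b j (-z) ≠ 0 := by
  set K := ⌈H / b.re + 1⌉
  have h1 : ∀ᶠ z in leftStrip H, ∀ j ∈ Finset.range K.toNat, poleFactor b j (-z) ≠ 0 := by
    refine (Filter.eventually_all_finset _).2 fun j _ => ?_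
    have h2 := tendsto_exp_leftStrip hb (I * b * (j + 1 / 2)) H
    filter_upwards [(h2.const_add 1).eventually_ne (b₂ := 0) (by norm_num)] with z hz h0
    apply hz
    have e : exp (2 * Real.pi * b * (z + I * b * (j + 1 / 2))) *
        exp (2 * Real.pi * b * (-z - I * b * (j + 1 / 2))) = 1 := by
      rw [← Complex.exp_add, ← Complex.exp_zero]; congr 1; ring
    rw [poleFactor] at h0
    linear_combination (exp (2 * Real.pi * b * (z + I * b * (j + 1 / 2)))) * h0 - e
  filter_upwards [h1, eventually_leftStrip_mem H] with z hz hzH j hj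
  refine hz j (Finset.mem_range.2 ((Finset.mem_range.1 hj).trans_le ?_))
  have := (abs_le.1 (abs_round_le hb (z := -z) (by simpa using hzH))).2
  exact Int.toNat_le_toNat this

end WGZ

end

noncomputable section

namespace WGZ

open Filter MeasureTheory Set

/-! ### Inversion relation outside the strip of definition -/

variable {b : ℂ}

/-- On the boundary of the strip the rounding may choose a neighbouring index; there the overlap
identity `faddeevPiece_succ` applies. -/
lemma faddeev_eq_integral (hb : 0 < b.re) {z : ℂ} (hz : |z.im| ≤ b.re / 2) :
    faddeev b z = faddeevIntegral b z := by
  have h0 : faddeevPiece b 0 z = faddeevIntegral b z := by simp [faddeevPiece]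
  rw [faddeev_eq_piece, ← h0]
  have hk := abs_im_sub_round_mul_le hb z
  set k := round (z.im / b.re)
  have hk1 : |(k : ℝ)| ≤ 1 := by
    rw [abs_le] at hz hk ⊢
    constructor <;> nlinarith
  have hk2 : |k| ≤ 1 := by exact_mod_cast hk1
  rw [abs_le] at hk2
  have hlt := strip_lt hb
  obtain h | h | h : k = 0 ∨ k = 0 + 1 ∨ k = -1 := by omega
  · rw [h]
  · rw [h] at hk ⊢
    push_cast at hk
    exact (faddeevPiece_succ hb (by simpa using hz.trans_lt hlt) (by simpa using hk.trans_lt hlt)).symm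
  · rw [h] at hk ⊢
    have := faddeevPiece_succ hb (n := -1) (z := z) (hk.trans_lt hlt) (by
      push_cast; rw [neg_add_cancel, zero_mul, sub_zero]; exact hz.trans_lt hlt)
    rwa [neg_add_cancel] at this

/-- The inversion relation of Faddeev's quantum dilogarithm. -/
lemma eventually_faddeev_mul_neg (hb : 0 < b.re) (H : ℝ) : ∀ᶠ z in leftStrip H,
    faddeev b z * faddeev b (-z) = faddeevIntegral b 0 ^ 2 * exp (Real.pi * I * z ^ 2) := by
  set Inv : ℂ → Prop := fun z =>
    faddeev b z * faddeev b (-z) = faddeevIntegral b 0 ^ 2 * exp (Real.pi * I * z ^ 2) with hInv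
  -- Passing from z + ib to z multiplies both sides of the relation by e = e^{2πb(z + ib/2)}.
  have step (H : ℝ) : ∀ᶠ z in leftStrip H, (Inv z ↔ Inv (z + I * b)) := by
    filter_upwards [(tendsto_zeroFactor hb 0 H).eventually_ne one_ne_zero] with z hz
    set e := exp (2 * Real.pi * b * (z + I * b / 2)) with he
    have he0 : e ≠ 0 := exp_ne_zero _
    have z1 : zeroFactor b 0 z = 1 + e := by
      rw [zeroFactor, he]; congr 3; push_cast; ring
    have z2 : zeroFactor b 0 (-z - I * b) = 1 + e⁻¹ := by
      rw [zeroFactor, he, ← Complex.exp_neg]; congr 2; push_cast; ring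
    rw [z1] at hz
    have z3 : (1 + e) = e * (1 + e⁻¹) := by field_simp; ring
    have hz2 : 1 + e⁻¹ ≠ 0 := by
      intro h; rw [z3, h, mul_zero] at hz; exact hz rfl
    have f1 := faddeev_eq_mul hb (z1 ▸ hz : zeroFactor b 0 z ≠ 0)
    have f2 := faddeev_eq_mul hb (z2 ▸ hz2 : zeroFactor b 0 (-z - I * b) ≠ 0)
    rw [z1, z3] at f1
    rw [z2, sub_add_cancel] at f2
    have hE : exp (Real.pi * I * z ^ 2) = e * exp (Real.pi * I * (z + I * b) ^ 2) := by
      rw [he, ← Complex.exp_add]; congr 1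
      linear_combination (-2 * Real.pi * z * b - Real.pi * I * b ^ 2) * I_sq
    simp only [hInv]
    rw [f1, hE, neg_add', f2]
    constructor
    · intro h
      apply mul_left_cancel₀ he0; linear_combination h
    · intro h
      linear_combination e * h
  -- The induction carries all heights H at once, because the translation by ±ib enlarges the strip.
  have all (n : ℤ) : ∀ H, ∀ᶠ z in leftStrip H, |z.im - n * b.re| ≤ b.re / 2 → Inv z := by
    induction n with
    | zero =>
      refine fun H => .of_forall fun z hz => ?_
      rw [Int.cast_zero, zero_mul, sub_zero] at hz
      simp only [hInv]
      rw [faddeev_eq_integral hb hz, faddeev_eq_integral hb (by rwa [neg_im, abs_neg]),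
        faddeevIntegral_mul_neg hb (hz.trans_lt (strip_lt hb))]
    | succ n ih =>
      intro H
      filter_upwards [eventually_forall_add ih (-(I * b)) H, eventually_forall_add step (-(I * b)) H]
        with z h1 h2 hz
      rw [neg_add_cancel_right] at h2
      refine h2.1 (h1 ?_)
      have : (z + -(I * b)).im = z.im - b.re := by simp; ring
      rw [this]; push_cast at hz ⊢
      convert hz using 2; ring
    | pred n ih =>
      intro H
      filter_upwards [eventually_forall_add ih (I * b) H, step H] with z h1 h2 hz
      refine h2.2 (h1 ?_)
      have : (z + I * b).im = z.im + b.re := by simp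
      rw [this]; push_cast at hz ⊢
      convert hz using 2; ring
  exact eventually_of_forall_round (p := fun _ z => Inv z) hb fun n => all n H

/-! ### The entire function `Φ_b(z) ξ(c_b - z)` -/

/-- The quotient of two holomorphic functions, extended over simple zeros of the denominator. -/
def removableQuot (g h : ℂ → ℂ) (w : ℂ) : ℂ := if h w = 0 then deriv g w / deriv h w else g w / h w

lemma analyticAt_removableQuot {g h : ℂ → ℂ} {w : ℂ} (hg : AnalyticAt ℂ g w) (hh : AnalyticAt ℂ h w)
    (h0 : h w = 0 → g w = 0 ∧ deriv h w ≠ 0) : AnalyticAt ℂ (removableQuot g h) w := by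
  by_cases hw : h w = 0
  · obtain ⟨gw, hw'⟩ := h0 hw
    have hne : dslope h w w ≠ 0 := by rwa [dslope_same]
    have a1 := hg.dslope hg
    have a2 := hh.dslope hh
    refine (a1.div a2 hne).congr ?_
    filter_upwards [a2.continuousAt.eventually_ne hne] with x hx
    have e1 : h x = (x - w) * dslope h w x := by
      have := sub_smul_dslope h w x
      rw [hw, sub_zero, smul_eq_mul] at this; exact this.symm
    have e2 : g x = (x - w) * dslope g w x := by
      have := sub_smul_dslope g w x
      rw [gw, sub_zero, smul_eq_mul] at this; exact this.symm
    rcases eq_or_ne x w with rfl | hxw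
    · rw [removableQuot, if_pos hw, Pi.div_apply, dslope_same, dslope_same]
    · have hxw' := sub_ne_zero.2 hxw
      rw [removableQuot, if_neg (by rw [e1]; exact mul_ne_zero hxw' hx), Pi.div_apply, e1, e2]
      field_simp
  · refine (hg.div hh hw).congr ?_
    filter_upwards [hh.continuousAt.eventually_ne hw] with x hx
    rw [removableQuot, if_neg hx, Pi.div_apply]

/-- `1 + e^{2πbw}`. -/
def onePlusExp (b w : ℂ) : ℂ := 1 + exp (2 * Real.pi * b * w)

/-- `∏_{n ≥ 0} (1 - e^{-2πi(w - i b⁻¹(n + 1/2))})`. -/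
def rowFactor (b w : ℂ) : ℂ := xiRow b (I * b⁻¹ / 2 - w)

/-- The quotient `rowFactor / onePlusExp`, holomorphic for `Im w > - Re b⁻¹ / 2`. -/
def rowQuot (b : ℂ) : ℂ → ℂ := removableQuot (rowFactor b) (onePlusExp b)

/-- A zero of 1 + e^{2πbw} is a point i(k + 1/2)/b. The bound on Im w forces k ≥ 0, and then the
k-th factor of the row vanishes. -/
lemma rowFactor_eq_zero (hb : 0 < b.re) {w : ℂ} (hw : -((b⁻¹).re / 2) < w.im)
    (h : onePlusExp b w = 0) : rowFactor b w = 0 := by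
  have hb0 := ne_zero_of_re_pos hb
  have hρ := inv_re_pos hb
  have h1 : exp (2 * Real.pi * b * w) = exp (Real.pi * I) := by
    rw [Complex.exp_pi_mul_I]; rw [onePlusExp] at h; linear_combination h
  obtain ⟨k, hk⟩ := Complex.exp_eq_exp_iff_exists_int.1 h1
  have hpi : (2 * Real.pi : ℂ) ≠ 0 := by
    have : (Real.pi : ℂ) ≠ 0 := by exact_mod_cast Real.pi_ne_zero
    simp [this]
  have h2 : w = ((k : ℝ) + 1 / 2 : ℝ) * I * b⁻¹ := by
    have : b * w = (k + 1 / 2) * I := by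
      apply mul_left_cancel₀ hpi; linear_combination hk
    rw [show w = b * w * b⁻¹ by field_simp, this]; push_cast; ring
  have h3 : w.im = (k + 1 / 2) * (b⁻¹).re := by rw [h2]; simp [mul_assoc]
  have h4 : (-1 : ℝ) < k := by
    rw [h3] at hw; by_contra hlt
    rw [not_lt] at hlt
    nlinarith
  have h5 : 0 ≤ k := by
    have : (-1 : ℤ) < k := by exact_mod_cast h4
    omega
  obtain ⟨n, rfl⟩ := Int.eq_ofNat_of_zero_le h5
  refine xiRow_eq_zero n ?_
  rw [h2, ← Complex.exp_zero]
  congr 1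
  push_cast
  linear_combination (-2 * Real.pi * b⁻¹ * n) * I_sq

lemma analyticAt_rowQuot (hb : 0 < b.re) {w : ℂ} (hw : -((b⁻¹).re / 2) < w.im) :
    AnalyticAt ℂ (rowQuot b) w := by
  have hb0 := ne_zero_of_re_pos hb
  refine analyticAt_removableQuot ?_ ?_ fun h => ⟨rowFactor_eq_zero hb hw h, ?_⟩
  · exact ((differentiable_xiRow hb).comp (differentiable_id.const_sub _)).analyticAt w
  · exact (show Differentiable ℂ (onePlusExp b) by unfold onePlusExp; fun_prop).analyticAt w
  · have hd : HasDerivAt (onePlusExp b) (exp (2 * Real.pi * b * w) * (2 * Real.pi * b * 1)) w :=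
      (((hasDerivAt_id w).const_mul (2 * Real.pi * b)).cexp).const_add 1
    rw [hd.deriv]
    have : (Real.pi : ℂ) ≠ 0 := by exact_mod_cast Real.pi_ne_zero
    simp [hb0, this]

lemma rowQuot_mul (hb : 0 < b.re) {w : ℂ} (hw : -((b⁻¹).re / 2) < w.im) :
    rowQuot b w * onePlusExp b w = rowFactor b w := by
  rw [rowQuot, removableQuot]
  split_ifs with h
  · rw [h, mul_zero, rowFactor_eq_zero hb hw h]
  · field_simp

lemma xi_sub_eq_rowFactor_mul (hb : 0 < b.re) (z : ℂ) (m : ℕ) : xi b (cb b - z + I * b * m) =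
    rowFactor b (z - I * b * (m + 1 / 2)) * xi b (cb b - z + I * b * (m + 1 : ℕ)) := by
  rw [xi_eq_xiRow_mul hb, rowFactor]
  congr 2
  · rw [cb]; ring
  · push_cast; ring

/-- The m rows split off here are meant to cancel the factors `poleFactor b j`, j < m, of the
denominator of Φ_b. -/
lemma xi_sub_eq_prod (hb : 0 < b.re) (z : ℂ) (m : ℕ) :
    xi b (cb b - z) = (∏ j ∈ Finset.range m, rowFactor b (z - I * b * (j + 1 / 2))) *
      xi b (cb b - z + I * b * m) := by
  induction m with
  | zero => simp
  | succ m ih =>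
    rw [ih, Finset.prod_range_succ, xi_sub_eq_rowFactor_mul hb]; ring

/-- The expression of `theta` in the strip around `Im z = n Re b`. -/
def thetaPiece (b : ℂ) (n : ℤ) (z : ℂ) : ℂ :=
  faddeevIntegral b (z - I * b * n) * (∏ j ∈ Finset.range (-n).toNat, zeroFactor b j z) *
    (xi b (cb b - z + I * b * n.toNat) *
      ∏ j ∈ Finset.range n.toNat, rowQuot b (z - I * b * (j + 1 / 2)))

/-- The entire function which is equal to `Φ_b(z) ξ(c_b - z)` off the poles of `Φ_b`. -/
def theta (b z : ℂ) : ℂ := thetaPiece b (round (z.im / b.re)) z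

lemma im_sub_lt (hb : 0 < b.re) {n : ℤ} {z : ℂ} (h : |z.im - n * b.re| < (b.re + (b⁻¹).re) / 2)
    {j : ℕ} (hj : j ∈ Finset.range n.toNat) :
    -((b⁻¹).re / 2) < (z - I * b * (j + 1 / 2)).im := by
  have h1 : (z - I * b * (j + 1 / 2)).im = z.im - (j + 1 / 2) * b.re := by simp; ring
  have h2 : (j : ℤ) + 1 ≤ n := by have := Finset.mem_range.1 hj; omega
  have h3 : (j : ℝ) + 1 ≤ n := by exact_mod_cast h2
  rw [h1]
  have := (abs_lt.1 h).1
  nlinarith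

/-- For n ≥ 0 the factor gained by the integral multiplies the new `rowQuot` back to the row that
has been split off from ξ. For n < 0 it is one of the numerator factors, as in `faddeevPiece_succ`.
-/
lemma thetaPiece_succ (hb : 0 < b.re) {n : ℤ} {z : ℂ}
    (h1 : |z.im - n * b.re| < (b.re + (b⁻¹).re) / 2)
    (h2 : |z.im - (n + 1) * b.re| < (b.re + (b⁻¹).re) / 2) :
    thetaPiece b n z = thetaPiece b (n + 1) z := by
  obtain ⟨hne, hE⟩ := faddeevIntegral_sub_one hb h1 h2
  simp only [thetaPiece, hE]
  obtain ⟨m, hm⟩ | ⟨m, hm⟩ : (∃ m : ℕ, n = m) ∨ ∃ m : ℕ, n = -(m + 1 : ℤ) := by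
    rcases n with m | m
    · exact .inl ⟨m, rfl⟩
    · exact .inr ⟨m, by rw [Int.negSucc_eq]⟩
  · have e1 : n.toNat = m := by omega
    have e2 : (n + 1).toNat = m + 1 := by omega
    have e3 : (-n).toNat = 0 := by omega
    have e4 : (-(n + 1)).toNat = 0 := by omega
    have e6 := rowQuot_mul hb (im_sub_lt hb (n := n + 1) (by push_cast; exact h2)
      (j := m) (by rw [e2]; simp))
    have e5 : onePlusExp b (z - I * b * (m + 1 / 2)) =
        1 + exp (2 * Real.pi * b * (z - I * b * (n + 1 / 2))) := by
      rw [onePlusExp, hm, Int.cast_natCast]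
    rw [e5] at e6
    simp only [e1, e2, e3, e4, Finset.prod_range_succ, xi_sub_eq_rowFactor_mul hb z m, ← e6]
    ring
  · have e1 : n.toNat = 0 := by omega
    have e2 : (n + 1).toNat = 0 := by omega
    have e3 : (-n).toNat = m + 1 := by omega
    have e4 : (-(n + 1)).toNat = m := by omega
    have e5 : zeroFactor b m z = 1 + exp (2 * Real.pi * b * (z - I * b * (n + 1 / 2))) := by
      rw [zeroFactor, hm]; congr 3; push_cast; ring
    simp only [e1, e2, e3, e4, Finset.prod_range_succ, e5]
    ring

lemma differentiable_theta (hb : 0 < b.re) : Differentiable ℂ (theta b) := by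
  intro z
  have hz := (abs_im_sub_round_mul_le hb z).trans_lt (strip_lt hb)
  refine (analyticAt_glue (Ψ := thetaPiece b) hb (strip_lt hb) ?_
    fun n z h1 h2 => thetaPiece_succ hb h1 h2).differentiableAt
  refine ((AnalyticAt.fun_comp (analyticAt_faddeevIntegral hb ?_) ?_).mul ?_).mul (.mul ?_ ?_)
  · rw [im_sub_mul]; exact hz
  · fun_prop
  · exact Finset.analyticAt_fun_prod _ fun j _ => (differentiable_zeroFactor b j).analyticAt z
  · exact ((differentiable_xi hb).comp (by fun_prop)).analyticAt z
  · refine Finset.analyticAt_fun_prod _ fun j hj => ?_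
    exact AnalyticAt.fun_comp (analyticAt_rowQuot hb (im_sub_lt hb hz hj)) (by fun_prop)

lemma theta_eq_of_poleFactor_ne_zero (hb : 0 < b.re) {z : ℂ}
    (hz : ∀ j ∈ Finset.range (round (z.im / b.re)).toNat, poleFactor b j z ≠ 0) :
    theta b z = faddeev b z * xi b (cb b - z) := by
  have h := (abs_im_sub_round_mul_le hb z).trans_lt (strip_lt hb)
  rw [theta, faddeev_eq_piece, thetaPiece, faddeevPiece]
  set k := round (z.im / b.re)
  rw [xi_sub_eq_prod hb z k.toNat]
  have e : ∏ j ∈ Finset.range k.toNat, rowFactor b (z - I * b * (j + 1 / 2)) =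
      (∏ j ∈ Finset.range k.toNat, rowQuot b (z - I * b * (j + 1 / 2))) *
        ∏ j ∈ Finset.range k.toNat, poleFactor b j z := by
    rw [← Finset.prod_mul_distrib]
    exact Finset.prod_congr rfl fun j hj => (rowQuot_mul hb (im_sub_lt hb h hj)).symm
  have hP := Finset.prod_ne_zero_iff.2 hz
  rw [e]
  generalize ∏ j ∈ Finset.range k.toNat, poleFactor b j z = P at *
  generalize ∏ j ∈ Finset.range k.toNat, rowQuot b (z - I * b * (j + 1 / 2)) = Q at *
  field_simp

/-- A vanishing `poleFactor b j` in the denominator makes the j-th row of ξ(c_b - z) vanish. So off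
the zeros of ξ(c_b - z) the value 0 assigned to Φ_b at its poles does no harm. -/
lemma theta_eq (hb : 0 < b.re) {z : ℂ} (hz : xi b (cb b - z) ≠ 0) :
    theta b z = faddeev b z * xi b (cb b - z) := by
  have h := (abs_im_sub_round_mul_le hb z).trans_lt (strip_lt hb)
  refine theta_eq_of_poleFactor_ne_zero hb fun j hj h0 => hz ?_
  rw [xi_sub_eq_prod hb z (round (z.im / b.re)).toNat]
  exact mul_eq_zero_of_left (Finset.prod_eq_zero hj (rowFactor_eq_zero hb (im_sub_lt hb h hj) h0)) _

lemma eventually_theta_eq (hb : 0 < b.re) (H : ℝ) :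
    ∀ᶠ z in leftStrip H, theta b z = faddeev b z * xi b (cb b - z) :=
  (eventually_poleFactor_ne_zero hb H).mono fun _ => theta_eq_of_poleFactor_ne_zero hb

lemma eventually_theta_neg_eq (hb : 0 < b.re) (H : ℝ) :
    ∀ᶠ z in leftStrip H, theta b (-z) = faddeev b (-z) * xi b (cb b + z) := by
  filter_upwards [eventually_poleFactor_neg_ne_zero hb H] with z hz
  rw [theta_eq_of_poleFactor_ne_zero hb hz, sub_neg_eq_add]

end WGZ

end

noncomputable section

namespace WGZ

open Filter MeasureTheory Set

/-! ### Finite products of `q`-difference operators -/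

/-- The shift `f ↦ f(· + 1)`. -/
def shiftOp : Module.End ℂ (ℂ → ℂ) := LinearMap.funLeft ℂ ℂ (· + 1)

/-- The operator `∏_{a ∈ A} (1 - q_a S)`, where `S` is the shift by `1` and `q_a = xiCoeff b a`. -/
def opr (b : ℂ) (A : Finset (ℕ × ℕ)) : Module.End ℂ (ℂ → ℂ) :=
  Polynomial.aeval shiftOp (∏ a ∈ A, (1 - Polynomial.C (xiCoeff b a) * Polynomial.X))

variable {b : ℂ} {A : Finset (ℕ × ℕ)} {f g : ℂ → ℂ}

@[simp] lemma opr_empty (b : ℂ) (f : ℂ → ℂ) : opr b ∅ f = f := by simp [opr]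

lemma opr_insert {a : ℕ × ℕ} (ha : a ∉ A) (f : ℂ → ℂ) (z : ℂ) :
    opr b (insert a A) f z = opr b A f z - xiCoeff b a * opr b A f (z + 1) := by
  rw [opr, Finset.prod_insert ha, map_mul]
  simp [opr, shiftOp, LinearMap.funLeft, Module.algebraMap_end_apply]

lemma opr_union {B : Finset (ℕ × ℕ)} (h : Disjoint A B) (f : ℂ → ℂ) :
    opr b (A ∪ B) f = opr b A (opr b B f) := by
  rw [opr, Finset.prod_union h, map_mul]; rfl

lemma opr_induction {P : (ℂ → ℂ) → Prop} (step : ∀ (q : ℂ) f, P f → P fun z => f z - q * f (z + 1))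
    (A : Finset (ℕ × ℕ)) (hf : P f) : P (opr b A f) := by
  induction A using Finset.induction_on with
  | empty => simpa using hf
  | insert a A ha ih =>
    have : opr b (insert a A) f = fun z => opr b A f z - xiCoeff b a * opr b A f (z + 1) :=
      funext fun z => opr_insert ha f z
    rw [this]; exact step _ _ ih

/-- Multiplication by a 1-periodic function commutes with the shift. This carries tameness from Φ_b
over to its product with ξ(c_b - z). -/
lemma opr_periodic_mul (hg : ∀ z, g (z + 1) = g z) (A : Finset (ℕ × ℕ)) (f : ℂ → ℂ) (z : ℂ) :
    opr b A (fun z => g z * f z) z = g z * opr b A f z := by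
  induction A using Finset.induction_on generalizing z with
  | empty => simp
  | insert a A ha ih => rw [opr_insert ha, opr_insert ha, ih, ih, hg]; ring

lemma opr_comp_add (A : Finset (ℕ × ℕ)) (f : ℂ → ℂ) (d z : ℂ) :
    opr b A (fun z => f (z + d)) z = opr b A f (z + d) := by
  induction A using Finset.induction_on generalizing z with
  | empty => simp
  | insert a A ha ih => rw [opr_insert ha, opr_insert ha, ih, ih, add_right_comm]

/-- The translate `{(k + 1, l) : (k, l) ∈ A}`. -/
def succFst (A : Finset (ℕ × ℕ)) : Finset (ℕ × ℕ) :=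
  A.map ((⟨Nat.succ, Nat.succ_injective⟩ : ℕ ↪ ℕ).prodMap (Function.Embedding.refl ℕ))

lemma xiCoeff_succ_mul (b : ℂ) (k l : ℕ) (z : ℂ) :
    xiCoeff b (k + 1, l) * exp (2 * Real.pi * b * (z + 1)) =
      xiCoeff b (k, l) * exp (2 * Real.pi * b * z) := by
  have : nome b * exp (2 * Real.pi * b * (z + 1)) = exp (2 * Real.pi * b * z) := by
    rw [nome, ← exp_add]; congr 1; ring
  rw [← this]; simp only [xiCoeff]; ring

/-- Moving the shift past e^{2πbz} costs a factor e^{2πb}, and q_{k+1,l} e^{2πb} = q_{k,l}. Hence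
the translation of the index set. -/
lemma opr_succFst (A : Finset (ℕ × ℕ)) (f : ℂ → ℂ) (z : ℂ) :
    opr b (succFst A) (fun z => exp (2 * Real.pi * b * z) * f z) z =
      exp (2 * Real.pi * b * z) * opr b A f z := by
  induction A using Finset.induction_on generalizing z with
  | empty => simp [succFst]
  | insert a A ha ih =>
    obtain ⟨k, l⟩ := a
    have h : succFst (insert (k, l) A) = insert (k + 1, l) (succFst A) := by
      simp [succFst, Function.Embedding.prodMap]
    have h' : (k + 1, l) ∉ succFst A := by
      simpa [succFst, Function.Embedding.prodMap] using ha
    rw [h, opr_insert h', opr_insert ha, ih, ih, ← mul_assoc, xiCoeff_succ_mul]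
    ring

lemma opr_eigen {c : ℂ} (hf : ∀ z, f (z + 1) = c * f z) (A : Finset (ℕ × ℕ)) (z : ℂ) :
    opr b A f z = (∏ a ∈ A, (1 - xiCoeff b a * c)) * f z := by
  induction A using Finset.induction_on generalizing z with
  | empty => simp
  | insert a A ha ih => rw [opr_insert ha, ih, ih, hf, Finset.prod_insert ha]; ring

/-- The row `{(0, l) : l < N}`. -/
def rowSet (N : ℕ) : Finset (ℕ × ℕ) :=
  (Finset.range N).map ⟨fun l => (0, l), fun _ _ h => (Prod.ext_iff.1 h).2⟩

lemma mem_rowSet {N l : ℕ} (h : l < N) : (0, l) ∈ rowSet N :=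
  Finset.mem_map.2 ⟨l, Finset.mem_range.2 h, rfl⟩

lemma disjoint_rowSet_succFst (N : ℕ) (A : Finset (ℕ × ℕ)) : Disjoint (rowSet N) (succFst A) := by
  rw [Finset.disjoint_left]
  rintro ⟨k, l⟩ h h'
  obtain ⟨_, _, h⟩ := Finset.mem_map.1 h
  obtain ⟨_, _, h'⟩ := Finset.mem_map.1 h'
  exact absurd ((Prod.ext_iff.1 h').1.trans (Prod.ext_iff.1 h).1.symm) (Nat.succ_ne_zero _)

/-- The shift multiplies e^{2πnz/b} by e^{2πn/b} = 1 / q_{0,n}, so the factor with index (0, n)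
kills it. -/
lemma opr_rowSet_exp (N : ℕ) {n : ℕ} (hn : n < N) (c z : ℂ) :
    opr b (rowSet N) (fun z => c * exp (2 * Real.pi * b⁻¹ * z) ^ n) z = 0 := by
  rw [opr_eigen (c := exp (2 * Real.pi * b⁻¹) ^ n), Finset.prod_eq_zero (mem_rowSet hn), zero_mul]
  · simp only [xiCoeff, pow_zero, one_mul, nome]
    rw [← mul_pow, ← exp_add]; simp
  · intro z; rw [mul_add, exp_add, mul_one]; ring

/-! ### Exponential decay in left strips -/

/-- `f z = O(e^{2πσ Re z})` as `Re z → -∞` in every horizontal strip. -/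
def LeftO (σ : ℝ) (f : ℂ → ℂ) : Prop :=
  ∀ H, f =O[leftStrip H] fun z => Real.exp (2 * Real.pi * σ * z.re)

lemma LeftO.congr {σ : ℝ} (hf : LeftO σ f) (h : ∀ H, ∀ᶠ z in leftStrip H, f z = g z) : LeftO σ g :=
  fun H => (hf H).congr' (h H) (EventuallyEq.refl _ _)

lemma LeftO.mono {σ σ' : ℝ} (hf : LeftO σ f) (h : σ' ≤ σ) : LeftO σ' f := by
  refine fun H => (hf H).trans (Asymptotics.IsBigO.of_bound 1 ?_)
  filter_upwards [(tendsto_re_leftStrip H).eventually (eventually_le_atBot 0)] with z hz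
  rw [one_mul, Real.norm_eq_abs, Real.norm_eq_abs, Real.abs_exp, Real.abs_exp, Real.exp_le_exp]
  have := Real.pi_pos
  have : σ * z.re ≤ σ' * z.re := mul_le_mul_of_nonpos_right h hz
  nlinarith

lemma LeftO.comp_add {σ : ℝ} (hf : LeftO σ f) (d : ℂ) : LeftO σ fun z => f (z + d) := by
  intro H
  refine ((hf (H + |d.im|)).comp_tendsto (tendsto_add_leftStrip d H)).trans
    (Asymptotics.IsBigO.of_bound (Real.exp (2 * Real.pi * σ * d.re)) (.of_forall fun z => ?_))
  simp only [Function.comp_apply, Real.norm_eq_abs, Real.abs_exp, add_re]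
  rw [← Real.exp_add]; apply le_of_eq; congr 1; ring

lemma LeftO.sub {σ : ℝ} (hf : LeftO σ f) (hg : LeftO σ g) : LeftO σ fun z => f z - g z :=
  fun H => (hf H).sub (hg H)

lemma LeftO.const_mul {σ : ℝ} (hf : LeftO σ f) (c : ℂ) : LeftO σ fun z => c * f z :=
  fun H => (hf H).const_mul_left c

lemma LeftO.opr {σ : ℝ} (hf : LeftO σ f) (A : Finset (ℕ × ℕ)) : LeftO σ (opr b A f) :=
  opr_induction (P := LeftO σ) (fun q _ h => h.sub ((h.comp_add 1).const_mul q)) A hf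

lemma LeftO.exp_mul {σ : ℝ} (hf : LeftO σ f) (b : ℂ) :
    LeftO (σ + b.re) fun z => exp (2 * Real.pi * b * z) * f z := by
  intro H
  have h1 : (fun z => exp (2 * Real.pi * b * z)) =O[leftStrip H]
      fun z => Real.exp (2 * Real.pi * b.re * z.re) := by
    refine Asymptotics.IsBigO.of_bound (Real.exp (2 * Real.pi * (|b.im| * H))) ?_
    filter_upwards [eventually_leftStrip_mem H] with z hz
    rw [Real.norm_eq_abs, Real.abs_exp]; exact norm_exp_two_pi_mul_le b hz
  refine (h1.mul (hf H)).congr_right fun z => ?_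
  rw [← Real.exp_add]; congr 1; ring

lemma LeftO.mul_bounded {σ : ℝ} (hf : LeftO σ f)
    (hg : ∀ H, g =O[leftStrip H] fun _ => (1 : ℝ)) : LeftO σ fun z => g z * f z :=
  fun H => ((hg H).mul (hf H)).congr_right fun _ => one_mul _

lemma LeftO.bound {σ : ℝ} (hf : LeftO σ f) (H : ℝ) : ∃ C R : ℝ, 0 ≤ C ∧ ∀ z : ℂ, z.re ≤ R →
    |z.im| ≤ H → ‖f z‖ ≤ C * Real.exp (2 * Real.pi * σ * z.re) := by
  obtain ⟨C, hC, h⟩ := (hf H).exists_nonneg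
  obtain ⟨R, hR⟩ := eventually_leftStrip.1 h.bound
  refine ⟨C, R, hC, fun z hz hz' => ?_⟩
  simpa [abs_of_pos (Real.exp_pos _)] using hR z hz hz'

lemma opr_eventually_congr (h : ∀ H, ∀ᶠ z in leftStrip H, f z = g z) (A : Finset (ℕ × ℕ)) (H : ℝ) :
    ∀ᶠ z in leftStrip H, opr b A f z = opr b A g z := by
  induction A using Finset.induction_on generalizing H with
  | empty => simpa using h H
  | insert a A ha ih =>
    filter_upwards [ih H, eventually_forall_add ih 1 H] with z h1 h2
    rw [opr_insert ha, opr_insert ha, h1, h2]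

lemma opr_eventually_analyticAt (h : ∀ H, ∀ᶠ z in leftStrip H, AnalyticAt ℂ f z)
    (A : Finset (ℕ × ℕ)) (H : ℝ) : ∀ᶠ z in leftStrip H, AnalyticAt ℂ (opr b A f) z := by
  revert H
  refine opr_induction (P := fun f => ∀ H, ∀ᶠ z in leftStrip H, AnalyticAt ℂ f z) ?_ A h
  intro q f hf H
  filter_upwards [hf H, eventually_forall_add hf 1 H] with z h1 h2
  exact h1.sub (analyticAt_const.mul (AnalyticAt.fun_comp (g := f) (f := fun z => z + 1) h2 (by fun_prop)))

lemma differentiable_opr (hf : Differentiable ℂ f) (A : Finset (ℕ × ℕ)) :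
    Differentiable ℂ (opr b A f) :=
  opr_induction (P := fun f => Differentiable ℂ f) (fun q f h => by fun_prop) A hf

/-- Each factor 1 - qS also uses the value at z + 1, so the half-line of validity shrinks by one per
factor. Only points of one horizontal line enter, which permits approximants varying from line to
line. -/
lemma norm_opr_le {σ R C y : ℝ} (A : Finset (ℕ × ℕ)) (h : ∀ z : ℂ, z.im = y → z.re ≤ R →
      ‖f z‖ ≤ C * Real.exp (2 * Real.pi * σ * z.re)) (z : ℂ) (hy : z.im = y)
    (hz : z.re ≤ R - A.card) :
    ‖opr b A f z‖ ≤ (C * ∏ a ∈ A, (1 + ‖xiCoeff b a‖ * Real.exp (2 * Real.pi * σ))) *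
      Real.exp (2 * Real.pi * σ * z.re) := by
  induction A using Finset.induction_on generalizing z with
  | empty => simpa using h z hy (by simpa using hz)
  | insert a A ha ih =>
    rw [Finset.card_insert_of_notMem ha] at hz
    push_cast at hz
    have h1 := ih z hy (by linarith)
    have h2 := ih (z + 1) (by simpa using hy) (by simp; linarith)
    rw [opr_insert ha, Finset.prod_insert ha]
    refine (norm_sub_le _ _).trans ?_
    rw [norm_mul]
    have h3 := mul_le_mul_of_nonneg_left h2 (norm_nonneg (xiCoeff b a))
    have e : Real.exp (2 * Real.pi * σ * (z + 1).re) =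
        Real.exp (2 * Real.pi * σ) * Real.exp (2 * Real.pi * σ * z.re) := by
      rw [← Real.exp_add]; congr 1; simp; ring
    rw [e] at h3
    refine (add_le_add h1 h3).trans (le_of_eq ?_)
    ring

/-- If on every horizontal line `F` is a combination of the exponentials `e^{2πnz/b}`, `n < N`, up
to a uniformly decaying remainder, then the row operator turns it into a decaying function. -/
lemma leftO_opr_rowSet {F : ℂ → ℂ} {σ : ℝ} {N : ℕ} (h : ∀ H : ℝ, ∃ C R : ℝ, ∀ y : ℝ, |y| ≤ H →
      ∃ c : ℕ → ℂ, ∀ z : ℂ, z.im = y → z.re ≤ R →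
        ‖F z - ∑ n ∈ Finset.range N, c n * exp (2 * Real.pi * b⁻¹ * z) ^ n‖ ≤
          C * Real.exp (2 * Real.pi * σ * z.re)) :
    LeftO σ (opr b (rowSet N) F) := by
  intro H
  obtain ⟨C, R, hCR⟩ := h H
  refine Asymptotics.IsBigO.of_bound
    (C * ∏ a ∈ rowSet N, (1 + ‖xiCoeff b a‖ * Real.exp (2 * Real.pi * σ)))
    (eventually_leftStrip.2 ⟨R - (rowSet N).card, fun z hz hz' => ?_⟩)
  -- The coefficients may depend on the line, as the operators preserve it; the constant C may not.
  obtain ⟨c, hc⟩ := hCR z.im hz'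
  rw [Real.norm_eq_abs, Real.abs_exp]
  refine le_of_eq_of_le (congrArg norm ?_) (norm_opr_le (b := b) (rowSet N) hc z rfl hz)
  have : (fun z => F z - ∑ n ∈ Finset.range N, c n * exp (2 * Real.pi * b⁻¹ * z) ^ n) =
      F - ∑ n ∈ Finset.range N, fun z => c n * exp (2 * Real.pi * b⁻¹ * z) ^ n := by
    ext z; simp
  rw [this, map_sub, map_sum, Pi.sub_apply, Finset.sum_apply, Finset.sum_eq_zero, sub_zero]
  exact fun n hn => opr_rowSet_exp N (Finset.mem_range.1 hn) _ _

end WGZ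

end

noncomputable section

namespace WGZ

open Filter MeasureTheory Set

/-! ### Difference equations in left half-strips -/

variable {b : ℂ}

/-- The `ib`-periodic exponential `e^{-2πu/b}`. -/
def kerExp (b u : ℂ) : ℂ := exp (-(2 * Real.pi * b⁻¹ * u))

lemma differentiable_kerExp (b : ℂ) : Differentiable ℂ (kerExp b) := by
  unfold kerExp; fun_prop

lemma kerExp_add_mul (hb : b ≠ 0) (u s : ℂ) :
    kerExp b (u + s * (I * b)) = kerExp b u * exp (-(2 * Real.pi * I * s)) := by
  rw [kerExp, kerExp, ← exp_add]; congr 1; field_simp; ring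

lemma norm_kerExp_real (b : ℂ) (y : ℝ) :
    ‖kerExp b y‖ = Real.exp (-(2 * Real.pi * (b⁻¹).re * y)) := by
  rw [kerExp, norm_exp]; congr 1
  simp only [neg_re, mul_re, re_ofNat, im_ofNat, ofReal_re, ofReal_im, mul_im]; ring

lemma norm_exp_neg_two_pi_I_mul (s : ℝ) : ‖exp (-(2 * Real.pi * I * s))‖ = 1 := by
  rw [norm_exp]; simp

lemma norm_kerExp_add (hb : b ≠ 0) (y s : ℝ) :
    ‖kerExp b (y + s * (I * b))‖ = Real.exp (-(2 * Real.pi * (b⁻¹).re * y)) := by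
  rw [kerExp_add_mul hb, norm_mul, norm_exp_neg_two_pi_I_mul, mul_one, norm_kerExp_real]

lemma kerExp_ne_one (hb : 0 < b.re) {u : ℂ} (hu : |u.im| < b.re) (h0 : u ≠ 0) : kerExp b u ≠ 1 := by
  intro h
  obtain ⟨n, hn⟩ := exp_eq_one_iff.1 h
  have hb0 := ne_zero_of_re_pos hb
  have hu' : u = I * b * (-n : ℤ) := by
    have : (2 * Real.pi : ℂ) ≠ 0 := mul_ne_zero two_ne_zero (ofReal_ne_zero.2 Real.pi_ne_zero)
    apply mul_left_cancel₀ this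
    field_simp at hn
    push_cast
    linear_combination -2 * Real.pi * hn
  have h1 : u.im = b.re * (-n : ℤ) := by rw [hu']; simp
  rw [h1, abs_mul, abs_of_pos hb] at hu
  have h2 : |((-n : ℤ) : ℝ)| < 1 := by
    by_contra! h'
    exact absurd (le_mul_of_one_le_right hb.le h') (not_le.2 hu)
  rw [← Int.cast_abs] at h2
  have h3 : -n = 0 := Int.abs_lt_one_iff.1 (by exact_mod_cast h2)
  exact h0 (by rw [hu', h3]; simp)

/-- The removable quotient `(F w - F z) / (1 - e^{-2π(w - z)/b})` is analytic. -/
lemma analyticAt_dslope_div (hb : 0 < b.re) {F : ℂ → ℂ} {z w : ℂ} (hz : AnalyticAt ℂ F z)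
    (hw : AnalyticAt ℂ F w) (h : |(w - z).im| < b.re) :
    AnalyticAt ℂ (fun w => dslope F z w / dslope (fun u => 1 - kerExp b u) 0 (w - z)) w := by
  have he : Differentiable ℂ fun u => 1 - kerExp b u := (differentiable_kerExp b).const_sub 1
  refine (hz.dslope hw).div ?_ ?_
  · exact AnalyticAt.fun_comp (g := dslope (fun u => 1 - kerExp b u) 0) (f := fun w => w - z)
      ((he.analyticAt _).dslope (he.analyticAt _)) (by fun_prop)
  · rcases eq_or_ne (w - z) 0 with h0 | h0
    · rw [h0, dslope_same]
      have : HasDerivAt (fun u => 1 - kerExp b u) (2 * Real.pi * b⁻¹) 0 := by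
        have h := (((hasDerivAt_id (0 : ℂ)).const_mul (2 * Real.pi * b⁻¹)).neg.cexp).const_sub 1
        simpa [kerExp] using h
      rw [this.deriv]
      exact mul_ne_zero (mul_ne_zero two_ne_zero (ofReal_ne_zero.2 Real.pi_ne_zero))
        (inv_ne_zero (ne_zero_of_re_pos hb))
    · rw [dslope_of_ne _ h0, slope_def_field]
      refine div_ne_zero ?_ (by simpa using h0)
      have : kerExp b 0 = 1 := by simp [kerExp]
      rw [this, sub_self, sub_zero]
      exact sub_ne_zero.2 (kerExp_ne_one hb h h0).symm

lemma dslope_div_dslope (b : ℂ) (F : ℂ → ℂ) {z w : ℂ} (h : w ≠ z) :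
    dslope F z w / dslope (fun u => 1 - kerExp b u) 0 (w - z) =
      (F w - F z) / (1 - kerExp b (w - z)) := by
  have h0 : w - z ≠ 0 := sub_ne_zero.2 h
  have : kerExp b 0 = 1 := by simp [kerExp]
  rw [dslope_of_ne _ h, dslope_of_ne _ h0, slope_def_field, slope_def_field, this, sub_self,
    sub_zero, sub_zero, div_div_div_cancel_right₀ h0]

/-- The quotient of 1 + |`kerExp b y`| by 1 + `kerExp b y` is continuous: a zero of the denominator
would have modulus one, hence y = 0, where the denominator is 2. It is bounded by 3 where |`kerExp b
y`| is at most 1/2 or at least 2. -/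
lemma exists_le_norm_one_add_kerExp (hb : 0 < b.re) : ∃ δ > 0, ∀ y : ℝ,
    δ * (1 + Real.exp (-(2 * Real.pi * (b⁻¹).re * y))) ≤ ‖1 + kerExp b y‖ := by
  have hρ := inv_re_pos hb
  have hk : 0 < 2 * Real.pi * (b⁻¹).re := by have := Real.pi_pos; positivity
  set k := 2 * Real.pi * (b⁻¹).re
  have hne (y : ℝ) : 1 + kerExp b y ≠ 0 := by
    intro h
    have h1 : kerExp b y = -1 := by linear_combination h
    have h2 := congrArg norm h1
    rw [norm_kerExp_real, norm_neg, norm_one, Real.exp_eq_one_iff, neg_eq_zero] at h2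
    have h3 : y = 0 := (mul_eq_zero.1 h2).resolve_left hk.ne'
    rw [h3] at h1; simp [kerExp] at h1; norm_num at h1
  have hc : Continuous fun y : ℝ => ((1 + Real.exp (-(k * y)) : ℝ) : ℂ) / (1 + kerExp b y) :=
    Continuous.div (by fun_prop)
      (continuous_const.add ((differentiable_kerExp b).continuous.comp continuous_ofReal)) hne
  obtain ⟨C, hC⟩ := exists_forall_norm_le_exp hc (C := 3) (κ := 0) (by
    have key (y : ℝ) (h : Real.exp (-(k * y)) ≤ 1 / 2 ∨ 2 ≤ Real.exp (-(k * y))) :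
        ‖((1 + Real.exp (-(k * y)) : ℝ) : ℂ) / (1 + kerExp b y)‖ ≤ 3 * Real.exp (-0 * |y|) := by
      have hp := Real.exp_pos (-(k * y))
      rw [neg_zero, zero_mul, Real.exp_zero, mul_one, norm_div, norm_real, Real.norm_eq_abs,
        abs_of_pos (by linarith), div_le_iff₀ (norm_pos_iff.2 (hne y))]
      have hn : ‖kerExp b y‖ = Real.exp (-(k * y)) := norm_kerExp_real b y
      rcases h with h | h
      · have := norm_sub_norm_le (1 : ℂ) (-kerExp b y)
        rw [norm_one, norm_neg, hn, sub_neg_eq_add] at this; linarith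
      · have := norm_sub_norm_le (kerExp b y) (-1)
        rw [norm_neg, norm_one, hn, sub_neg_eq_add, add_comm] at this; linarith
    rw [cocompact_eq_atBot_atTop, eventually_sup]
    constructor
    · have : Tendsto (fun y : ℝ => Real.exp (-(k * y))) atBot atTop :=
        Real.tendsto_exp_atTop.comp (tendsto_neg_atBot_atTop.comp (tendsto_id.const_mul_atBot hk))
      filter_upwards [this.eventually_ge_atTop 2] with y hy using key y (.inr hy)
    · have : Tendsto (fun y : ℝ => Real.exp (-(k * y))) atTop (𝓝 0) :=
        Real.tendsto_exp_atBot.comp (tendsto_neg_atTop_atBot.comp (tendsto_id.const_mul_atTop hk))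
      filter_upwards [this.eventually (eventually_le_nhds (b := 1 / 2) (by norm_num))] with y hy
        using key y (.inl hy))
  have hC0 : 0 < C := by
    have := (norm_pos_iff.2 (div_ne_zero (by
      rw [ne_eq, ofReal_eq_zero]; positivity) (hne 0))).trans_le (hC 0)
    simpa using this
  refine ⟨C⁻¹, inv_pos.2 hC0, fun y => ?_⟩
  have := hC y
  rw [neg_zero, zero_mul, Real.exp_zero, mul_one, norm_div, norm_real, Real.norm_eq_abs,
    abs_of_pos (by positivity), div_le_iff₀ (norm_pos_iff.2 (hne y))] at this
  rwa [inv_mul_le_iff₀ hC0]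

lemma inv_one_sub_eq_geom {E : ℂ} (h : E ≠ 1) (N : ℕ) (v : ℂ) :
    v / (1 - E) = ∑ n ∈ Finset.range N, v * E ^ n + v * E ^ N / (1 - E) := by
  have h' : 1 - E ≠ 0 := sub_ne_zero.2 h.symm
  rw [← Finset.mul_sum, div_eq_iff h', add_mul, div_mul_cancel₀ _ h']
  linear_combination -v * geom_sum_mul_neg E N

lemma integral_exp_two_pi_I (n : ℕ) :
    ∫ s in (0 : ℝ)..1, exp (-(2 * Real.pi * I * ((s - 1 / 2 : ℝ) : ℂ))) ^ n =
      if n = 0 then 1 else 0 := by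
  split_ifs with hn
  · simp [hn]
  have hc : -(2 * Real.pi * I * n) ≠ 0 := by
    simp [Real.pi_ne_zero, hn]
  have h1 (s : ℝ) : exp (-(2 * Real.pi * I * ((s - 1 / 2 : ℝ) : ℂ))) ^ n =
      exp (Real.pi * I * n) * exp (-(2 * Real.pi * I * n) * s) := by
    rw [← exp_nat_mul, ← exp_add]; congr 1; push_cast; ring
  simp_rw [h1]
  rw [intervalIntegral.integral_const_mul, integral_exp_mul_complex hc]
  have : exp (-(2 * Real.pi * I * n) * (1 : ℝ)) = 1 :=
    exp_eq_one_iff.2 ⟨-n, by push_cast; ring⟩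
  rw [this]; simp

end WGZ

end

noncomputable section

namespace WGZ

open Filter MeasureTheory Set

/-! ### Cauchy's formula on half-strips with an ib-periodic kernel -/

variable {b : ℂ}

/-- The half-strip swept by the parallelograms with sides `ib` and the line `Im z = τ`. -/
def halfStrip (b : ℂ) (a τ : ℝ) : Set ℂ := {w | w.re ≤ a + |b.im| ∧ |w.im - τ| ≤ b.re}

/-- The lower left corner `iτ - ib/2` of the parallelograms. -/
def corner (b : ℂ) (τ : ℝ) : ℂ := I * τ - I * b / 2

lemma corner_add_mem (hb : 0 < b.re) {a τ t s : ℝ} (ht : t ≤ a) (hs : s ∈ Icc (0 : ℝ) 1) :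
    corner b τ + t + s * (I * b) ∈ halfStrip b a τ := by
  have e1 : (corner b τ + t + s * (I * b)).re = t + (1 / 2 - s) * b.im := by
    simp [corner]; ring
  have e2 : (corner b τ + t + s * (I * b)).im - τ = (s - 1 / 2) * b.re := by
    simp [corner]; ring
  have h3 : |1 / 2 - s| ≤ 1 := abs_le.2 ⟨by linarith [hs.2], by linarith [hs.1]⟩
  refine ⟨?_, ?_⟩
  · rw [e1]
    have h1 : (1 / 2 - s) * b.im ≤ |b.im| := by
      refine (le_abs_self _).trans ?_
      rw [abs_mul]
      exact mul_le_of_le_one_left (abs_nonneg _) h3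
    linarith
  · rw [e2, abs_mul, abs_sub_comm, abs_of_pos hb]
    exact mul_le_of_le_one_left hb.le h3

lemma corner_add_mem₀ (hb : 0 < b.re) {a τ t : ℝ} (ht : t ≤ a) :
    corner b τ + t ∈ halfStrip b a τ := by
  simpa using corner_add_mem hb (τ := τ) ht ⟨le_rfl, zero_le_one⟩

lemma corner_add_mem₁ (hb : 0 < b.re) {a τ t : ℝ} (ht : t ≤ a) :
    corner b τ + t + I * b ∈ halfStrip b a τ := by
  simpa using corner_add_mem hb (τ := τ) ht ⟨zero_le_one, le_rfl⟩

lemma mem_halfStrip (hb : 0 < b.re) {a : ℝ} {z : ℂ} (hz : z.re ≤ a) : z ∈ halfStrip b a z.im :=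
  ⟨hz.trans (le_add_of_nonneg_right (abs_nonneg _)), by simpa using hb.le⟩

lemma corner_add_sub (b z : ℂ) (t s : ℝ) : corner b z.im + t + s * (I * b) - z =
    ((t - z.re : ℝ) : ℂ) + ((s - 1 / 2 : ℝ) : ℂ) * (I * b) := by
  conv_lhs => rw [← re_add_im z]
  simp only [corner, add_im, ofReal_im, mul_im, ofReal_re, I_re, I_im]
  push_cast
  ring_nf

lemma norm_kerExp_corner (hb : 0 < b.re) (z : ℂ) (t s : ℝ) :
    ‖kerExp b (corner b z.im + t + s * (I * b) - z)‖ =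
      Real.exp (-(2 * Real.pi * (b⁻¹).re * (t - z.re))) := by
  rw [corner_add_sub, norm_kerExp_add (ne_zero_of_re_pos hb)]

lemma kerExp_corner (hb : 0 < b.re) (z : ℂ) (t : ℝ) :
    kerExp b (corner b z.im + t - z) = -kerExp b ((t - z.re : ℝ) : ℂ) := by
  have h := corner_add_sub b z t 0
  rw [ofReal_zero, zero_mul, add_zero] at h
  rw [h, kerExp_add_mul (ne_zero_of_re_pos hb)]
  have : exp (-(2 * Real.pi * I * ((0 - 1 / 2 : ℝ) : ℂ))) = -1 := by
    rw [← exp_pi_mul_I]; congr 1; push_cast; ring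
  rw [this]; ring

lemma kerExp_corner_add (hb : 0 < b.re) (z : ℂ) (t : ℝ) :
    kerExp b (corner b z.im + t + I * b - z) = kerExp b (corner b z.im + t - z) := by
  rw [show corner b z.im + t + I * b - z = corner b z.im + t - z + 1 * (I * b) by ring,
    kerExp_add_mul (ne_zero_of_re_pos hb), mul_one, exp_eq_one_iff.2 ⟨-1, by push_cast; ring⟩,
    mul_one]

lemma kerExp_sub (b w z : ℂ) : kerExp b (w - z) = exp (2 * Real.pi * b⁻¹ * z) * kerExp b w := by
  rw [kerExp, kerExp, ← exp_add]; congr 1; ring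

/-- A continuous function on `(-∞, a]` bounded by `C e^{kt}`, `k > 0`, is integrable. -/
lemma integrableOn_Iic_of_norm_le {g : ℝ → ℂ} {a k C : ℝ} (hk : 0 < k)
    (hg : ContinuousOn g (Iic a)) (h : ∀ t ≤ a, ‖g t‖ ≤ C * Real.exp (k * t)) :
    IntegrableOn g (Iic a) :=
  Integrable.mono' ((integrableOn_exp_mul_Iic hk a).const_mul C)
    (hg.aestronglyMeasurable measurableSet_Iic)
    ((ae_restrict_iff' measurableSet_Iic).2 (.of_forall h))

section
variable {F : ℂ → ℂ} {a τ σ C₀ C₁ : ℝ}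

lemma continuousOn_corner_add (hb : 0 < b.re) (hF : ∀ w ∈ halfStrip b a τ, AnalyticAt ℂ F w) :
    ContinuousOn (fun t : ℝ => F (corner b τ + t + I * b) - F (corner b τ + t)) (Iic a) := by
  intro t ht
  refine ContinuousAt.continuousWithinAt (ContinuousAt.sub ?_ ?_)
  · exact ContinuousAt.comp (f := fun t : ℝ => corner b τ + t + I * b) (x := t) (g := F)
      (hF _ (corner_add_mem₁ hb ht)).continuousAt (by fun_prop)
  · exact ContinuousAt.comp (f := fun t : ℝ => corner b τ + t) (x := t) (g := F)
      (hF _ (corner_add_mem₀ hb ht)).continuousAt (by fun_prop)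

lemma norm_corner_diff_le
    (hC₁ : ∀ t : ℝ, t ≤ a → ‖F (corner b τ + t + I * b) - F (corner b τ + t)‖ ≤
      C₁ * Real.exp (2 * Real.pi * σ * t)) {t : ℝ} (ht : t ≤ a) (n : ℕ) :
    ‖(F (corner b τ + t + I * b) - F (corner b τ + t)) * kerExp b (corner b τ + t) ^ n‖ ≤
      C₁ * ‖kerExp b (corner b τ)‖ ^ n *
        Real.exp (2 * Real.pi * (σ - n * (b⁻¹).re) * t) := by
  have e : kerExp b (corner b τ + t) = kerExp b (corner b τ) * kerExp b t := by
    rw [kerExp, kerExp, kerExp, ← exp_add]; congr 1; ring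
  rw [norm_mul, e, mul_pow, norm_mul, norm_pow, norm_pow, norm_kerExp_real, ← Real.exp_nat_mul]
  calc _ ≤ (C₁ * Real.exp (2 * Real.pi * σ * t)) * (‖kerExp b (corner b τ)‖ ^ n *
        Real.exp (n * -(2 * Real.pi * (b⁻¹).re * t))) := by
        gcongr; exact hC₁ t ht
    _ = C₁ * ‖kerExp b (corner b τ)‖ ^ n * (Real.exp (2 * Real.pi * σ * t) *
        Real.exp (n * -(2 * Real.pi * (b⁻¹).re * t))) := by ring
    _ = _ := by rw [← Real.exp_add]; congr 2; ring

/-- The Cauchy formula with an `ib`-periodic kernel. -/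
lemma integral_slant_eq (hb : 0 < b.re) {z : ℂ} (hz : z.re ≤ a - 1) (hσ : 0 < σ)
    (hF : ∀ w ∈ halfStrip b a z.im, AnalyticAt ℂ F w)
    (hC₀ : ∀ w ∈ halfStrip b a z.im, ‖F w‖ ≤ C₀)
    (hC₁ : ∀ t : ℝ, t ≤ a → ‖F (corner b z.im + t + I * b) - F (corner b z.im + t)‖ ≤
      C₁ * Real.exp (2 * Real.pi * σ * t)) :
    ∫ s in (0 : ℝ)..1, I * b * ((F (corner b z.im + a + s * (I * b)) - F z) /
        (1 - kerExp b (corner b z.im + a + s * (I * b) - z))) =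
      ∫ t in Iic a, (F (corner b z.im + t + I * b) - F (corner b z.im + t)) /
        (1 - kerExp b (corner b z.im + t - z)) := by
  have hρ := inv_re_pos hb
  have hπ := Real.pi_pos
  -- The point z lies on the middle line s = 1/2 of the parallelograms. Subtracting F z removes the
  -- only pole of the kernel in them, so Cauchy's theorem applies without a residue.
  set φ : ℂ → ℂ := fun w => dslope F z w / dslope (fun u => 1 - kerExp b u) 0 (w - z) with hφ
  have hzm : z ∈ halfStrip b a z.im := mem_halfStrip hb (by linarith)
  have him (t s : ℝ) : (corner b z.im + t + s * (I * b) - z).im = (s - 1 / 2) * b.re := by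
    rw [corner_add_sub]; simp
  have han (t : ℝ) (ht : t ≤ a) (s : ℝ) (hs : s ∈ Icc (0 : ℝ) 1) :
      AnalyticAt ℂ φ (corner b z.im + t + s * (I * b)) := by
    refine analyticAt_dslope_div hb (hF z hzm) (hF _ (corner_add_mem hb ht hs)) ?_
    rw [him, abs_mul, abs_of_pos hb]
    have : |s - 1 / 2| < 1 := abs_lt.2 ⟨by linarith [hs.1], by linarith [hs.2]⟩
    nlinarith
  -- off the line `Im w = τ` the removable quotient is the quotient
  have hne_h (t s : ℝ) (hs : s ≠ 1 / 2) : corner b z.im + t + s * (I * b) ≠ z := by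
    intro h
    have := him t s
    rw [h, sub_self, zero_im] at this
    exact hb.ne' ((mul_eq_zero.1 this.symm).resolve_left (sub_ne_zero.2 hs))
  have hne_a (t s : ℝ) (ht : t ≠ z.re) : corner b z.im + t + s * (I * b) ≠ z := by
    intro h
    have h1 := norm_kerExp_corner hb z t s
    rw [h, sub_self] at h1
    have h2 : kerExp b 0 = 1 := by simp [kerExp]
    rw [h2, norm_one, eq_comm, Real.exp_eq_one_iff, neg_eq_zero, mul_eq_zero] at h1
    exact ht (sub_eq_zero.1 (h1.resolve_left (by positivity)))
  set r : ℝ → ℂ := fun t => (F (corner b z.im + t + I * b) - F (corner b z.im + t)) /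
        (1 - kerExp b (corner b z.im + t - z)) with hr
  -- The kernel takes equal values on the two horizontal sides, so F z drops out and only the
  -- ib-difference of F remains.
  have hline (t : ℝ) : φ (corner b z.im + t + I * b) - φ (corner b z.im + t) = r t := by
    have h0 := hne_h t 0 (by norm_num)
    have h1 := hne_h t 1 (by norm_num)
    simp only [ofReal_zero, zero_mul, add_zero, ofReal_one, one_mul] at h0 h1
    simp only [hφ, hr]
    rw [dslope_div_dslope b F h0, dslope_div_dslope b F h1, kerExp_corner_add hb, ← sub_div]
    congr 1; ring
  -- integrability of the right-hand side
  obtain ⟨δ, hδ, hδk⟩ := exists_le_norm_one_add_kerExp hb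
  have hden (t : ℝ) : δ ≤ ‖1 - kerExp b (corner b z.im + t - z)‖ := by
    rw [kerExp_corner hb, sub_neg_eq_add]
    refine le_trans ?_ (hδk _)
    exact le_mul_of_one_le_right hδ.le (by linarith [Real.exp_pos (-(2 * Real.pi * (b⁻¹).re * (t - z.re)))])
  have hrint : IntegrableOn r (Iic a) := by
    refine integrableOn_Iic_of_norm_le (k := 2 * Real.pi * σ) (C := C₁ / δ) (by positivity) ?_ ?_
    · refine (continuousOn_corner_add hb hF).div ?_ fun t _ => norm_pos_iff.1 (hδ.trans_le (hden t))
      have := (differentiable_kerExp b).continuous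
      fun_prop
    · intro t ht
      rw [norm_div]
      calc _ ≤ (C₁ * Real.exp (2 * Real.pi * σ * t)) / δ :=
            div_le_div₀ ((norm_nonneg _).trans (hC₁ t ht)) (hC₁ t ht) hδ (hden t)
        _ = _ := by ring
  have hlim := intervalIntegral_tendsto_integral_Iic a hrint tendsto_id
  -- the slanted side at `t` tends to zero
  have hslant : Tendsto (fun t : ℝ => ∫ s in (0 : ℝ)..1, (I * b) * φ (corner b z.im + t + s * (I * b)))
      atBot (𝓝 0) := by
    -- F is bounded, and the exponential in the denominator has modulus e^{-2π Re b⁻¹ (t - Re z)},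
    -- which tends to ∞ as t → -∞.
    have hE : Tendsto (fun t : ℝ => ‖b‖ * (2 * C₀ /
        (Real.exp (-(2 * Real.pi * (b⁻¹).re * (t - z.re))) - 1))) atBot (𝓝 0) := by
      rw [← mul_zero ‖b‖]
      refine Tendsto.const_mul _ (Tendsto.const_div_atTop ?_ _)
      refine tendsto_atTop_add_const_right _ _ (Real.tendsto_exp_atTop.comp ?_)
      refine tendsto_neg_atBot_atTop.comp (Tendsto.const_mul_atBot (by positivity) ?_)
      exact tendsto_atBot_add_const_right _ _ tendsto_id
    refine squeeze_zero_norm' ?_ hE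
    filter_upwards [eventually_le_atBot a, eventually_lt_atBot z.re] with t hta htz
    have hexp : 1 < Real.exp (-(2 * Real.pi * (b⁻¹).re * (t - z.re))) := by
      rw [Real.one_lt_exp_iff, neg_pos]
      exact mul_neg_of_pos_of_neg (by positivity) (by linarith)
    have := intervalIntegral.norm_integral_le_of_norm_le_const (a := 0) (b := 1)
      (f := fun s : ℝ => (I * b) * φ (corner b z.im + t + s * (I * b)))
      (C := ‖b‖ * (2 * C₀ / (Real.exp (-(2 * Real.pi * (b⁻¹).re * (t - z.re))) - 1))) (by
        intro s hs
        rw [uIoc_of_le zero_le_one] at hs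
        simp only [hφ]
        rw [dslope_div_dslope b F (hne_a t s htz.ne), norm_mul, norm_mul, norm_I, one_mul, norm_div]
        refine mul_le_mul_of_nonneg_left (div_le_div₀ ?_ ?_ (by linarith) ?_) (norm_nonneg _)
        · linarith [(norm_nonneg _).trans (hC₀ z hzm)]
        · refine (norm_sub_le _ _).trans ?_
          linarith [hC₀ z hzm, hC₀ _ (corner_add_mem hb (τ := z.im) hta ⟨hs.1.le, hs.2⟩)]
        · have := norm_sub_norm_le (kerExp b (corner b z.im + t + s * (I * b) - z)) 1
          rwa [norm_one, norm_kerExp_corner hb, norm_sub_rev] at this)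
    simpa using this
  have hid : ∀ᶠ t : ℝ in atBot, (∫ s in (0 : ℝ)..1, (I * b) * φ (corner b z.im + a + s * (I * b))) -
      (∫ s in (0 : ℝ)..1, (I * b) * φ (corner b z.im + t + s * (I * b))) = ∫ t in t..a, r t := by
    filter_upwards [eventually_le_atBot a] with t hta
    rw [integral_boundary_parallelogram hta fun t' ht' s hs => han t' ht'.2 s hs,
      ← intervalIntegral.integral_sub]
    · simp_rw [hline]
    · refine ContinuousOn.intervalIntegrable fun t' ht' => ContinuousAt.continuousWithinAt ?_
      rw [uIcc_of_le hta] at ht'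
      have := (han t' ht'.2 1 ⟨zero_le_one, le_rfl⟩).continuousAt
      rw [ofReal_one, one_mul] at this
      exact ContinuousAt.comp (f := fun t : ℝ => corner b z.im + t + I * b) (x := t') (g := φ)
        this (by fun_prop)
    · refine ContinuousOn.intervalIntegrable fun t' ht' => ContinuousAt.continuousWithinAt ?_
      rw [uIcc_of_le hta] at ht'
      have := (han t' ht'.2 0 ⟨le_rfl, zero_le_one⟩).continuousAt
      rw [ofReal_zero, zero_mul, add_zero] at this
      exact ContinuousAt.comp (f := fun t : ℝ => corner b z.im + t) (x := t') (g := φ)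
        this (by fun_prop)
  have h1 := ((hslant.const_sub (∫ s in (0 : ℝ)..1, (I * b) *
    φ (corner b z.im + a + s * (I * b)))).congr' hid)
  rw [sub_zero] at h1
  rw [← tendsto_nhds_unique h1 hlim]
  refine intervalIntegral.integral_congr fun s _ => ?_
  simp only [hφ]
  rw [dslope_div_dslope b F (hne_a a s (by linarith))]

end

end WGZ

end

noncomputable section

namespace WGZ

open Filter MeasureTheory Set

/-! ### Expansion in exponentials on horizontal lines -/

variable {b : ℂ}

lemma integral_exp_abs_sub {k : ℝ} (x : ℝ) :
    ∫ t : ℝ, Real.exp (-k * |t - x|) = ∫ t : ℝ, Real.exp (-k * |t|) :=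
  integral_sub_right_eq_self (fun t => Real.exp (-k * |t|)) x

/-- The bound for the remainder of the geometric expansion along the horizontal line. -/
lemma exp_mul_exp_div_le (ρ σ : ℝ) (N : ℕ) (x t : ℝ) :
    Real.exp (2 * Real.pi * σ * t) * (Real.exp (-(2 * Real.pi * ρ * (t - x))) ^ N /
        (1 + Real.exp (-(2 * Real.pi * ρ * (t - x))))) ≤
      Real.exp (2 * Real.pi * σ * x) *
        Real.exp (-(2 * Real.pi * min (N * ρ - σ) (σ - (N - 1) * ρ)) * |t - x|) := by
  have hπ := Real.pi_pos
  have hE := Real.exp_pos (-(2 * Real.pi * ρ * (t - x)))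
  set E := Real.exp (-(2 * Real.pi * ρ * (t - x))) with hE'
  rcases le_total x t with h | h
  · have : E ^ N / (1 + E) ≤ E ^ N := div_le_self (by positivity) (by linarith)
    refine (mul_le_mul_of_nonneg_left this (Real.exp_pos _).le).trans ?_
    rw [hE', ← Real.exp_nat_mul, ← Real.exp_add, ← Real.exp_add, Real.exp_le_exp,
      abs_of_nonneg (sub_nonneg.2 h)]
    have := mul_le_mul_of_nonneg_right (min_le_left (N * ρ - σ) (σ - (N - 1) * ρ))
      (sub_nonneg.2 h)
    nlinarith
  · have : E ^ N / (1 + E) ≤ E ^ N / E :=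
      div_le_div_of_nonneg_left (by positivity) hE (by linarith)
    refine (mul_le_mul_of_nonneg_left this (Real.exp_pos _).le).trans ?_
    rw [hE', ← Real.exp_nat_mul, ← Real.exp_sub, ← Real.exp_add, ← Real.exp_add, Real.exp_le_exp,
      abs_of_nonpos (sub_nonpos.2 h)]
    have := mul_le_mul_of_nonneg_right (min_le_right (N * ρ - σ) (σ - (N - 1) * ρ))
      (sub_nonneg.2 h)
    nlinarith

section
variable {F : ℂ → ℂ} {a σ C₀ C₁ : ℝ} {N : ℕ} {z : ℂ}

/-- The kernel is expanded geometrically in E = e^{-2π(w - z)/b}, which has modulus at most e^{-2π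
Re b⁻¹} because Re z ≤ a - 1. The side covers a full period of E, so ∫ Eⁿ vanishes for n > 0 and F z
survives only in the term n = 0. The remainder carries E^N, which is O(e^{2πσ Re z}) as σ < N Re
b⁻¹. -/
lemma slant_expansion (hb : 0 < b.re) (hN : 0 < N) (hσ : σ < N * (b⁻¹).re) (hz : z.re ≤ a - 1)
    (hF : ∀ w ∈ halfStrip b a z.im, AnalyticAt ℂ F w)
    (hC₀ : ∀ w ∈ halfStrip b a z.im, ‖F w‖ ≤ C₀) :
    ‖(∫ s in (0 : ℝ)..1, I * b * ((F (corner b z.im + a + s * (I * b)) - F z) /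
        (1 - kerExp b (corner b z.im + a + s * (I * b) - z)))) - I * b * (∑ n ∈ Finset.range N,
      exp (2 * Real.pi * b⁻¹ * z) ^ n * (∫ s in (0 : ℝ)..1, F (corner b z.im + a + s * (I * b)) *
        kerExp b (corner b z.im + a + s * (I * b)) ^ n) - F z)‖ ≤
      ‖b‖ * (2 * C₀ * Real.exp (-(2 * Real.pi * σ * a)) / (1 - Real.exp (-(2 * Real.pi * (b⁻¹).re)))) *
        Real.exp (2 * Real.pi * σ * z.re) := by
  have hρ := inv_re_pos hb
  have hπ := Real.pi_pos
  have hzm : z ∈ halfStrip b a z.im := mem_halfStrip hb (by linarith)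
  set w : ℝ → ℂ := fun s => corner b z.im + a + s * (I * b) with hw
  set P := exp (2 * Real.pi * b⁻¹ * z) with hP
  set E : ℝ → ℂ := fun s => kerExp b (w s - z) with hE
  have hwc : Continuous w := by fun_prop
  have hkc := (differentiable_kerExp b).continuous
  have hEc : Continuous E := hkc.comp (hwc.sub continuous_const)
  have hEn (s : ℝ) : ‖E s‖ = Real.exp (-(2 * Real.pi * (b⁻¹).re * (a - z.re))) :=
    norm_kerExp_corner hb z a s
  have hEl (s : ℝ) : ‖E s‖ ≤ Real.exp (-(2 * Real.pi * (b⁻¹).re)) := by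
    rw [hEn, Real.exp_le_exp, neg_le_neg_iff]
    exact le_mul_of_one_le_right (by positivity) (by linarith)
  have hlt : Real.exp (-(2 * Real.pi * (b⁻¹).re)) < 1 := by
    rw [Real.exp_lt_one_iff, neg_lt_zero]; positivity
  have hE1 (s : ℝ) : E s ≠ 1 := by
    intro h
    have := hEl s
    rw [h, norm_one] at this; linarith
  have hFc : ContinuousOn (fun s => F (w s)) (uIcc 0 1) := by
    rw [uIcc_of_le zero_le_one]
    exact fun s hs => (ContinuousAt.comp (f := w) (x := s) (g := F)
      (hF _ (corner_add_mem hb le_rfl hs)).continuousAt hwc.continuousAt).continuousWithinAt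
  have hEint (n : ℕ) : ∫ s in (0 : ℝ)..1, E s ^ n = if n = 0 then 1 else 0 := by
    have h1 (s : ℝ) : E s ^ n = kerExp b ((a - z.re : ℝ) : ℂ) ^ n *
        exp (-(2 * Real.pi * I * ((s - 1 / 2 : ℝ) : ℂ))) ^ n := by
      simp only [hE, hw]
      rw [corner_add_sub, kerExp_add_mul (ne_zero_of_re_pos hb), mul_pow]
    simp_rw [h1]
    rw [intervalIntegral.integral_const_mul, integral_exp_two_pi_I]
    split_ifs with hn <;> simp [hn]
  have hterm (n : ℕ) : ∫ s in (0 : ℝ)..1, I * b * ((F (w s) - F z) * E s ^ n) =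
      I * b * (P ^ n * (∫ s in (0 : ℝ)..1, F (w s) * kerExp b (w s) ^ n) -
        if n = 0 then F z else 0) := by
    rw [intervalIntegral.integral_const_mul]
    congr 1
    have h1 (s : ℝ) : (F (w s) - F z) * E s ^ n =
        P ^ n * (F (w s) * kerExp b (w s) ^ n) - F z * E s ^ n := by
      have : E s = P * kerExp b (w s) := kerExp_sub b (w s) z
      rw [sub_mul, this, mul_pow]; ring
    simp_rw [h1]
    rw [intervalIntegral.integral_sub, intervalIntegral.integral_const_mul,
      intervalIntegral.integral_const_mul, hEint]
    · split_ifs <;> simp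
    · exact (ContinuousOn.const_mul (hFc.mul (by fun_prop)) _).intervalIntegrable
    · exact (Continuous.intervalIntegrable (by fun_prop) _ _)
  have hsplit : (∫ s in (0 : ℝ)..1, I * b * ((F (w s) - F z) / (1 - E s))) -
      I * b * (∑ n ∈ Finset.range N, P ^ n * (∫ s in (0 : ℝ)..1, F (w s) * kerExp b (w s) ^ n)
        - F z) = ∫ s in (0 : ℝ)..1, I * b * ((F (w s) - F z) * E s ^ N / (1 - E s)) := by
    have h1 (s : ℝ) : I * b * ((F (w s) - F z) / (1 - E s)) =
        ∑ n ∈ Finset.range N, I * b * ((F (w s) - F z) * E s ^ n) +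
          I * b * ((F (w s) - F z) * E s ^ N / (1 - E s)) := by
      rw [inv_one_sub_eq_geom (hE1 s) N, mul_add, Finset.mul_sum]
    have hi (n : ℕ) : IntervalIntegrable (fun s => I * b * ((F (w s) - F z) * E s ^ n)) volume 0 1 :=
      (ContinuousOn.const_mul ((hFc.sub continuousOn_const).mul (by fun_prop)) _).intervalIntegrable
    simp_rw [h1]
    rw [intervalIntegral.integral_add, intervalIntegral.integral_finsetSum (fun n _ => hi n)]
    · simp_rw [hterm]
      rw [← Finset.mul_sum, Finset.sum_sub_distrib, Finset.sum_ite_eq' (Finset.range N) 0,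
        if_pos (Finset.mem_range.2 hN)]
      ring
    · exact (continuousOn_finsetSum _ fun n _ => ContinuousOn.const_mul
        ((hFc.sub continuousOn_const).mul (by fun_prop)) _).intervalIntegrable
    · exact (ContinuousOn.const_mul (((hFc.sub continuousOn_const).mul (by fun_prop)).div
        (by fun_prop) fun s _ => sub_ne_zero.2 (hE1 s).symm) _).intervalIntegrable
  rw [hsplit]
  refine (intervalIntegral.norm_integral_le_of_norm_le_const
    (C := ‖b‖ * (2 * C₀ * Real.exp (-(2 * Real.pi * σ * a)) /
      (1 - Real.exp (-(2 * Real.pi * (b⁻¹).re)))) * Real.exp (2 * Real.pi * σ * z.re)) ?_).trans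
    (by simp)
  intro s hs
  rw [uIoc_of_le zero_le_one] at hs
  have hC₀' : 0 ≤ C₀ := (norm_nonneg _).trans (hC₀ z hzm)
  have h1 : ‖F (w s) - F z‖ ≤ 2 * C₀ := by
    refine (norm_sub_le _ _).trans ?_
    linarith [hC₀ z hzm, hC₀ _ (corner_add_mem hb (τ := z.im) le_rfl ⟨hs.1.le, hs.2⟩)]
  have h2 : ‖E s‖ ^ N ≤ Real.exp (-(2 * Real.pi * σ * a)) * Real.exp (2 * Real.pi * σ * z.re) := by
    rw [hEn, ← Real.exp_nat_mul, ← Real.exp_add, Real.exp_le_exp]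
    have : σ * (a - z.re) ≤ N * (b⁻¹).re * (a - z.re) :=
      mul_le_mul_of_nonneg_right hσ.le (by linarith)
    nlinarith
  have h3 : 1 - Real.exp (-(2 * Real.pi * (b⁻¹).re)) ≤ ‖1 - E s‖ := by
    have := norm_sub_norm_le (1 : ℂ) (E s)
    rw [norm_one] at this
    linarith [hEl s]
  rw [norm_mul, norm_mul, norm_I, one_mul, norm_div, norm_mul, norm_pow, mul_assoc]
  refine mul_le_mul_of_nonneg_left ?_ (norm_nonneg _)
  calc _ ≤ 2 * C₀ * (Real.exp (-(2 * Real.pi * σ * a)) * Real.exp (2 * Real.pi * σ * z.re)) /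
        (1 - Real.exp (-(2 * Real.pi * (b⁻¹).re))) :=
        div_le_div₀ (by positivity) (mul_le_mul h1 h2 (by positivity) (by positivity))
          (by linarith) h3
    _ = _ := by ring

/-- The same geometric expansion on an infinite side. The coefficients with n < N converge because σ
> (N - 1) Re b⁻¹. The remainder decays on both sides of Re z by `exp_mul_exp_div_le`, and this needs
σ strictly between (N - 1) Re b⁻¹ and N Re b⁻¹. -/
lemma line_expansion (hb : 0 < b.re) (hσ₁ : (N - 1) * (b⁻¹).re < σ) (hσ₂ : σ < N * (b⁻¹).re)
    {δ : ℝ} (hδ : 0 < δ)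
    (hδk : ∀ y : ℝ, δ * (1 + Real.exp (-(2 * Real.pi * (b⁻¹).re * y))) ≤ ‖1 + kerExp b y‖)
    (hF : ∀ w ∈ halfStrip b a z.im, AnalyticAt ℂ F w)
    (hC₁ : ∀ t : ℝ, t ≤ a → ‖F (corner b z.im + t + I * b) - F (corner b z.im + t)‖ ≤
      C₁ * Real.exp (2 * Real.pi * σ * t)) :
    ‖(∫ t in Iic a, (F (corner b z.im + t + I * b) - F (corner b z.im + t)) /
        (1 - kerExp b (corner b z.im + t - z))) - ∑ n ∈ Finset.range N,
      exp (2 * Real.pi * b⁻¹ * z) ^ n * (∫ t in Iic a,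
        (F (corner b z.im + t + I * b) - F (corner b z.im + t)) *
          kerExp b (corner b z.im + t) ^ n)‖ ≤
      C₁ / δ * (∫ t : ℝ, Real.exp (-(2 * Real.pi *
        min (N * (b⁻¹).re - σ) (σ - (N - 1) * (b⁻¹).re)) * |t|)) *
        Real.exp (2 * Real.pi * σ * z.re) := by
  have hρ := inv_re_pos hb
  have hπ := Real.pi_pos
  set r : ℝ → ℂ := fun t => F (corner b z.im + t + I * b) - F (corner b z.im + t) with hr
  set P := exp (2 * Real.pi * b⁻¹ * z) with hP
  set E : ℝ → ℂ := fun t => kerExp b (corner b z.im + t - z) with hE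
  set k := 2 * Real.pi * min (N * (b⁻¹).re - σ) (σ - (N - 1) * (b⁻¹).re) with hk
  have hk0 : 0 < k := mul_pos (by positivity) (lt_min (by linarith) (by linarith))
  have hrc : ContinuousOn r (Iic a) := continuousOn_corner_add hb hF
  have hkc := (differentiable_kerExp b).continuous
  have hEc : Continuous E := by fun_prop
  have hEn (t : ℝ) : ‖E t‖ = Real.exp (-(2 * Real.pi * (b⁻¹).re * (t - z.re))) := by
    simpa using norm_kerExp_corner hb z t 0
  have hden (t : ℝ) : δ * (1 + ‖E t‖) ≤ ‖1 - E t‖ := by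
    rw [hEn]; simp only [hE]
    rw [kerExp_corner hb, sub_neg_eq_add]
    exact hδk _
  have hE1 (t : ℝ) : E t ≠ 1 := by
    intro h
    have := hden t
    rw [h, sub_self, norm_one, norm_zero] at this; linarith
  have hi (n : ℕ) (hn : n < N) : IntegrableOn (fun t => r t * kerExp b (corner b z.im + t) ^ n)
      (Iic a) := by
    refine integrableOn_Iic_of_norm_le (k := 2 * Real.pi * (σ - n * (b⁻¹).re)) ?_
      (hrc.mul (by fun_prop)) fun t ht => norm_corner_diff_le hC₁ ht n
    have : (n : ℝ) ≤ N - 1 := by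
      have : (n : ℝ) + 1 ≤ N := by exact_mod_cast hn
      linarith
    have := mul_le_mul_of_nonneg_right this hρ.le
    exact mul_pos (by positivity) (by linarith)
  have hbound (t : ℝ) (ht : t ≤ a) : ‖r t * E t ^ N / (1 - E t)‖ ≤
      C₁ / δ * Real.exp (2 * Real.pi * σ * z.re) * Real.exp (-k * |t - z.re|) := by
    have hC : 0 ≤ C₁ := by
      have := (norm_nonneg _).trans (hC₁ t ht)
      exact nonneg_of_mul_nonneg_left this (Real.exp_pos _)
    rw [norm_div, norm_mul, norm_pow]
    have h0 : 0 < 1 + ‖E t‖ := by positivity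
    calc _ ≤ C₁ * Real.exp (2 * Real.pi * σ * t) * ‖E t‖ ^ N / (δ * (1 + ‖E t‖)) :=
          div_le_div₀ (by positivity) (mul_le_mul_of_nonneg_right (hC₁ t ht) (by positivity))
            (by positivity) (hden t)
      _ = C₁ / δ * (Real.exp (2 * Real.pi * σ * t) * (‖E t‖ ^ N / (1 + ‖E t‖))) := by
          field_simp
      _ ≤ C₁ / δ * (Real.exp (2 * Real.pi * σ * z.re) * Real.exp (-k * |t - z.re|)) := by
          refine mul_le_mul_of_nonneg_left ?_ (by positivity)
          rw [hEn]
          exact exp_mul_exp_div_le _ σ N z.re t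
      _ = _ := by ring
  have hmaj : Integrable fun t : ℝ => C₁ / δ * Real.exp (2 * Real.pi * σ * z.re) *
      Real.exp (-k * |t - z.re|) :=
    ((integrable_exp_neg_mul_abs hk0).comp_sub_right z.re).const_mul _
  have hrem : IntegrableOn (fun t => r t * E t ^ N / (1 - E t)) (Iic a) := by
    refine Integrable.mono' hmaj.integrableOn ?_
      ((ae_restrict_iff' measurableSet_Iic).2 (.of_forall hbound))
    exact ((hrc.mul (by fun_prop)).div (by fun_prop)
      fun t _ => sub_ne_zero.2 (hE1 t).symm).aestronglyMeasurable measurableSet_Iic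
  have hsplit : (∫ t in Iic a, r t / (1 - E t)) - ∑ n ∈ Finset.range N,
      P ^ n * (∫ t in Iic a, r t * kerExp b (corner b z.im + t) ^ n) =
      ∫ t in Iic a, r t * E t ^ N / (1 - E t) := by
    have h1 (t : ℝ) : r t / (1 - E t) = ∑ n ∈ Finset.range N,
        P ^ n * (r t * kerExp b (corner b z.im + t) ^ n) + r t * E t ^ N / (1 - E t) := by
      rw [inv_one_sub_eq_geom (hE1 t) N]
      congr 1
      refine Finset.sum_congr rfl fun n _ => ?_
      have : E t = P * kerExp b (corner b z.im + t) := kerExp_sub b _ z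
      rw [this, mul_pow]; ring
    simp_rw [h1]
    rw [integral_add (integrable_finsetSum _ fun n hn =>
      (hi n (Finset.mem_range.1 hn)).const_mul _) hrem,
      integral_finsetSum _ fun n hn => (hi n (Finset.mem_range.1 hn)).const_mul _]
    simp_rw [integral_const_mul]
    ring
  rw [hsplit]
  refine (norm_integral_le_of_norm_le hmaj.integrableOn
    ((ae_restrict_iff' measurableSet_Iic).2 (.of_forall hbound))).trans ?_
  by_cases hC : 0 ≤ C₁
  · refine (setIntegral_le_integral hmaj (.of_forall fun t => by positivity)).trans (le_of_eq ?_)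
    rw [integral_const_mul, integral_exp_abs_sub]; ring
  · exact absurd (nonneg_of_mul_nonneg_left ((norm_nonneg _).trans (hC₁ a le_rfl))
      (Real.exp_pos _)) hC

end

/-- A bounded analytic function on a half-strip whose `ib`-difference decays like `e^{2πσ Re z}`
is, up to an error of this order, a combination of exponentials `e^{2πnz/b}` on each line. -/
lemma exists_expansion (hb : 0 < b.re) {σ a C₀ C₁ : ℝ} {N : ℕ} (hN : 0 < N) (hσ : 0 < σ)
    (hσ₁ : (N - 1) * (b⁻¹).re < σ) (hσ₂ : σ < N * (b⁻¹).re) : ∃ K : ℝ, ∀ (F : ℂ → ℂ) (τ : ℝ),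
      (∀ w ∈ halfStrip b a τ, AnalyticAt ℂ F w) → (∀ w ∈ halfStrip b a τ, ‖F w‖ ≤ C₀) →
      (∀ t : ℝ, t ≤ a → ‖F (corner b τ + t + I * b) - F (corner b τ + t)‖ ≤
        C₁ * Real.exp (2 * Real.pi * σ * t)) →
      ∃ c : ℕ → ℂ, ∀ z : ℂ, z.im = τ → z.re ≤ a - 1 →
        ‖F z - ∑ n ∈ Finset.range N, c n * exp (2 * Real.pi * b⁻¹ * z) ^ n‖ ≤
          K * Real.exp (2 * Real.pi * σ * z.re) := by
  have hb0 := ne_zero_of_re_pos hb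
  obtain ⟨δ, hδ, hδk⟩ := exists_le_norm_one_add_kerExp hb
  -- The sum of the two remainder bounds, divided by the modulus of the factor ib in front of F z.
  -- It depends neither on F nor on the line.
  refine ⟨(‖b‖ * (2 * C₀ * Real.exp (-(2 * Real.pi * σ * a)) /
    (1 - Real.exp (-(2 * Real.pi * (b⁻¹).re)))) + C₁ / δ * (∫ t : ℝ, Real.exp (-(2 * Real.pi *
        min (N * (b⁻¹).re - σ) (σ - (N - 1) * (b⁻¹).re)) * |t|))) / ‖b‖,
    fun F τ hF hC₀ hC₁ => ⟨fun n => (∫ s in (0 : ℝ)..1, F (corner b τ + a + s * (I * b)) *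
        kerExp b (corner b τ + a + s * (I * b)) ^ n) - (∫ t in Iic a,
        (F (corner b τ + t + I * b) - F (corner b τ + t)) *
          kerExp b (corner b τ + t) ^ n) / (I * b), ?_⟩⟩
  rintro z rfl hz
  have h1 := slant_expansion hb hN hσ₂ hz hF hC₀
  rw [integral_slant_eq hb hz hσ hF hC₀ hC₁] at h1
  have h2 := line_expansion hb hσ₁ hσ₂ hδ hδk hF hC₁
  have hn : 0 < ‖b‖ := norm_pos_iff.2 hb0
  rw [div_mul_eq_mul_div, le_div_iff₀ hn, add_mul]
  refine le_trans ?_ (add_le_add h1 h2)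
  rw [← norm_neg (_ - ∑ n ∈ Finset.range N, exp (2 * Real.pi * b⁻¹ * z) ^ n *
    (∫ t in Iic a, _ * _))]
  refine le_trans (le_of_eq ?_) (norm_add_le _ _)
  rw [mul_comm, show ‖b‖ = ‖I * b‖ by simp, ← norm_mul]
  congr 1
  have key (A B : ℕ → ℂ) (P : ℂ) : I * b * ∑ n ∈ Finset.range N, (A n - B n / (I * b)) * P ^ n =
      I * b * (∑ n ∈ Finset.range N, P ^ n * A n) - ∑ n ∈ Finset.range N, P ^ n * B n := by
    rw [Finset.mul_sum, Finset.mul_sum, ← Finset.sum_sub_distrib]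
    refine Finset.sum_congr rfl fun n _ => ?_
    field_simp [I_ne_zero]
  rw [mul_sub, key]
  ring

end WGZ

end

noncomputable section

namespace WGZ

open Filter MeasureTheory Set

/-! ### Decay of the theta functions under the difference operators -/

variable {b : ℂ}

lemma leftO_opr_rowSet_of_diff (hb : 0 < b.re) {F : ℂ → ℂ} {σ : ℝ} {N : ℕ} (hN : 0 < N)
    (hσ : 0 < σ) (hσ₁ : (N - 1) * (b⁻¹).re < σ) (hσ₂ : σ < N * (b⁻¹).re)
    (hF : ∀ H, ∀ᶠ z in leftStrip H, AnalyticAt ℂ F z) (h0 : LeftO 0 F)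
    (hd : LeftO σ fun z => F (z + I * b) - F z) : LeftO σ (opr b (rowSet N) F) := by
  refine leftO_opr_rowSet fun H => ?_
  obtain ⟨R₁, hR₁⟩ := eventually_leftStrip.1 (hF (H + b.re))
  obtain ⟨C₀, R₂, -, hR₂⟩ := h0.bound (H + b.re)
  obtain ⟨C₁, R₃, -, hR₃⟩ := hd.bound (H + b.re)
  -- The half-strips reach |Im b| further to the right than a, and Re b further than the height H.
  set a := min R₁ (min R₂ R₃) - |b.im| with ha
  have hmem {τ : ℝ} (hτ : |τ| ≤ H) {w : ℂ} (hw : w ∈ halfStrip b a τ) :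
      w.re ≤ R₁ ∧ w.re ≤ R₂ ∧ w.re ≤ R₃ ∧ |w.im| ≤ H + b.re := by
    have h1 : w.re ≤ min R₁ (min R₂ R₃) := by have := hw.1; rw [ha] at this; linarith
    refine ⟨h1.trans (min_le_left _ _), h1.trans ((min_le_right _ _).trans (min_le_left _ _)),
      h1.trans ((min_le_right _ _).trans (min_le_right _ _)), ?_⟩
    have := abs_sub_abs_le_abs_sub w.im τ
    linarith [hw.2]
  -- The extra factor e^{πσ Im b} arises because the corner has real part Im b / 2.
  obtain ⟨K, hK⟩ := exists_expansion (a := a) (C₀ := C₀)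
    (C₁ := C₁ * Real.exp (Real.pi * σ * b.im)) hb hN hσ hσ₁ hσ₂
  refine ⟨K, a - 1, fun τ hτ => hK F τ (fun w hw => ?_) (fun w hw => ?_) (fun t ht => ?_)⟩
  · obtain ⟨h1, -, -, h4⟩ := hmem hτ hw
    exact hR₁ w h1 h4
  · obtain ⟨-, h2, -, h4⟩ := hmem hτ hw
    simpa using hR₂ w h2 h4
  · obtain ⟨-, -, h3, h4⟩ := hmem hτ (corner_add_mem₀ hb ht)
    refine (hR₃ _ h3 h4).trans (le_of_eq ?_)
    rw [mul_assoc C₁, ← Real.exp_add]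
    congr 2
    simp [corner]; ring

section
variable {f : ℂ → ℂ} {c d : ℂ}

/-- By `opr_succFst` the translated operator passes through e^{2πbz} and acts on f(z + d) as the
original one. The exponential then adds Re b to the rate. -/
lemma leftO_opr_succFst_diff (hf : ∀ H, ∀ᶠ z in leftStrip H, f (z + I * b) - f z =
      c * exp (2 * Real.pi * b * z) * f (z + d)) {A : Finset (ℕ × ℕ)} {σ : ℝ}
    (hA : LeftO σ (opr b A f)) :
    LeftO (σ + b.re) fun z => opr b (succFst A) f (z + I * b) - opr b (succFst A) f z := by
  have h1 : LeftO (σ + b.re) fun z => exp (2 * Real.pi * b * z) * (c * opr b A f (z + d)) :=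
    ((hA.comp_add d).const_mul c).exp_mul b
  refine h1.congr fun H => ?_
  have h2 := opr_eventually_congr (b := b) (f := fun z => f (z + I * b) - f z)
    (g := fun z => exp (2 * Real.pi * b * z) * (c * f (z + d)))
    (fun H => (hf H).mono fun z hz => by simp only [hz]; ring) (succFst A) H
  filter_upwards [h2] with z hz
  rw [opr_succFst, opr_periodic_mul (g := fun _ => c) (fun _ => rfl), opr_comp_add] at hz
  rw [← hz]
  have h3 : (fun z => f (z + I * b) - f z) = (fun z => f (z + I * b)) - f := rfl
  rw [h3, map_sub, Pi.sub_apply, opr_comp_add]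

/-- Bounded functions which decay arbitrarily fast after applying suitable difference operators. -/
def IsTame (b : ℂ) (f : ℂ → ℂ) : Prop := LeftO 0 f ∧ ∀ σ, ∃ A, LeftO σ (opr b A f)

/-- A bounded function with `f(z + ib) - f(z) = c e^{2πbz} f(z + d)` decays arbitrarily fast after
applying suitable difference operators. -/
lemma isTame_of_diff (hb : 0 < b.re) (han : ∀ H, ∀ᶠ z in leftStrip H, AnalyticAt ℂ f z)
    (h0 : LeftO 0 f) (hf : ∀ H, ∀ᶠ z in leftStrip H, f (z + I * b) - f z =
      c * exp (2 * Real.pi * b * z) * f (z + d)) : IsTame b f := by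
  refine ⟨h0, fun σ => ?_⟩
  have hρ := inv_re_pos hb
  set ρ := (b⁻¹).re
  obtain ⟨m, hm⟩ := exists_nat_gt (ρ / b.re)
  -- The rate grows by ρ/M in each round, which must not exceed the gain Re b of the functional
  -- equation.
  obtain ⟨M, hM0, hM⟩ : ∃ M : ℕ, 0 < M ∧ ρ / M ≤ b.re := by
    have hm0 : (0 : ℝ) < m := (div_pos hρ hb).trans hm
    refine ⟨m, by exact_mod_cast hm0, ?_⟩
    rw [div_le_iff₀ hm0, mul_comm]
    exact ((div_lt_iff₀ hb).1 hm).le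
  have hM0' : (0 : ℝ) < M := by exact_mod_cast hM0
  -- The offset 1/2 keeps the rates away from the multiples of ρ, which `exists_expansion` excludes:
  -- (2K - 1)/(2M) is never an integer.
  have key (K : ℕ) : ∃ A, LeftO ((K - 1 / 2) * (ρ / M)) (opr b A f) := by
    induction K with
    | zero =>
      refine ⟨∅, ?_⟩
      rw [opr_empty]
      refine h0.mono ?_
      have : 0 < ρ / M := by positivity
      push_cast; linarith
    | succ K ih =>
      obtain ⟨A, hA⟩ := ih
      -- The integer part of the new rate divided by ρ, so that a row of length q + 1 is needed.
      -- Both inequalities are strict because 2K + 1 is odd.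
      set q := (2 * K + 1) / (2 * M) with hq
      have hdm := Nat.div_add_mod (2 * K + 1) (2 * M)
      have hlt := Nat.mod_lt (2 * K + 1) (show 0 < 2 * M by omega)
      rw [← hq] at hdm
      have hq1 : 2 * M * q < 2 * K + 1 := by
        have : 2 * M * q = 2 * (M * q) := by ring
        omega
      have hq2 : 2 * K + 1 < 2 * M * (q + 1) := by rw [mul_add]; omega
      have hq1' : (2 * M * q : ℝ) < 2 * K + 1 := by exact_mod_cast hq1
      have hq2' : (2 * K + 1 : ℝ) < 2 * M * (q + 1) := by exact_mod_cast hq2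
      have e : ((K + 1 : ℕ) - 1 / 2 : ℝ) * (ρ / M) = (2 * K + 1) / (2 * M) * ρ := by
        push_cast; field_simp; ring
      refine ⟨rowSet (q + 1) ∪ succFst A, ?_⟩
      rw [opr_union (disjoint_rowSet_succFst _ _)]
      refine leftO_opr_rowSet_of_diff hb (Nat.succ_pos q) ?_ ?_ ?_
        (opr_eventually_analyticAt han _) (h0.opr _) ((leftO_opr_succFst_diff hf hA).mono ?_)
      · rw [e]; positivity
      · rw [e]; push_cast; rw [add_sub_cancel_right]
        exact mul_lt_mul_of_pos_right ((lt_div_iff₀ (by positivity)).2 (by linarith)) hρ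
      · rw [e]; push_cast
        exact mul_lt_mul_of_pos_right ((div_lt_iff₀ (by positivity)).2 (by linarith)) hρ
      · push_cast; linarith
  obtain ⟨K, hK⟩ := exists_nat_gt (σ / (ρ / M) + 1 / 2)
  obtain ⟨A, hA⟩ := key K
  refine ⟨A, hA.mono ?_⟩
  have : σ / (ρ / M) ≤ K - 1 / 2 := by linarith
  rwa [div_le_iff₀ (by positivity)] at this

end

lemma leftO_zero_of_tendsto {f : ℂ → ℂ} {c : ℂ} (h : ∀ H, Tendsto f (leftStrip H) (𝓝 c)) :
    LeftO 0 f := fun H => by simpa using (h H).isBigO_one ℝ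

/-- ξ is an entire function of e^{2πix}, and this exponential stays in a disc when Im x is bounded.
-/
lemma xi_bounded (hb : 0 < b.re) {g : ℂ → ℂ} (hg : ∀ H, ∃ C : ℝ, ∀ z : ℂ, |z.im| ≤ H → |(g z).im| ≤ C)
    (H : ℝ) : (fun z => xi b (g z)) =O[leftStrip H] fun _ => (1 : ℝ) := by
  obtain ⟨C, hC⟩ := hg H
  obtain ⟨M, hM⟩ := (isCompact_closedBall (0 : ℂ) (Real.exp (2 * Real.pi * C))).exists_bound_of_continuousOn
    (f := qprod (xiCoeff b)) (differentiable_qprod (summable_xiCoeff hb)).continuous.continuousOn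
  refine Asymptotics.IsBigO.of_bound M ?_
  filter_upwards [eventually_leftStrip_mem H] with z hz
  rw [norm_one, mul_one, xi_eq]
  refine hM _ ?_
  rw [mem_closedBall_zero_iff, norm_exp, Real.exp_le_exp]
  have h1 := hC z hz
  have h2 : (2 * Real.pi * I * g z).re = 2 * Real.pi * -(g z).im := by simp
  rw [h2]
  have := Real.pi_pos
  exact mul_le_mul_of_nonneg_left ((neg_le_abs _).trans h1) (by positivity)

/-- The functional equation, solved for the difference, has the form required by `isTame_of_diff`
with d = ib. -/
lemma isTame_faddeev (hb : 0 < b.re) : IsTame b (faddeev b) := by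
  refine isTame_of_diff (c := -exp (2 * Real.pi * b * (I * b / 2))) (d := I * b) hb
    (fun H => (eventually_poleFactor_ne_zero hb H).mono fun z hz => ?_)
    (leftO_zero_of_tendsto (tendsto_faddeev hb)) (fun H => ?_)
  · exact analyticAt_faddeev hb hz
  · filter_upwards [(tendsto_zeroFactor hb 0 H).eventually_ne one_ne_zero] with z hz
    rw [faddeev_eq_mul hb hz, zeroFactor, neg_mul, ← exp_add]
    have : 2 * Real.pi * b * (z + I * b * ((0 : ℕ) + 1 / 2)) =
        2 * Real.pi * b * (I * b / 2) + 2 * Real.pi * b * z := by push_cast; ring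
    rw [this]; ring

/-- The reciprocal satisfies a difference equation of the same form with d = 0. By the inversion
relation it governs the behaviour of Φ_b at +∞. -/
lemma isTame_div_faddeev (hb : 0 < b.re) (C : ℂ) : IsTame b fun z => C / faddeev b z := by
  have hne (H : ℝ) := (tendsto_faddeev hb H).eventually_ne one_ne_zero
  refine isTame_of_diff (f := fun z => C / faddeev b z)
    (c := exp (2 * Real.pi * b * (I * b / 2))) (d := 0) hb (fun H => ?_)
    (leftO_zero_of_tendsto fun H => Tendsto.div tendsto_const_nhds (tendsto_faddeev hb H) one_ne_zero)
    (fun H => ?_)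
  · filter_upwards [eventually_poleFactor_ne_zero hb H, hne H] with z hz hz'
    exact analyticAt_const.div (analyticAt_faddeev hb hz) hz'
  · filter_upwards [(tendsto_zeroFactor hb 0 H).eventually_ne one_ne_zero, hne H,
      eventually_forall_add hne (I * b) H] with z hz h1 h2
    rw [add_zero, ← exp_add, faddeev_eq_mul hb hz]
    have : 2 * Real.pi * b * (I * b / 2) + 2 * Real.pi * b * z =
        2 * Real.pi * b * (z + I * b * ((0 : ℕ) + 1 / 2)) := by push_cast; ring
    rw [this]
    have h3 : exp (2 * Real.pi * b * (z + I * b * ((0 : ℕ) + 1 / 2))) = zeroFactor b 0 z - 1 := by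
      rw [zeroFactor]; ring
    rw [h3]
    field_simp

lemma IsTame.periodic_mul {f g h : ℂ → ℂ} (hf : IsTame b f) (hg : ∀ z, g (z + 1) = g z)
    (hg' : ∀ H, g =O[leftStrip H] fun _ => (1 : ℝ))
    (hh : ∀ H, ∀ᶠ z in leftStrip H, g z * f z = h z) : IsTame b h := by
  refine ⟨(hf.1.mul_bounded hg').congr hh, fun σ => ?_⟩
  obtain ⟨A, hA⟩ := hf.2 σ
  refine ⟨A, (hA.mul_bounded hg').congr fun H => ?_⟩
  filter_upwards [opr_eventually_congr (b := b) hh A H] with z hz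
  rw [← hz, opr_periodic_mul hg]

lemma isTame_theta (hb : 0 < b.re) : IsTame b (theta b) := by
  refine (isTame_faddeev hb).periodic_mul (g := fun z => xi b (cb b - z)) (fun z => ?_)
    (xi_bounded hb fun H => ⟨|(cb b).im| + H, fun z hz => ?_⟩)
    fun H => (eventually_theta_eq hb H).mono fun z hz => by rw [hz, mul_comm]
  · rw [← xi_add_int b (cb b - (z + 1)) 1]; congr 1; push_cast; ring
  · rw [sub_im]
    exact (abs_sub _ _).trans (by linarith)

/-- The function `e^{-πiz²} Θ(-z)`. -/
def thetaDual (b z : ℂ) : ℂ := exp (-(Real.pi * I * z ^ 2)) * theta b (-z)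

lemma differentiable_thetaDual (hb : 0 < b.re) : Differentiable ℂ (thetaDual b) := by
  have := differentiable_theta hb
  unfold thetaDual; fun_prop

/-- Far to the left e^{-πiz²} Φ_b(-z) equals Φ_b(0)² / Φ_b(z) by inversion. The other factor ξ(c_b +
z) is 1-periodic and bounded on strips. -/
lemma isTame_thetaDual (hb : 0 < b.re) : IsTame b (thetaDual b) := by
  refine (isTame_div_faddeev hb (faddeevIntegral b 0 ^ 2)).periodic_mul
    (g := fun z => xi b (cb b + z)) (fun z => ?_)
    (xi_bounded hb fun H => ⟨|(cb b).im| + H, fun z hz => ?_⟩) fun H => ?_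
  · rw [← xi_add_int b (cb b + z) 1]; congr 1; push_cast; ring
  · rw [add_im]
    exact (abs_add_le _ _).trans (by linarith)
  · filter_upwards [eventually_theta_neg_eq hb H, eventually_faddeev_mul_neg hb H,
      (tendsto_faddeev hb H).eventually_ne one_ne_zero] with z h1 h2 h3
    have h4 : faddeevIntegral b 0 ^ 2 / faddeev b z =
        exp (-(Real.pi * I * z ^ 2)) * faddeev b (-z) := by
      rw [div_eq_iff h3, mul_assoc, mul_comm (faddeev b (-z)), h2, mul_left_comm, ← exp_add]
      simp
    rw [h4, thetaDual, h1]; ring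

end WGZ

end

noncomputable section

namespace WGZ

open Filter MeasureTheory Set
open scoped BoundedContinuousFunction

/-! ### Analyticity of series in two variables -/

lemma norm_single_one_le (j n : ℕ) : ‖(Pi.single j 1 : ℕ → ℂ) n‖ ≤ 1 := by
  by_cases h : n = j
  · subst h; simp
  · simp [Pi.single_eq_of_ne h]

/-- The sequence `δ_j` as a bounded function. -/
def deltaSeq (j : ℕ) : ℕ →ᵇ ℂ :=
  BoundedContinuousFunction.ofNormedAddCommGroupDiscrete (Pi.single j 1) 1 (norm_single_one_le j)

lemma norm_deltaSeq_le (j : ℕ) : ‖deltaSeq j‖ ≤ 1 :=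
  BoundedContinuousFunction.norm_ofNormedAddCommGroup_le _ zero_le_one (norm_single_one_le j)

lemma norm_evalCLM_le (j : ℕ) : ‖BoundedContinuousFunction.evalCLM ℂ (β := ℂ) j‖ ≤ 1 :=
  ContinuousLinearMap.opNorm_le_bound _ zero_le_one fun f => by
    rw [one_mul]; exact f.norm_coe_le_norm j

/-- The sum is the pairing of a bounded sequence depending on the first variable with a functional
depending on the second. Each is analytic in one variable as a normally convergent series, and
evaluation is bilinear, so joint analyticity follows. -/
lemma analyticAt_tsum_mul {f g : ℕ → ℂ → ℂ} {U V : Set ℂ} (hU : IsOpen U) (hV : IsOpen V)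
    {p q : ℕ → ℝ} (hp : Summable p) (hq : Summable q) (hf : ∀ j, DifferentiableOn ℂ (f j) U)
    (hg : ∀ j, DifferentiableOn ℂ (g j) V) (hfp : ∀ j, ∀ x ∈ U, ‖f j x‖ ≤ p j)
    (hgq : ∀ j, ∀ y ∈ V, ‖g j y‖ ≤ q j) {z : ℂ × ℂ} (h1 : z.1 ∈ U) (h2 : z.2 ∈ V) :
    AnalyticAt ℂ (fun z : ℂ × ℂ => ∑' j, f j z.1 * g j z.2) z := by
  set π : ℕ → (ℕ →ᵇ ℂ) →L[ℂ] ℂ := fun j => BoundedContinuousFunction.evalCLM ℂ j with hπ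
  set A : ℂ → ℕ →ᵇ ℂ := fun x => ∑' j, f j x • deltaSeq j with hA
  set L : ℂ → (ℕ →ᵇ ℂ) →L[ℂ] ℂ := fun y => ∑' j, g j y • π j with hL
  have hfA (j : ℕ) (x : ℂ) (hx : x ∈ U) : ‖f j x • deltaSeq j‖ ≤ p j := by
    rw [norm_smul]
    exact (mul_le_of_le_one_right (norm_nonneg _) (norm_deltaSeq_le j)).trans (hfp j x hx)
  have hgL (j : ℕ) (y : ℂ) (hy : y ∈ V) : ‖g j y • π j‖ ≤ q j := by
    rw [norm_smul]
    exact (mul_le_of_le_one_right (norm_nonneg _) (norm_evalCLM_le j)).trans (hgq j y hy)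
  have dA : DifferentiableOn ℂ A U := differentiableOn_tsum_of_summable_norm hp
    (fun j => (hf j).smul_const _) hU hfA
  have dL : DifferentiableOn ℂ L V := differentiableOn_tsum_of_summable_norm hq
    (F := fun j y => g j y • π j) (fun j => (hg j).smul_const (π j)) hV hgL
  have aA : AnalyticAt ℂ (fun z : ℂ × ℂ => A z.1) z :=
    AnalyticAt.fun_comp (g := A) (dA.analyticAt (hU.mem_nhds h1)) analyticAt_fst
  have aL : AnalyticAt ℂ (fun z : ℂ × ℂ => L z.2) z :=
    AnalyticAt.fun_comp (g := L) (dL.analyticAt (hV.mem_nhds h2)) analyticAt_snd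
  have aB := (ContinuousLinearMap.id ℂ ((ℕ →ᵇ ℂ) →L[ℂ] ℂ)).analyticAt_bilinear (L z.2, A z.1)
  have key : AnalyticAt ℂ (fun z : ℂ × ℂ => L z.2 (A z.1)) z :=
    AnalyticAt.fun_comp (f := fun z : ℂ × ℂ => (L z.2, A z.1)) aB (aL.prod aA)
  refine key.congr ?_
  filter_upwards [(hU.preimage continuous_fst).mem_nhds h1,
    (hV.preimage continuous_snd).mem_nhds h2] with w hw1 hw2
  have sA : Summable fun j => f j w.1 • deltaSeq j :=
    .of_norm_bounded hp fun j => hfA j _ hw1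
  have sL : Summable fun j => g j w.2 • π j := .of_norm_bounded hq fun j => hgL j _ hw2
  have eA (j : ℕ) : π j (A w.1) = f j w.1 := by
    rw [hA, (π j).map_tsum sA, tsum_eq_single j]
    · simp [hπ, deltaSeq]
    · intro k hk
      simp [hπ, deltaSeq, Pi.single_eq_of_ne hk.symm]
  have : L w.2 (A w.1) = ∑' j, (g j w.2 • π j) (A w.1) :=
    (ContinuousLinearMap.apply ℂ ℂ (A w.1)).map_tsum sL
  rw [this]
  refine tsum_congr fun j => ?_
  rw [_root_.smul_apply, eA, smul_eq_mul, mul_comm]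

/-! ### One-sided Zak series -/

/-- The `j`-th term of the one-sided series `∑_{j ≥ 0} f(x - 1 - j) e^{-2πi(j+1)y}`. -/
def zakTerm (f : ℂ → ℂ) (x y : ℂ) (j : ℕ) : ℂ :=
  f (x - 1 - j) * exp (-(2 * Real.pi * I * (j + 1) * y))

/-- The one-sided series `∑_{j ≥ 0} f(x - 1 - j) e^{-2πi(j+1)y}`. -/
def zakSum (f : ℂ → ℂ) (p : ℂ × ℂ) : ℂ := ∑' j, zakTerm f p.1 p.2 j

lemma LeftO.bound_of_continuous {f : ℂ → ℂ} {σ : ℝ} (hf : LeftO σ f) (hc : Continuous f) (H X : ℝ) :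
    ∃ C : ℝ, 0 ≤ C ∧ ∀ z : ℂ, z.re ≤ X → |z.im| ≤ H →
      ‖f z‖ ≤ C * Real.exp (2 * Real.pi * σ * z.re) := by
  obtain ⟨C, R, hC, hR⟩ := hf.bound H
  obtain ⟨M, hM⟩ := ((isCompact_Icc (a := R) (b := X)).reProdIm
    (isCompact_Icc (a := -H) (b := H))).exists_bound_of_continuousOn
    (f := fun z => f z * exp (-(2 * Real.pi * σ * (z.re : ℂ)))) (by fun_prop)
  refine ⟨max C M, hC.trans (le_max_left _ _), fun z hz hz' => ?_⟩
  rcases le_total z.re R with h | h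
  · exact (hR z h hz').trans (mul_le_mul_of_nonneg_right (le_max_left _ _) (Real.exp_pos _).le)
  · have h1 := hM z ⟨⟨h, hz⟩, abs_le.1 hz'⟩
    have h2 : ‖exp (-(2 * Real.pi * σ * (z.re : ℂ)))‖ = (Real.exp (2 * Real.pi * σ * z.re))⁻¹ := by
      rw [norm_exp, ← Real.exp_neg]; congr 1
      simp
    rw [norm_mul, h2, ← div_eq_mul_inv, div_le_iff₀ (Real.exp_pos _)] at h1
    exact h1.trans (mul_le_mul_of_nonneg_right (le_max_right _ _) (Real.exp_pos _).le)

lemma norm_exp_zak (y : ℂ) (j : ℕ) : ‖exp (-(2 * Real.pi * I * (j + 1) * y))‖ =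
    Real.exp (2 * Real.pi * y.im) ^ (j + 1) := by
  rw [norm_exp, ← Real.exp_nat_mul]; congr 1; simp; ring

section
variable {f : ℂ → ℂ} {σ : ℝ}

lemma norm_le_of_leftO (hf : LeftO σ f) (hc : Continuous f) (x₀ : ℂ) : ∃ C : ℝ, ∀ (j : ℕ),
    ∀ x ∈ Metric.ball x₀ 1, ‖f (x - 1 - j)‖ ≤ C * Real.exp (-(2 * Real.pi * σ)) ^ (j + 1) := by
  obtain ⟨C, hC, h⟩ := hf.bound_of_continuous hc (|x₀.im| + 1) (x₀.re + 1)
  refine ⟨C * Real.exp (2 * Real.pi * (|σ| * (|x₀.re| + 1))), fun j x hx => ?_⟩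
  rw [Metric.mem_ball, dist_eq] at hx
  have h1 : |x.re - x₀.re| ≤ 1 := by
    rw [← sub_re]; exact (abs_re_le_norm _).trans hx.le
  have h2 : |x.im - x₀.im| ≤ 1 := by
    rw [← sub_im]; exact (abs_im_le_norm _).trans hx.le
  have hj : (0 : ℝ) ≤ j := Nat.cast_nonneg j
  have e1 : (x - 1 - j).re = x.re - 1 - j := by simp
  have e2 : (x - 1 - j).im = x.im := by simp
  refine (h _ ?_ ?_).trans ?_
  · rw [e1]; linarith [le_abs_self (x.re - x₀.re)]
  · rw [e2]
    have := abs_sub_abs_le_abs_sub x.im x₀.im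
    linarith
  · rw [e1, mul_assoc C, ← Real.exp_nat_mul, ← Real.exp_add]
    refine mul_le_mul_of_nonneg_left (Real.exp_le_exp.2 ?_) hC
    have h3 : σ * x.re ≤ |σ| * (|x₀.re| + 1) := by
      refine (le_abs_self _).trans ?_
      rw [abs_mul]
      refine mul_le_mul_of_nonneg_left ?_ (abs_nonneg _)
      have := abs_sub_abs_le_abs_sub x.re x₀.re
      linarith
    have := mul_le_mul_of_nonneg_left h3 (show 0 ≤ 2 * Real.pi by positivity)
    push_cast
    linarith

lemma summable_zakTerm (hf : LeftO σ f) (hc : Continuous f) (x : ℂ) {y : ℂ} (hy : y.im < σ) :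
    Summable (zakTerm f x y) := by
  obtain ⟨C, hC⟩ := norm_le_of_leftO hf hc x
  have hr : Real.exp (2 * Real.pi * (y.im - σ)) < 1 :=
    Real.exp_lt_one_iff.2 (mul_neg_of_pos_of_neg (by positivity) (by linarith))
  have hs : Summable fun j : ℕ => C * Real.exp (2 * Real.pi * (y.im - σ)) ^ (j + 1) :=
    (((summable_nat_add_iff 1).2 (summable_geometric_of_lt_one (Real.exp_pos _).le hr))).mul_left C
  refine .of_norm_bounded hs fun j => ?_
  rw [zakTerm, norm_mul, norm_exp_zak]
  refine (mul_le_mul_of_nonneg_right (hC j x (Metric.mem_ball_self one_pos))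
    (by positivity)).trans (le_of_eq ?_)
  rw [mul_assoc, ← mul_pow, ← Real.exp_add]; congr 3; ring

lemma analyticAt_zakSum (hf : LeftO σ f) (hd : Differentiable ℂ f) {p : ℂ × ℂ} (hp : p.2.im < σ) :
    AnalyticAt ℂ (zakSum f) p := by
  obtain ⟨C, hC⟩ := norm_le_of_leftO hf hd.continuous p.1
  obtain ⟨s, hs1, hs2⟩ := exists_between hp
  -- The weights e^{±2πm(j + 1)}, with s < m < σ, are distributed over the two factors so that each
  -- has a geometric majorant of its own.
  set m := (s + σ) / 2 with hm
  have hlt {t : ℝ} (ht : t < 0) : Real.exp (2 * Real.pi * t) < 1 :=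
    Real.exp_lt_one_iff.2 (mul_neg_of_pos_of_neg (by positivity) ht)
  have hsum {t : ℝ} (ht : t < 0) : Summable fun j : ℕ => Real.exp (2 * Real.pi * t) ^ (j + 1) :=
    (summable_nat_add_iff 1).2 (summable_geometric_of_lt_one (Real.exp_pos _).le (hlt ht))
  have key := analyticAt_tsum_mul (U := Metric.ball p.1 1) (V := {y | y.im < s}) (z := p)
    (f := fun j x => f (x - 1 - j) * Real.exp (2 * Real.pi * m) ^ (j + 1))
    (g := fun j y => exp (-(2 * Real.pi * I * (j + 1) * y)) * Real.exp (-(2 * Real.pi * m)) ^ (j + 1))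
    Metric.isOpen_ball (isOpen_lt continuous_im continuous_const)
    ((hsum (t := m - σ) (by rw [hm]; linarith)).mul_left C) (hsum (t := s - m) (by rw [hm]; linarith))
    (fun j => by fun_prop) (fun j => by fun_prop) (fun j x hx => ?_) (fun j y hy => ?_)
    (Metric.mem_ball_self one_pos) hs1
  · refine key.congr (.of_forall fun q => tsum_congr fun j => ?_)
    have : ((Real.exp (2 * Real.pi * m) : ℂ) ^ (j + 1)) *
        ((Real.exp (-(2 * Real.pi * m)) : ℂ) ^ (j + 1)) = 1 := by
      rw [← mul_pow, ← ofReal_mul, ← Real.exp_add, add_neg_cancel, Real.exp_zero, ofReal_one,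
        one_pow]
    rw [zakTerm, mul_mul_mul_comm, this, mul_one]
  · rw [norm_mul, norm_pow, norm_real, Real.norm_eq_abs, Real.abs_exp]
    refine (mul_le_mul_of_nonneg_right (hC j x hx) (by positivity)).trans (le_of_eq ?_)
    rw [mul_assoc, ← mul_pow, ← Real.exp_add]; congr 3; ring
  · rw [norm_mul, norm_pow, norm_real, Real.norm_eq_abs, Real.abs_exp, norm_exp_zak, ← mul_pow,
      ← Real.exp_add]
    refine pow_le_pow_left₀ (Real.exp_pos _).le (Real.exp_le_exp.2 ?_) _
    have : y.im < s := hy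
    nlinarith [Real.pi_pos]

end

end WGZ

end

noncomputable section

namespace WGZ

open Filter MeasureTheory Set

/-! ### Entire extension of the one-sided series -/

variable {b : ℂ} {f : ℂ → ℂ}

lemma zakTerm_comp_add_zero (f : ℂ → ℂ) (x y : ℂ) :
    zakTerm (fun z => f (z + 1)) x y 0 = exp (-(2 * Real.pi * I * y)) * f x := by
  simp [zakTerm, mul_comm]

lemma zakTerm_comp_add_succ (f : ℂ → ℂ) (x y : ℂ) (j : ℕ) :
    zakTerm (fun z => f (z + 1)) x y (j + 1) = exp (-(2 * Real.pi * I * y)) * zakTerm f x y j := by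
  have e : -(2 * Real.pi * I * ((j + 1 : ℕ) + 1) * y) =
      -(2 * Real.pi * I * y) + -(2 * Real.pi * I * (j + 1) * y) := by push_cast; ring
  have e' : x - 1 - (j + 1 : ℕ) + 1 = x - 1 - j := by push_cast; ring
  rw [zakTerm, zakTerm, e, e', exp_add]; ring

/-- Replacing f by f(· + 1) shifts the index by one: the series is multiplied by e^{-2πiy} and
acquires a boundary term from f(x), which is entire if f is. -/
lemma zakSum_sub_mul (q : ℂ) {x y : ℂ} (hs : Summable (zakTerm f x y)) :
    zakSum (fun z => f z - q * f (z + 1)) (x, y) =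
      (1 - q * exp (-(2 * Real.pi * I * y))) * zakSum f (x, y) -
        q * exp (-(2 * Real.pi * I * y)) * f x := by
  have hs1 : Summable (zakTerm (fun z => f (z + 1)) x y) := by
    refine (summable_nat_add_iff 1).1 ?_
    simp_rw [zakTerm_comp_add_succ]
    exact hs.mul_left _
  have h1 : zakSum (fun z => f (z + 1)) (x, y) =
      exp (-(2 * Real.pi * I * y)) * (f x + zakSum f (x, y)) := by
    rw [zakSum, hs1.tsum_eq_zero_add]
    simp_rw [zakTerm_comp_add_succ, zakTerm_comp_add_zero]
    rw [tsum_mul_left, zakSum]; ring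
  have h2 (j : ℕ) : zakTerm (fun z => f z - q * f (z + 1)) x y j =
      zakTerm f x y j - q * zakTerm (fun z => f (z + 1)) x y j := by
    simp only [zakTerm]; ring
  have h3 : zakSum (fun z => f z - q * f (z + 1)) (x, y) =
      zakSum f (x, y) - q * zakSum (fun z => f (z + 1)) (x, y) := by
    simp only [zakSum, h2]
    rw [hs.tsum_sub (hs1.mul_left q), tsum_mul_left]
  rw [h3, h1]; ring

lemma analyticAt_comp_fst (hf : Differentiable ℂ f) (p : ℂ × ℂ) :
    AnalyticAt ℂ (fun p : ℂ × ℂ => f p.1) p :=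
  AnalyticAt.fun_comp (g := f) (hf.analyticAt _) analyticAt_fst

lemma analyticAt_comp_snd (hf : Differentiable ℂ f) (p : ℂ × ℂ) :
    AnalyticAt ℂ (fun p : ℂ × ℂ => f p.2) p :=
  AnalyticAt.fun_comp (g := f) (hf.analyticAt _) analyticAt_snd

/-- Applying difference operators multiplies the series by a polynomial in `e^{-2πiy}`, up to an
entire function. -/
lemma exists_zakSum_opr (h0 : LeftO 0 f) (hf : Differentiable ℂ f) (A : Finset (ℕ × ℕ)) :
    ∃ B : ℂ × ℂ → ℂ, AnalyticOnNhd ℂ B univ ∧ ∀ p : ℂ × ℂ, p.2.im < 0 →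
      zakSum (opr b A f) p =
        (∏ a ∈ A, (1 - xiCoeff b a * exp (-(2 * Real.pi * I * p.2)))) * zakSum f p + B p := by
  induction A using Finset.induction_on with
  | empty => exact ⟨0, analyticOnNhd_const, fun p _ => by simp⟩
  | insert a A ha ih =>
    obtain ⟨B, hB, h⟩ := ih
    refine ⟨fun p => (1 - xiCoeff b a * exp (-(2 * Real.pi * I * p.2))) * B p -
      xiCoeff b a * exp (-(2 * Real.pi * I * p.2)) * opr b A f p.1, fun p _ => ?_, fun p hp => ?_⟩
    · have e1 : AnalyticAt ℂ (fun p : ℂ × ℂ => 1 - xiCoeff b a * exp (-(2 * Real.pi * I * p.2))) p :=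
        analyticAt_comp_snd (f := fun y => 1 - xiCoeff b a * exp (-(2 * Real.pi * I * y)))
          (by fun_prop) p
      have e2 : AnalyticAt ℂ (fun p : ℂ × ℂ => xiCoeff b a * exp (-(2 * Real.pi * I * p.2))) p :=
        analyticAt_comp_snd (f := fun y => xiCoeff b a * exp (-(2 * Real.pi * I * y)))
          (by fun_prop) p
      exact (e1.mul (hB p (mem_univ p))).sub (e2.mul (analyticAt_comp_fst (differentiable_opr hf A) p))
    · have e : opr b (insert a A) f = fun z => opr b A f z - xiCoeff b a * opr b A f (z + 1) :=
        funext fun z => opr_insert ha f z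
      have hs := summable_zakTerm (h0.opr (b := b) A) (differentiable_opr hf A).continuous p.1 hp
      rw [e, ← Prod.mk.eta (p := p), zakSum_sub_mul _ hs, h _ hp, Finset.prod_insert ha]
      ring

lemma isPreconnected_im_lt (r : ℝ) : IsPreconnected {p : ℂ × ℂ | p.2.im < r} := by
  have : Convex ℝ {p : ℂ × ℂ | p.2.im < r} :=
    (convex_Iio r).linear_preimage (Complex.imLm.comp (LinearMap.snd ℝ ℂ ℂ))
  exact this.isPreconnected

lemma isOpen_im_lt (r : ℝ) : IsOpen {p : ℂ × ℂ | p.2.im < r} :=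
  isOpen_lt (continuous_im.comp continuous_snd) continuous_const

/-- Analytic continuation along the exhaustion of `ℂ²` by the sets `Im y < n`. -/
lemma exists_entire_of_forall_nat {g : ℂ × ℂ → ℂ} (h : ∀ n : ℕ, ∃ G : ℂ × ℂ → ℂ,
      AnalyticOnNhd ℂ G {p | p.2.im < n} ∧ ∀ p : ℂ × ℂ, p.2.im < 0 → G p = g p) :
    ∃ F : ℂ × ℂ → ℂ, AnalyticOnNhd ℂ F univ ∧ ∀ p : ℂ × ℂ, p.2.im < 0 → F p = g p := by
  choose G hG hGg using h
  have hle (m n : ℕ) (hmn : m ≤ n) {p : ℂ × ℂ} (hp : p.2.im < m) : G m p = G n p := by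
    have hn : AnalyticOnNhd ℂ (G n) {p | p.2.im < m} := (hG n).mono fun p hp => by
      have : (m : ℝ) ≤ n := by exact_mod_cast hmn
      exact lt_of_lt_of_le hp this
    -- Both functions equal g near this point, and the identity theorem applies on the convex set Im
    -- y < m.
    have h0 : ((0, -I) : ℂ × ℂ) ∈ {p : ℂ × ℂ | p.2.im < 0} := by simp
    refine (hG m).eqOn_of_preconnected_of_eventuallyEq hn (isPreconnected_im_lt m)
      (z₀ := (0, -I)) ?_ ?_ hp
    · have : (0 : ℝ) ≤ m := Nat.cast_nonneg m
      rw [mem_ofPred_eq, neg_im, I_im]; linarith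
    · filter_upwards [(isOpen_im_lt 0).mem_nhds h0] with q hq
      rw [hGg m q hq, hGg n q hq]
  -- The natural floor is 0 for negative Im y, so the inequality holds there too.
  have hnat (p : ℂ × ℂ) : p.2.im < (⌊p.2.im⌋₊ + 1 : ℕ) := by
    push_cast; exact Nat.lt_floor_add_one _
  refine ⟨fun p => G (⌊p.2.im⌋₊ + 1) p, fun p _ => ?_, fun p hp => hGg _ p hp⟩
  refine (hG _ p (hnat p)).congr ?_
  filter_upwards [(isOpen_im_lt _).mem_nhds (hnat p)] with q hq
  rcases le_total (⌊p.2.im⌋₊ + 1) (⌊q.2.im⌋₊ + 1) with h | h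
  · exact hle _ _ h hq
  · exact (hle _ _ h (hnat q)).symm

/-- On Im y < n let A be the operators giving decay of rate n. Then ξ(-y) is the finite product over
A times an entire remainder, and the finite product times the series of f is the series of `opr b A
f`, convergent for Im y < n, minus an entire function. -/
lemma exists_entire_zakSum (hb : 0 < b.re) (hd : Differentiable ℂ f) (hf : IsTame b f) :
    ∃ F : ℂ × ℂ → ℂ, AnalyticOnNhd ℂ F univ ∧ ∀ p : ℂ × ℂ, p.2.im < 0 →
      F p = xi b (-p.2) * zakSum f p := by
  refine exists_entire_of_forall_nat fun n => ?_
  obtain ⟨A, hA⟩ := hf.2 n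
  obtain ⟨B, hB, h⟩ := exists_zakSum_opr (b := b) hf.1 hd A
  have hsum := summable_xiCoeff hb
  have hsum' : Summable fun i : ((A : Set (ℕ × ℕ))ᶜ : Set (ℕ × ℕ)) => ‖xiCoeff b i‖ :=
    hsum.subtype _
  set R : ℂ → ℂ := fun y => qprod (fun i : ((A : Set (ℕ × ℕ))ᶜ : Set (ℕ × ℕ)) => xiCoeff b i)
    (exp (-(2 * Real.pi * I * y))) with hR
  have hRd : Differentiable ℂ R := (differentiable_qprod hsum').comp (by fun_prop)
  refine ⟨fun p => R p.2 * (zakSum (opr b A f) p - B p), fun p hp => ?_, fun p hp => ?_⟩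
  · exact (analyticAt_comp_snd hRd p).mul
      ((analyticAt_zakSum hA (differentiable_opr hd A) hp).sub (hB p (mem_univ p)))
  · have e : 2 * Real.pi * I * -p.2 = -(2 * Real.pi * I * p.2) := by ring
    simp only [hR]
    rw [h p hp, xi_eq, qprod_eq_prod_mul hsum A, e]
    ring

end WGZ

end

noncomputable section

namespace WGZ

open Filter MeasureTheory Set

/-! ### The Weil–Gel'fand–Zak transform of the quantum dilogarithm -/

variable {b : ℂ}

lemma wgzTerm_theta_neg (b x y : ℂ) (j : ℕ) :
    wgzTerm (theta b) x y (-((j : ℤ) + 1)) = zakTerm (theta b) x y j := by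
  rw [wgzTerm, zakTerm]; push_cast; congr 2 <;> ring

/-- The exponential relating the two halves of the series. -/
def halfPhase (p : ℂ × ℂ) : ℂ :=
  exp (Real.pi * I * p.1 ^ 2 + 2 * Real.pi * I * -(p.1 + p.2 + 1 / 2))

lemma exp_pi_I_mul_sq (j : ℕ) : exp (Real.pi * I * (j : ℂ) ^ 2) = exp (Real.pi * I * j) := by
  have e (n : ℕ) : exp (Real.pi * I * n) = (-1) ^ n := by
    rw [mul_comm, exp_nat_mul, exp_pi_mul_I]
  have h := e (j ^ 2)
  rw [Nat.cast_pow] at h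
  rw [h, e, sq, pow_mul]
  rcases Nat.even_or_odd j with hj | hj
  · rw [hj.neg_one_pow, one_pow]
  · rw [hj.neg_one_pow, hj.neg_one_pow]

/-- The exponent πi(x + j)² is expanded, and e^{πij²} = e^{πij} makes its quadratic part linear in
j. This parity factor is the origin of the shift 1/2 in χ. -/
lemma wgzTerm_theta_nat (b x y : ℂ) (j : ℕ) : wgzTerm (theta b) x y j =
    halfPhase (x, y) * zakTerm (thetaDual b) (1 - x) (-(x + y + 1 / 2)) j := by
  have e1 : -(1 - x - 1 - (j : ℂ)) = x + j := by ring
  have e2 : exp (-(Real.pi * I * (1 - x - 1 - (j : ℂ)) ^ 2)) = exp (-(Real.pi * I * x ^ 2)) *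
      exp (-(2 * Real.pi * I * x * j)) * exp (-(Real.pi * I * j)) := by
    rw [exp_neg (Real.pi * I * j), ← exp_pi_I_mul_sq, ← exp_neg, ← exp_add, ← exp_add]
    congr 1; ring
  have e3 : exp (2 * Real.pi * I * j * y) = halfPhase (x, y) *
      (exp (-(Real.pi * I * x ^ 2)) * exp (-(2 * Real.pi * I * x * j)) * exp (-(Real.pi * I * j))) *
        exp (-(2 * Real.pi * I * (j + 1) * -(x + y + 1 / 2))) := by
    rw [halfPhase, ← exp_add, ← exp_add, ← exp_add, ← exp_add]
    congr 1; ring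
  rw [wgzTerm, zakTerm, thetaDual, e1, e2, Int.cast_natCast, e3]
  ring

lemma im_dual_neg {p : ℂ × ℂ} (hp : p ∈ seriesDomain) : (-(p.1 + p.2 + 1 / 2)).im < 0 := by
  have : ((1 / 2 : ℂ)).im = 0 := by norm_num
  rw [neg_im, add_im, add_im, this]
  linarith [hp.2]

lemma hasSum_wgzTerm_theta (hb : 0 < b.re) {p : ℂ × ℂ} (hp : p ∈ seriesDomain) :
    HasSum (wgzTerm (theta b) p.1 p.2) (halfPhase p *
      zakSum (thetaDual b) (1 - p.1, -(p.1 + p.2 + 1 / 2)) + zakSum (theta b) p) := by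
  refine HasSum.of_nat_of_neg_add_one ?_ ?_
  · simp_rw [wgzTerm_theta_nat]
    exact (summable_zakTerm (isTame_thetaDual hb).1 (differentiable_thetaDual hb).continuous _
      (im_dual_neg hp)).hasSum.mul_left _
  · simp_rw [wgzTerm_theta_neg]
    exact (summable_zakTerm (isTame_theta hb).1 (differentiable_theta hb).continuous _
      (by linarith [hp.1])).hasSum

/-- By periodicity ξ(c_b - ·) takes the same nonzero value at all points x + m, so it can be taken
out of the series. -/
lemma wgzTerm_faddeev_mul (hb : 0 < b.re) {x : ℂ} (hx : xi b (cb b - x) ≠ 0) (y : ℂ) (m : ℤ) :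
    wgzTerm (faddeev b) x y m = (xi b (cb b - x))⁻¹ * wgzTerm (theta b) x y m := by
  have e : xi b (cb b - (x + m)) = xi b (cb b - x) := by
    rw [← xi_add_int b (cb b - (x + m)) m]; congr 1; ring
  rw [wgzTerm, wgzTerm, theta_eq hb (e ▸ hx), e]
  field_simp

lemma hasSum_wgzTerm_faddeev (hb : 0 < b.re) {p : ℂ × ℂ} (hp : p ∈ seriesDomain)
    (hx : xi b (cb b - p.1) ≠ 0) :
    HasSum (wgzTerm (faddeev b) p.1 p.2) ((xi b (cb b - p.1))⁻¹ * (halfPhase p *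
      zakSum (thetaDual b) (1 - p.1, -(p.1 + p.2 + 1 / 2)) + zakSum (theta b) p)) := by
  have := (hasSum_wgzTerm_theta hb hp).mul_left (xi b (cb b - p.1))⁻¹
  simpa only [← wgzTerm_faddeev_mul hb hx] using this

/-- Each half of the series is continued by its own factor ξ(-y) or ξ(x + y + 1/2); the extension
multiplies each by the factor belonging to the other half and adds. -/
lemma exists_entire_extension (hb : 0 < b.re) : ∃ F : ℂ × ℂ → ℂ, AnalyticOnNhd ℂ F univ ∧
    ∀ p ∈ seriesDomain, xi b (cb b - p.1) ≠ 0 → F p = phi b p * chi b p := by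
  obtain ⟨G, hG, hGe⟩ := exists_entire_zakSum hb (differentiable_theta hb) (isTame_theta hb)
  obtain ⟨G', hG', hGe'⟩ :=
    exists_entire_zakSum hb (differentiable_thetaDual hb) (isTame_thetaDual hb)
  have a1 (p : ℂ × ℂ) : AnalyticAt ℂ (fun p : ℂ × ℂ => p.1) p := analyticAt_fst
  have a2 (p : ℂ × ℂ) : AnalyticAt ℂ (fun p : ℂ × ℂ => p.2) p := analyticAt_snd
  have a3 (p : ℂ × ℂ) : AnalyticAt ℂ (fun p : ℂ × ℂ => p.1 + p.2 + 1 / 2) p :=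
    ((a1 p).add (a2 p)).add analyticAt_const
  have hxi (z : ℂ) : AnalyticAt ℂ (xi b) z := (differentiable_xi hb).analyticAt z
  refine ⟨fun p => exp (Real.pi * I * p.1 * p.2) * (xi b (p.1 + p.2 + 1 / 2) * G p +
    xi b (-p.2) * halfPhase p * G' (1 - p.1, -(p.1 + p.2 + 1 / 2))), fun p _ => ?_,
    fun p hp hx => ?_⟩
  · refine AnalyticAt.mul ?_ (AnalyticAt.add (AnalyticAt.mul ?_ (hG p (mem_univ p)))
      (AnalyticAt.mul (AnalyticAt.mul ?_ ?_) ?_))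
    · exact ((analyticAt_const.mul (a1 p)).mul (a2 p)).cexp
    · exact AnalyticAt.fun_comp (g := xi b) (hxi _) (a3 p)
    · exact AnalyticAt.fun_comp (g := xi b) (hxi _) (a2 p).neg
    · exact ((analyticAt_const.mul ((a1 p).pow 2)).add (analyticAt_const.mul (a3 p).neg)).cexp
    · exact AnalyticAt.fun_comp (g := G') (hG' _ (mem_univ _))
        ((analyticAt_const.sub (a1 p)).prod (a3 p).neg)
  · have h1 := hGe p (by linarith [hp.1])
    have h2 := hGe' (1 - p.1, -(p.1 + p.2 + 1 / 2)) (im_dual_neg hp)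
    rw [neg_neg] at h2
    simp only [phi, wgz, chi]
    rw [h1, h2, (hasSum_wgzTerm_faddeev hb hp hx).tsum_eq]
    field_simp
    ring

end WGZ

end

/-! ### Meromorphic continuation of the transform -/

theorem mainTheorem4 (b : ℂ) (hb : 0 < b.re) :
    -- the double product defining `ξ` converges, and `χ` is entire
    (∀ x : ℂ, Multipliable (WGZ.xiFactor b x)) ∧
    AnalyticOnNhd ℂ (WGZ.chi b) Set.univ ∧
    -- `F` is the entire extension of `φ_b χ`, and `Φ` the meromorphic extension of `φ_b`
    ∃ F Φ : ℂ × ℂ → ℂ,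
      AnalyticOnNhd ℂ F Set.univ ∧
      WGZ.IsMeromorphicWithPolesIn Φ {p | WGZ.chi b p = 0} ∧
      (∀ p : ℂ × ℂ, WGZ.chi b p ≠ 0 → Φ p * WGZ.chi b p = F p) ∧
      ∀ p ∈ WGZ.seriesDomain, WGZ.chi b p ≠ 0 →
        Summable (WGZ.wgzTerm (WGZ.faddeev b) p.1 p.2) ∧
        Φ p = WGZ.phi b p ∧
        F p = WGZ.phi b p * WGZ.chi b p := by
  obtain ⟨F, hF, hFe⟩ := WGZ.exists_entire_extension hb
  have hχ := WGZ.analyticOnNhd_chi hb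
  have hcont : Continuous (WGZ.chi b) := continuousOn_univ.1 hχ.continuousOn
  -- The extension is the global quotient F / χ, which also serves as the local quotient at every
  -- point.
  refine ⟨WGZ.multipliable_xiFactor hb, hχ, F, fun p => F p / WGZ.chi b p, hF,
    ⟨isClosed_singleton.preimage hcont, WGZ.interior_chi_zero hb, fun p hp => ?_, fun p => ?_⟩,
    fun p hp => div_mul_cancel₀ _ hp, fun p hp hne => ?_⟩
  · exact (hF p (Set.mem_univ p)).div (hχ p (Set.mem_univ p)) hp
  · exact ⟨Set.univ, Filter.univ_mem, F, WGZ.chi b, hF, hχ, fun q hq => ⟨hq.2, rfl⟩⟩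
  · have hx : WGZ.xi b (WGZ.cb b - p.1) ≠ 0 := left_ne_zero_of_mul (left_ne_zero_of_mul hne)
    have h := hFe p hp hx
    exact ⟨(WGZ.hasSum_wgzTerm_faddeev hb hp hx).summable, by simp only [h]; field_simp, h⟩
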